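/- For integers $N\ge 2$ and $1\le d\le N-1$ with $dN$ even, let $G_{N,d}$ be a graph drawn uniformly at random from the set of all simple $d$-regular graphs on $[N]=\{1,\dots,N\}$. For a simple graph $T$ whose vertices are in $[N]$, with edges $e_1,\dots,e_n$, define the edge-correlation function $$\mathfrak C_{N}(T)=\mathbb E\Big[\prod_{i=1}^n\big(\mathbb 1_{\{e_i\in G_{N,d}\}}-\mathbb P(e_i\in G_{N,d})\big)\Big].$$ (Here $\mathbb P(e\in G_{N,d})=d/(N-1)$ for every pair $e$ of distinct vertices.) Theorem. Let $(d_N)_{N\ge2}$ be integers with $1\le d_N\le N-1$ and $d_N N$ even, and let $\eta\in\mathbb R$ be a constant such that, as $N\to\infty$, $$d_N\to\infty,\qquad N-d_N\to\infty,\qquad \Big|\frac N2-d_N-\eta\sqrt{d_N}\Big|\to\infty .$$ Then for every fixed finite simple graph $T$ with $n$ edges, the function $\mathfrak C_N$ of $G_{N,d_N}$ satisfies $$\mathfrak C_N(T)=\Big(\frac{d_N}{N}\Big)^n\, O\big(d_N^{-n/2}\big)\qquad(N\to\infty).$$ That is, there is a constant $C$ (depending on $T$ and on the sequence $(d_N)$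 only) such that for all sufficiently large $N$ and every injective labelling $\varphi$ of the vertices of $T$ by elements of $[N]$, $|\mathfrak C_N(\varphi(T))|\le C\,(d_N/N)^n\,d_N^{-n/2}$. -/

import Mathlib

open Filter Topology Finset

noncomputable section

open Classical in
/-- The finite set of all simple `d`-regular graphs on the vertex set `{0, …, N - 1}`. -/
def regularGraphs (N d : ℕ) : Finset (SimpleGraph (Fin N)) :=
  Finset.univ.filter fun G => G.IsRegularOfDegree d

/-- The expectation `𝔼[f(G)]`, where `G` is the uniform `d`-regular graph on `N` vertices, that is
a graph drawn uniformly at random from the finite set of all simple `d`-regular graphs. -/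
def uniformRegularExpectation (N d : ℕ) (f : SimpleGraph (Fin N) → ℝ) : ℝ :=
  (∑ G ∈ regularGraphs N d, f G) / ((regularGraphs N d).card : ℝ)

open Classical in
/-- The indicator `G(e)` of the event that `e` is an edge of `G`. -/
def edgeIndicator {N : ℕ} (e : Sym2 (Fin N)) (G : SimpleGraph (Fin N)) : ℝ :=
  if e ∈ G.edgeSet then 1 else 0

/-- The probability `ℙ(e ∈ G)` for the uniform `d`-regular graph `G` on `N` vertices. -/
def edgeProbability (N d : ℕ) (e : Sym2 (Fin N)) : ℝ :=
  uniformRegularExpectation N d (edgeIndicator e)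

open Classical in
/-- The edge-correlation function
`𝔼[∏_{e ∈ T} (G(e) - ℙ(e ∈ G))]` of the uniform `d`-regular graph `G` on `N` vertices,
for a simple graph `T` on the same vertex set. -/
def edgeCorrelation (N d : ℕ) (T : SimpleGraph (Fin N)) : ℝ :=
  uniformRegularExpectation N d fun G =>
    ∏ e ∈ T.edgeFinset, (edgeIndicator e G - edgeProbability N d e)

end

/-! Write `x_uv` for the centred adjacency entries, `p = d/(N-1)` and `s = √d/N`. The claim is that
correlations of `n` edges are `O(s^n)`. Complementing a graph only flips the sign of every `x_uv`,
so `p ≤ 1/2` may be assumed (`corr_compl`).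

The probabilistic input is the switching that exchanges the edges `ij, kl` with `ik, jl`, together
with invariance under relabelling. Uniformity gives a discrete integration by parts
(`expectation_mul_switchPoly`): the expectation of `F` times a cubic polynomial in the four entries
is the expected change of `F` under the switching, restricted to graphs where the switching is
possible. For `F = ∏_{e ∈ T} x_e` with `T` untouched this vanishes. Sum over `k, l` outside a
bounded set `U` containing `i`, `j` and the vertices of `T`. Row sums of `x` vanish, so most terms
collapse, leaving `p(1-p)N² 𝔼[F x_ij] ≈ -∑_{k,l} 𝔼[F x_ik x_kl x_lj]`. Hence an edge may be replaced
by a path of length three through new vertices at the cost of a factor `2/p`, up to an error that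
already carries the desired factor `s` (`abs_corr_insert_le`).

The bound is proved by induction on the number `n` of edges whose factor has been improved from `p`
to `s`, simultaneously for all numbers of edges (`CorrBound`, `corrWeight`). The case `n = 0` bounds
the probability of containing a fixed graph, again by switching (`abs_corr_le_edgeDensity_pow`). In
the inductive step each replacement adds two edges worth `p²` and costs `2/p`, so errors do not grow
under iteration (`abs_corr_insert_le_iterate`). It remains to make the last term, with one long
path, negligible.

If `p` is below a small negative power of `N`, the net factor `p` per replacement suffices.
Otherwise the correlation of a long path equals its average over the inner vertices, by
exchangeability. Cauchy–Schwarz bounds this average by moments of `Y = tr(x⁴)/N⁴`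
(`abs_pathCorr_le`), and `𝔼[Y^t] = O((pN)^(-t))` (`exists_expectation_fourthTrace_pow_le`) follows
from the integration by parts with test functions `(x³)_ij Y^t`. -/

/-! ### Linearity and positivity of the expectation -/

section Expectation

variable {N d : ℕ}

theorem uniformRegularExpectation_congr {f g : SimpleGraph (Fin N) → ℝ}
    (h : ∀ G ∈ regularGraphs N d, f G = g G) :
    uniformRegularExpectation N d f = uniformRegularExpectation N d g := by
  unfold uniformRegularExpectation
  rw [Finset.sum_congr rfl h]

theorem uniformRegularExpectation_add (f g : SimpleGraph (Fin N) → ℝ) :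
    uniformRegularExpectation N d (fun G => f G + g G) =
      uniformRegularExpectation N d f + uniformRegularExpectation N d g := by
  unfold uniformRegularExpectation
  rw [Finset.sum_add_distrib, add_div]

theorem uniformRegularExpectation_sub (f g : SimpleGraph (Fin N) → ℝ) :
    uniformRegularExpectation N d (fun G => f G - g G) =
      uniformRegularExpectation N d f - uniformRegularExpectation N d g := by
  unfold uniformRegularExpectation
  rw [Finset.sum_sub_distrib, sub_div]

theorem uniformRegularExpectation_mul_left (c : ℝ) (f : SimpleGraph (Fin N) → ℝ) :
    uniformRegularExpectation N d (fun G => c * f G) =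
      c * uniformRegularExpectation N d f := by
  unfold uniformRegularExpectation
  rw [← Finset.mul_sum, mul_div_assoc]

theorem uniformRegularExpectation_sum {ι : Type*} (s : Finset ι)
    (f : ι → SimpleGraph (Fin N) → ℝ) :
    uniformRegularExpectation N d (fun G => ∑ i ∈ s, f i G) =
      ∑ i ∈ s, uniformRegularExpectation N d (f i) := by
  unfold uniformRegularExpectation
  rw [Finset.sum_comm, Finset.sum_div]

theorem uniformRegularExpectation_mono {f g : SimpleGraph (Fin N) → ℝ}
    (h : ∀ G ∈ regularGraphs N d, f G ≤ g G) :
    uniformRegularExpectation N d f ≤ uniformRegularExpectation N d g := by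
  unfold uniformRegularExpectation
  exact div_le_div_of_nonneg_right (Finset.sum_le_sum h) (Nat.cast_nonneg _)

theorem uniformRegularExpectation_nonneg {f : SimpleGraph (Fin N) → ℝ}
    (h : ∀ G ∈ regularGraphs N d, 0 ≤ f G) : 0 ≤ uniformRegularExpectation N d f :=
  div_nonneg (Finset.sum_nonneg h) (Nat.cast_nonneg _)

theorem abs_uniformRegularExpectation_le (f : SimpleGraph (Fin N) → ℝ) :
    |uniformRegularExpectation N d f| ≤ uniformRegularExpectation N d (fun G => |f G|) := by
  unfold uniformRegularExpectation
  rw [abs_div, Nat.abs_cast]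
  exact div_le_div_of_nonneg_right (Finset.abs_sum_le_sum_abs _ _) (Nat.cast_nonneg _)

/-- Only an inequality, with a sign condition: if there is no `d`-regular graph, the expectation is
`0 / 0 = 0`. -/
theorem uniformRegularExpectation_const_le {c : ℝ} (hc : 0 ≤ c) :
    uniformRegularExpectation N d (fun _ => c) ≤ c := by
  unfold uniformRegularExpectation
  rw [Finset.sum_const, nsmul_eq_mul]
  rcases eq_or_ne ((regularGraphs N d).card : ℝ) 0 with h | h
  · simpa [h] using hc
  · rw [mul_div_cancel_left₀ _ h]

theorem abs_uniformRegularExpectation_le_of_le {f : SimpleGraph (Fin N) → ℝ} {c : ℝ} (hc : 0 ≤ c)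
    (h : ∀ G ∈ regularGraphs N d, |f G| ≤ c) : |uniformRegularExpectation N d f| ≤ c :=
  (abs_uniformRegularExpectation_le f).trans
    ((uniformRegularExpectation_mono h).trans (uniformRegularExpectation_const_le hc))

end Expectation

/-! ### Indicators, centred indicators and the switching -/

section Switching

variable {N d : ℕ}

theorem mem_regularGraphs {G : SimpleGraph (Fin N)} :
    G ∈ regularGraphs N d ↔ ∀ u, ∑ v, edgeIndicator s(u, v) G = d := by
  classical
  unfold regularGraphs
  rw [Finset.mem_filter]
  simp only [Finset.mem_univ, true_and]
  have key : ∀ u, ∑ v, edgeIndicator s(u, v) G = (G.degree u : ℝ) := by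
    intro u
    rw [← SimpleGraph.card_neighborFinset_eq_degree, SimpleGraph.neighborFinset_eq_filter]
    simp only [edgeIndicator, SimpleGraph.mem_edgeSet]
    rw [Finset.sum_boole]
  constructor
  · intro h u
    rw [key]
    have := h u
    exact_mod_cast (by convert this)
  · intro h u
    have := h u
    rw [key] at this
    have h2 : G.degree u = d := by exact_mod_cast this
    convert h2

theorem edgeIndicator_zero_or_one (e : Sym2 (Fin N)) (G : SimpleGraph (Fin N)) :
    edgeIndicator e G = 0 ∨ edgeIndicator e G = 1 := by
  unfold edgeIndicator
  split_ifs <;> simp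

theorem edgeIndicator_nonneg (e : Sym2 (Fin N)) (G : SimpleGraph (Fin N)) :
    0 ≤ edgeIndicator e G := by
  rcases edgeIndicator_zero_or_one e G with h | h <;> simp [h]

theorem edgeIndicator_le_one (e : Sym2 (Fin N)) (G : SimpleGraph (Fin N)) :
    edgeIndicator e G ≤ 1 := by
  rcases edgeIndicator_zero_or_one e G with h | h <;> simp [h]

theorem edgeIndicator_diag (u : Fin N) (G : SimpleGraph (Fin N)) :
    edgeIndicator s(u, u) G = 0 := by
  simp [edgeIndicator]

/-- The four pairs toggled by the switching. -/
def switchPairs (i j k l : Fin N) : Finset (Sym2 (Fin N)) :=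
  {s(i, j), s(k, l), s(i, k), s(j, l)}

/-- Toggle the four pairs `ij`, `kl`, `ik`, `jl`. -/
noncomputable def switchGraph (i j k l : Fin N) (G : SimpleGraph (Fin N)) : SimpleGraph (Fin N) :=
  symmDiff G (SimpleGraph.fromEdgeSet (switchPairs i j k l : Set (Sym2 (Fin N))))

theorem switchGraph_switchGraph (i j k l : Fin N) (G : SimpleGraph (Fin N)) :
    switchGraph i j k l (switchGraph i j k l G) = G :=
  symmDiff_symmDiff_cancel_right _ _

theorem edgeIndicator_switchGraph_of_notMem {i j k l : Fin N} {e : Sym2 (Fin N)}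
    (he : e ∉ switchPairs i j k l) (G : SimpleGraph (Fin N)) :
    edgeIndicator e (switchGraph i j k l G) = edgeIndicator e G := by
  classical
  induction e with
  | h u v =>
    unfold edgeIndicator switchGraph
    have : (symmDiff G (SimpleGraph.fromEdgeSet (switchPairs i j k l : Set (Sym2 (Fin N))))).Adj u v
        ↔ G.Adj u v := by
      simp [symmDiff, he]
    simp only [SimpleGraph.mem_edgeSet, this]

theorem edgeIndicator_switchGraph_of_mem {i j k l : Fin N} {e : Sym2 (Fin N)}
    (he : e ∈ switchPairs i j k l) (hd : ¬ e.IsDiag) (G : SimpleGraph (Fin N)) :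
    edgeIndicator e (switchGraph i j k l G) = 1 - edgeIndicator e G := by
  classical
  induction e with
  | h u v =>
    unfold edgeIndicator switchGraph
    have huv : u ≠ v := by simpa using hd
    have : (symmDiff G (SimpleGraph.fromEdgeSet (switchPairs i j k l : Set (Sym2 (Fin N))))).Adj u v
        ↔ ¬ G.Adj u v := by
      simp [symmDiff, he, huv]
    simp only [SimpleGraph.mem_edgeSet, this]
    split_ifs <;> simp

/-- The matrix of signs of the pairs changed by the switching. -/
noncomputable def switchSign (i j k l u v : Fin N) : ℝ :=
  (if u = i then 1 else 0) * ((if v = k then 1 else 0) - (if v = j then 1 else 0)) +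
  (if u = j then 1 else 0) * ((if v = l then 1 else 0) - (if v = i then 1 else 0)) +
  (if u = k then 1 else 0) * ((if v = i then 1 else 0) - (if v = l then 1 else 0)) +
  (if u = l then 1 else 0) * ((if v = j then 1 else 0) - (if v = k then 1 else 0))

/-- Each of the four vertices loses one neighbour and gains one; this is why switchings preserve
regularity. -/
theorem sum_switchSign (i j k l u : Fin N) : ∑ v, switchSign i j k l u v = 0 := by
  simp [switchSign, Finset.sum_add_distrib]

/-- The event that `ij`, `kl` are edges and `ik`, `jl` are not, as a `0`-`1`-valued function. -/
noncomputable def switchable (i j k l : Fin N) (G : SimpleGraph (Fin N)) : ℝ :=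
  edgeIndicator s(i, j) G * edgeIndicator s(k, l) G *
    (1 - edgeIndicator s(i, k) G) * (1 - edgeIndicator s(j, l) G)

theorem switchable_eq_zero_or (i j k l : Fin N) (G : SimpleGraph (Fin N)) :
    switchable i j k l G = 0 ∨ (switchable i j k l G = 1 ∧ edgeIndicator s(i, j) G = 1 ∧
      edgeIndicator s(k, l) G = 1 ∧ edgeIndicator s(i, k) G = 0 ∧ edgeIndicator s(j, l) G = 0) := by
  unfold switchable
  rcases edgeIndicator_zero_or_one s(i, j) G with h1 | h1 <;>
  rcases edgeIndicator_zero_or_one s(k, l) G with h2 | h2 <;>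
  rcases edgeIndicator_zero_or_one s(i, k) G with h3 | h3 <;>
  rcases edgeIndicator_zero_or_one s(j, l) G with h4 | h4 <;>
  simp [h1, h2, h3, h4]

/-- The four vertices of a switching are distinct. -/
def Distinct4 (i j k l : Fin N) : Prop := i ≠ j ∧ i ≠ k ∧ i ≠ l ∧ j ≠ k ∧ j ≠ l ∧ k ≠ l

theorem edgeIndicator_switchGraph {i j k l : Fin N} (h : Distinct4 i j k l)
    {G : SimpleGraph (Fin N)} (hG : switchable i j k l G ≠ 0) (u v : Fin N) :
    edgeIndicator s(u, v) (switchGraph i j k l G) =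
      edgeIndicator s(u, v) G + switchSign i j k l u v := by
  obtain ⟨hij, hik, hil, hjk, hjl, hkl⟩ := h
  obtain ⟨-, h1, h2, h3, h4⟩ := (switchable_eq_zero_or i j k l G).resolve_left hG
  by_cases hm : s(u, v) ∈ switchPairs i j k l
  · have hd : ¬ (s(u, v)).IsDiag := by
      intro hd
      have : u = v := by simpa using hd
      subst this
      simp only [switchPairs, Finset.mem_insert, Finset.mem_singleton, Sym2.eq_iff] at hm
      grind
    rw [edgeIndicator_switchGraph_of_mem hm hd]
    simp only [switchPairs, Finset.mem_insert, Finset.mem_singleton] at hm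
    have hm' := hm
    simp only [Sym2.eq_iff] at hm'
    rcases hm with hm | hm | hm | hm <;> rw [hm] <;> simp only [h1, h2, h3, h4] <;>
      rw [Sym2.eq_iff] at hm <;> rcases hm with ⟨rfl, rfl⟩ | ⟨rfl, rfl⟩ <;>
      simp [switchSign, *, Ne.symm hij, Ne.symm hik, Ne.symm hil, Ne.symm hjk, Ne.symm hjl, Ne.symm hkl]
  · rw [edgeIndicator_switchGraph_of_notMem hm]
    simp only [switchPairs, Finset.mem_insert, Finset.mem_singleton, Sym2.eq_iff, not_or,
      not_and] at hm
    have : switchSign i j k l u v = 0 := by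
      unfold switchSign
      by_cases e1 : u = i
      · subst e1; simp_all
      · by_cases e2 : u = j
        · subst e2; simp_all
        · by_cases e3 : u = k
          · subst e3; simp_all
          · by_cases e4 : u = l
            · subst e4; simp_all
            · simp [e1, e2, e3, e4]
    rw [this, add_zero]

theorem switchGraph_mem_regularGraphs {i j k l : Fin N} (h : Distinct4 i j k l)
    {G : SimpleGraph (Fin N)} (hG : switchable i j k l G ≠ 0) (hr : G ∈ regularGraphs N d) :
    switchGraph i j k l G ∈ regularGraphs N d := by
  rw [mem_regularGraphs] at hr ⊢
  intro u
  simp_rw [edgeIndicator_switchGraph h hG]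
  rw [Finset.sum_add_distrib, sum_switchSign, hr, add_zero]

theorem switchGraph_comm (i j k l : Fin N) (G : SimpleGraph (Fin N)) :
    switchGraph i k j l G = switchGraph i j k l G := by
  unfold switchGraph switchPairs
  congr 3
  ext e
  simp only [Finset.mem_insert, Finset.mem_singleton]
  tauto

/-- Toggling turns the edges `ij`, `kl` into non-edges and `ik`, `jl` into edges, so the inverse
switching has `j` and `k` interchanged. -/
theorem switchable_switchGraph {i j k l : Fin N} (h : Distinct4 i j k l)
    (G : SimpleGraph (Fin N)) :
    switchable i k j l (switchGraph i j k l G) = switchable i j k l G := by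
  obtain ⟨hij, hik, hil, hjk, hjl, hkl⟩ := h
  unfold switchable
  rw [edgeIndicator_switchGraph_of_mem (e := s(i, k)) (by simp [switchPairs]) (by simpa using hik),
    edgeIndicator_switchGraph_of_mem (e := s(j, l)) (by simp [switchPairs]) (by simpa using hjl),
    edgeIndicator_switchGraph_of_mem (e := s(i, j)) (by simp [switchPairs]) (by simpa using hij),
    edgeIndicator_switchGraph_of_mem (e := s(k, l)) (by simp [switchPairs]) (by simpa using hkl)]
  ring

/-- Toggling is a bijection between the regular graphs admitting the switching and those admitting
its inverse, and the measure is uniform. -/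
theorem expectation_switchable {i j k l : Fin N} (h : Distinct4 i j k l)
    (F : SimpleGraph (Fin N) → ℝ) :
    uniformRegularExpectation N d (fun G => switchable i j k l G * F G) =
      uniformRegularExpectation N d
        (fun G => switchable i k j l G * F (switchGraph i j k l G)) := by
  have h' : Distinct4 i k j l := by
    obtain ⟨hij, hik, hil, hjk, hjl, hkl⟩ := h
    exact ⟨hik, hij, hil, hjk.symm, hkl, hjl⟩
  unfold uniformRegularExpectation
  congr 1
  -- Toggling need not preserve regularity for an arbitrary graph, so the bijection is set up on the
  -- nonzero terms only.
  refine Finset.sum_bij_ne_zero (fun G _ _ => switchGraph i j k l G) ?_ ?_ ?_ ?_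
  · intro G hG hne
    exact switchGraph_mem_regularGraphs h (left_ne_zero_of_mul hne) hG
  · intro G₁ _ _ G₂ _ _ heq
    rw [← switchGraph_switchGraph i j k l G₁, heq, switchGraph_switchGraph]
  · intro G hG hne
    have h0 := left_ne_zero_of_mul hne
    refine ⟨switchGraph i j k l G, ?_, ?_, switchGraph_switchGraph _ _ _ _ _⟩
    · rw [← switchGraph_comm]
      exact switchGraph_mem_regularGraphs h' h0 hG
    · rw [show switchable i j k l (switchGraph i j k l G) = switchable i k j l G from by
        rw [← switchGraph_comm]; exact switchable_switchGraph h' G]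
      exact hne
  · intro G _ _
    rw [switchable_switchGraph h, switchGraph_switchGraph]

end Switching

/-! ### Relabelling and complementation -/

section Symmetry

variable {N d : ℕ}

theorem edgeIndicator_comap (σ : Equiv.Perm (Fin N)) (G : SimpleGraph (Fin N)) (u v : Fin N) :
    edgeIndicator s(u, v) (G.comap σ) = edgeIndicator s(σ u, σ v) G := by
  classical
  unfold edgeIndicator
  exact if_congr (by rw [SimpleGraph.mem_edgeSet, SimpleGraph.mem_edgeSet, SimpleGraph.comap_adj]) rfl rfl

theorem comap_mem_regularGraphs (σ : Equiv.Perm (Fin N)) {G : SimpleGraph (Fin N)}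
    (hG : G ∈ regularGraphs N d) : G.comap σ ∈ regularGraphs N d := by
  rw [mem_regularGraphs] at hG ⊢
  intro u
  simp_rw [edgeIndicator_comap]
  rw [Equiv.sum_comp σ (fun v => edgeIndicator s(σ u, v) G), hG]

theorem uniformRegularExpectation_comap (σ : Equiv.Perm (Fin N)) (f : SimpleGraph (Fin N) → ℝ) :
    uniformRegularExpectation N d (fun G => f (G.comap σ)) = uniformRegularExpectation N d f := by
  unfold uniformRegularExpectation
  congr 1
  have key : ∀ (τ : Equiv.Perm (Fin N)) (G : SimpleGraph (Fin N)),
      (G.comap τ).comap τ.symm = G := by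
    intro τ G
    ext u v
    simp
  refine Finset.sum_bij' (fun G _ => G.comap σ) (fun G _ => G.comap σ.symm)
    (fun G hG => comap_mem_regularGraphs σ hG) (fun G hG => comap_mem_regularGraphs _ hG)
    (fun G _ => key σ G) (fun G _ => key σ.symm G) (fun G _ => rfl)

/-- The common edge density of `d`-regular graphs on `N` vertices. -/
noncomputable def edgeDensity (N d : ℕ) : ℝ := (d : ℝ) / ((N : ℝ) - 1)

/-- The centred indicator of an edge. -/
noncomputable def cen (N d : ℕ) (e : Sym2 (Fin N)) (G : SimpleGraph (Fin N)) : ℝ :=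
  edgeIndicator e G - edgeDensity N d

/-- The centred adjacency matrix, with zero diagonal. -/
noncomputable def cmat (N d : ℕ) (u v : Fin N) (G : SimpleGraph (Fin N)) : ℝ :=
  if u = v then 0 else cen N d s(u, v) G

/-- The correlation function of a set of pairs. -/
noncomputable def corr (N d : ℕ) (T : Finset (Sym2 (Fin N))) : ℝ :=
  uniformRegularExpectation N d fun G => ∏ e ∈ T, cen N d e G

theorem cmat_self (u : Fin N) (G : SimpleGraph (Fin N)) : cmat N d u u G = 0 := by simp [cmat]

theorem cmat_of_ne {u v : Fin N} (h : u ≠ v) (G : SimpleGraph (Fin N)) :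
    cmat N d u v G = cen N d s(u, v) G := by simp [cmat, h]

theorem cmat_comm (u v : Fin N) (G : SimpleGraph (Fin N)) :
    cmat N d u v G = cmat N d v u G := by
  simp [cmat, eq_comm, Sym2.eq_swap]

theorem cmat_comap (σ : Equiv.Perm (Fin N)) (G : SimpleGraph (Fin N)) (u v : Fin N) :
    cmat N d u v (G.comap σ) = cmat N d (σ u) (σ v) G := by
  simp [cmat, cen, edgeIndicator_comap]

theorem cmat_eq (u v : Fin N) (G : SimpleGraph (Fin N)) :
    cmat N d u v G = edgeIndicator s(u, v) G - (edgeDensity N d - if v = u then edgeDensity N d else 0) := by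
  by_cases h : v = u
  · subst h; simp [cmat_self, edgeIndicator_diag]
  · simp [cmat_of_ne (Ne.symm h), cen, h]

theorem sum_cmat (hN : 2 ≤ N) {G : SimpleGraph (Fin N)} (hG : G ∈ regularGraphs N d)
    (u : Fin N) : ∑ v, cmat N d u v G = 0 := by
  rw [mem_regularGraphs] at hG
  simp_rw [cmat_eq]
  rw [Finset.sum_sub_distrib, hG, Finset.sum_sub_distrib]
  have : (N : ℝ) - 1 ≠ 0 := by
    have : (2 : ℝ) ≤ N := by exact_mod_cast hN
    linarith
  simp [edgeDensity]
  field_simp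
  ring

/-- By exchangeability all pairs at `u` are equally likely, and these `N - 1` probabilities add up
to the degree `d`. -/
theorem edgeProbability_eq (hN : 2 ≤ N) (hne : (regularGraphs N d).Nonempty)
    {e : Sym2 (Fin N)} (he : ¬ e.IsDiag) : edgeProbability N d e = edgeDensity N d := by
  induction e with
  | h u v =>
    have huv : u ≠ v := by simpa using he
    have hN1 : (N : ℝ) - 1 ≠ 0 := by
      have : (2 : ℝ) ≤ N := by exact_mod_cast hN
      linarith
    have hconst : ∀ w, w ≠ u → edgeProbability N d s(u, w) = edgeProbability N d s(u, v) := by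
      intro w hw
      unfold edgeProbability
      rw [← uniformRegularExpectation_comap (Equiv.swap v w)]
      refine uniformRegularExpectation_congr fun G _ => ?_
      rw [edgeIndicator_comap, Equiv.swap_apply_of_ne_of_ne huv hw.symm, Equiv.swap_apply_right]
    have hsum : ∑ w, edgeProbability N d s(u, w) = d := by
      unfold edgeProbability
      rw [← uniformRegularExpectation_sum]
      rw [uniformRegularExpectation_congr (g := fun _ => (d : ℝ))
        (fun G hG => mem_regularGraphs.1 hG u)]
      unfold uniformRegularExpectation
      rw [Finset.sum_const, nsmul_eq_mul, mul_div_cancel_left₀]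
      exact_mod_cast hne.card_pos.ne'
    rw [← Finset.add_sum_erase _ _ (Finset.mem_univ u)] at hsum
    have h0 : edgeProbability N d s(u, u) = 0 := by
      unfold edgeProbability
      simp [edgeIndicator_diag, uniformRegularExpectation]
    rw [h0, zero_add, Finset.sum_congr rfl
      (fun w hw => hconst w (Finset.ne_of_mem_erase hw)), Finset.sum_const, nsmul_eq_mul,
      Finset.card_erase_of_mem (Finset.mem_univ _)] at hsum
    simp only [Finset.card_univ, Fintype.card_fin] at hsum
    rw [Nat.cast_sub (by omega)] at hsum
    unfold edgeDensity
    rw [eq_div_iff hN1, ← hsum]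
    push_cast
    ring

theorem edgeIndicator_compl {e : Sym2 (Fin N)} (he : ¬ e.IsDiag) (G : SimpleGraph (Fin N)) :
    edgeIndicator e Gᶜ = 1 - edgeIndicator e G := by
  classical
  induction e with
  | h u v =>
    have huv : u ≠ v := by simpa using he
    simp only [edgeIndicator, SimpleGraph.mem_edgeSet, SimpleGraph.compl_adj, ne_eq, huv,
      not_false_eq_true, true_and]
    split_ifs <;> simp

theorem compl_mem_regularGraphs (hd : d ≤ N - 1) {G : SimpleGraph (Fin N)}
    (hG : G ∈ regularGraphs N d) : Gᶜ ∈ regularGraphs N (N - 1 - d) := by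
  rw [mem_regularGraphs] at hG ⊢
  intro u
  have hN : 1 ≤ N := Nat.one_le_of_lt u.2
  have key : ∀ v, edgeIndicator s(u, v) Gᶜ =
      (1 - if v = u then 1 else 0) - edgeIndicator s(u, v) G := by
    intro v
    by_cases h : v = u
    · subst h; simp [edgeIndicator_diag]
    · rw [edgeIndicator_compl (by simpa using Ne.symm h)]; simp [h]
  simp_rw [key]
  rw [Finset.sum_sub_distrib, hG, Finset.sum_sub_distrib]
  simp
  rw [Nat.cast_sub hd, Nat.cast_sub hN]
  simp

/-- Complementation sends degree `d` to `N - 1 - d` and each centred indicator to its negative. -/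
theorem corr_compl (hN : 2 ≤ N) (hd : d ≤ N - 1) {T : Finset (Sym2 (Fin N))}
    (hT : ∀ e ∈ T, ¬ e.IsDiag) : |corr N d T| = |corr N (N - 1 - d) T| := by
  have hN1 : (N : ℝ) - 1 ≠ 0 := by
    have : (2 : ℝ) ≤ N := by exact_mod_cast hN
    linarith
  have hdens : edgeDensity N (N - 1 - d) = 1 - edgeDensity N d := by
    unfold edgeDensity
    rw [Nat.cast_sub hd, Nat.cast_sub (by omega)]
    field_simp
    push_cast
    ring
  have hdd : N - 1 - (N - 1 - d) = d := by omega
  have hcen : ∀ G, ∏ e ∈ T, cen N d e Gᶜ = (-1) ^ T.card * ∏ e ∈ T, cen N (N - 1 - d) e G := by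
    intro G
    rw [← Finset.prod_const, ← Finset.prod_mul_distrib]
    refine Finset.prod_congr rfl fun e he => ?_
    rw [cen, cen, edgeIndicator_compl (hT e he), hdens]
    ring
  have : corr N d T = (-1) ^ T.card * corr N (N - 1 - d) T := by
    unfold corr
    rw [← uniformRegularExpectation_mul_left]
    simp_rw [← hcen]
    unfold uniformRegularExpectation
    have hbij : ∀ f : SimpleGraph (Fin N) → ℝ,
        ∑ G ∈ regularGraphs N d, f G = ∑ G ∈ regularGraphs N (N - 1 - d), f Gᶜ := by
      intro f
      refine Finset.sum_bij' (fun G _ => Gᶜ) (fun G _ => Gᶜ)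
        (fun G hG => compl_mem_regularGraphs hd hG) (fun G hG => ?_)
        (fun G _ => compl_compl G) (fun G _ => compl_compl G) (fun G _ => by rw [compl_compl])
      have := compl_mem_regularGraphs (by omega) hG
      rwa [hdd] at this
    have hcard : ((regularGraphs N d).card : ℝ) = (regularGraphs N (N - 1 - d)).card := by
      have := hbij fun _ => 1
      simpa using this
    rw [hbij, hcard]
  rw [this, abs_mul, abs_pow, abs_neg, abs_one, one_pow, one_mul]

theorem edgeCorrelation_eq_corr (hN : 2 ≤ N) (T : SimpleGraph (Fin N))
    [Fintype T.edgeSet] : edgeCorrelation N d T = corr N d T.edgeFinset := by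
  classical
  rcases (regularGraphs N d).eq_empty_or_nonempty with h | h
  · simp [edgeCorrelation, corr, uniformRegularExpectation, h]
  · unfold edgeCorrelation corr
    congr 1
    ext G
    have : (∏ e ∈ T.edgeFinset, cen N d e G) =
        ∏ e ∈ T.edgeFinset, (edgeIndicator e G - edgeProbability N d e) := by
      refine Finset.prod_congr rfl fun e he => ?_
      rw [edgeProbability_eq hN h (T.not_isDiag_of_mem_edgeFinset he), cen]
    rw [this]
    congr!

end Symmetry

/-! ### The switching identity -/

section SwitchIdentity

variable {N d : ℕ}

/-- The polynomial identity satisfied in expectation by the entries of a switching. -/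
def switchPoly (p a b c e : ℝ) : ℝ :=
  p * (1 - p) * (a + b - c - e) + (1 - 2 * p) * (a * b - c * e) - a * b * (c + e) +
    c * e * (a + b)

/-- Under `A = p + x` the constant terms, the quartic terms and the mixed quadratic terms such as
`x_ij x_ik` cancel in the difference; this is where `switchPoly` comes from. -/
theorem switchable_sub_switchable {i j k l : Fin N} (h : Distinct4 i j k l)
    (G : SimpleGraph (Fin N)) :
    switchable i j k l G - switchable i k j l G =
      switchPoly (edgeDensity N d) (cmat N d i j G) (cmat N d k l G) (cmat N d i k G)
        (cmat N d j l G) := by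
  obtain ⟨hij, hik, hil, hjk, hjl, hkl⟩ := h
  rw [cmat_of_ne hij, cmat_of_ne hkl, cmat_of_ne hik, cmat_of_ne hjl]
  unfold switchable switchPoly cen
  ring

/-- A discrete integration by parts, used in two ways: the right-hand side is zero if `F` ignores
the four pairs, and small if `F` varies slowly. -/
theorem expectation_mul_switchPoly {i j k l : Fin N} (h : Distinct4 i j k l)
    (F : SimpleGraph (Fin N) → ℝ) :
    uniformRegularExpectation N d (fun G => F G * switchPoly (edgeDensity N d) (cmat N d i j G)
      (cmat N d k l G) (cmat N d i k G) (cmat N d j l G)) =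
    uniformRegularExpectation N d
      (fun G => switchable i k j l G * (F (switchGraph i j k l G) - F G)) := by
  simp_rw [← switchable_sub_switchable h, mul_sub]
  rw [uniformRegularExpectation_sub, uniformRegularExpectation_sub, ← expectation_switchable h]
  congr 2 <;> ext G <;> ring

theorem expectation_mul_switchPoly_eq_zero {i j k l : Fin N} (h : Distinct4 i j k l)
    {F : SimpleGraph (Fin N) → ℝ} (hF : ∀ G, F (switchGraph i j k l G) = F G) :
    uniformRegularExpectation N d (fun G => F G * switchPoly (edgeDensity N d) (cmat N d i j G)
      (cmat N d k l G) (cmat N d i k G) (cmat N d j l G)) = 0 := by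
  rw [expectation_mul_switchPoly h]
  simp [hF, uniformRegularExpectation]

end SwitchIdentity

/-! ### The probability of containing a fixed graph -/

section SubgraphProbability

variable {N d : ℕ}

/-- The set of vertices covered by a set of pairs. -/
def pairSupport (T : Finset (Sym2 (Fin N))) : Finset (Fin N) := T.biUnion fun e => e.toFinset

theorem mem_pairSupport {T : Finset (Sym2 (Fin N))} {v : Fin N} :
    v ∈ pairSupport T ↔ ∃ e ∈ T, v ∈ e := by
  simp [pairSupport]

theorem card_pairSupport_le (T : Finset (Sym2 (Fin N))) :
    (pairSupport T).card ≤ 2 * T.card := by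
  refine Finset.card_biUnion_le.trans ?_
  rw [mul_comm]
  refine Finset.sum_le_card_nsmul _ _ _ fun e _ => ?_
  by_cases h : e.IsDiag
  · rw [Sym2.card_toFinset_of_isDiag _ h]; norm_num
  · rw [Sym2.card_toFinset_of_not_isDiag _ h]

theorem notMem_switchPairs {T : Finset (Sym2 (Fin N))} {U : Finset (Fin N)}
    (hU : ∀ e ∈ T, ∀ v ∈ e, v ∈ U) {i j k l : Fin N} (hij : s(i, j) ∉ T) (hk : k ∉ U)
    (hl : l ∉ U) {e : Sym2 (Fin N)} (he : e ∈ T) : e ∉ switchPairs i j k l := by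
  intro hm
  simp only [switchPairs, Finset.mem_insert, Finset.mem_singleton] at hm
  rcases hm with rfl | rfl | rfl | rfl
  · exact hij he
  · exact hk (hU _ he k (by simp))
  · exact hk (hU _ he k (by simp))
  · exact hl (hU _ he l (by simp))

theorem edgeDensity_nonneg (hN : 2 ≤ N) : 0 ≤ edgeDensity N d := by
  have : (2 : ℝ) ≤ N := by exact_mod_cast hN
  exact div_nonneg (Nat.cast_nonneg _) (by linarith)

theorem edgeDensity_le_half (hN : 2 ≤ N) (hd : 2 * d ≤ N - 1) : edgeDensity N d ≤ 1 / 2 := by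
  have h2 : (2 : ℝ) ≤ N := by exact_mod_cast hN
  have hd' : (2 * d : ℝ) ≤ (N : ℝ) - 1 := by
    have : 2 * d + 1 ≤ N := by omega
    have : ((2 * d + 1 : ℕ) : ℝ) ≤ N := by exact_mod_cast this
    push_cast at this
    linarith
  unfold edgeDensity
  rw [div_le_iff₀ (by linarith)]
  linarith

theorem div_le_edgeDensity (hN : 2 ≤ N) : (d : ℝ) / N ≤ edgeDensity N d := by
  have h2 : (2 : ℝ) ≤ N := by exact_mod_cast hN
  exact div_le_div_of_nonneg_left (Nat.cast_nonneg _) (by linarith) (by linarith)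

theorem edgeDensity_le_div (hN : 2 ≤ N) : edgeDensity N d ≤ 2 * ((d : ℝ) / N) := by
  have h2 : (2 : ℝ) ≤ N := by exact_mod_cast hN
  have hd : (0 : ℝ) ≤ d := Nat.cast_nonneg _
  unfold edgeDensity
  rw [← mul_div_assoc, div_le_div_iff₀ (by linarith) (by linarith)]
  nlinarith

theorem inv_le_edgeDensity (hN : 2 ≤ N) (hd : 1 ≤ d) : 1 / (N : ℝ) ≤ edgeDensity N d := by
  refine le_trans ?_ (div_le_edgeDensity hN)
  have h1 : (1 : ℝ) ≤ d := by exact_mod_cast hd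
  gcongr

theorem abs_cen_le_one (hN : 2 ≤ N) (hd : 2 * d ≤ N - 1) (e : Sym2 (Fin N))
    (G : SimpleGraph (Fin N)) : |cen N d e G| ≤ 1 := by
  have h1 := edgeDensity_nonneg (d := d) hN
  have h2 := edgeDensity_le_half hN hd
  unfold cen
  rw [abs_le]
  rcases edgeIndicator_zero_or_one e G with h | h <;> rw [h] <;> constructor <;> linarith

theorem abs_cmat_le_one (hN : 2 ≤ N) (hd : 2 * d ≤ N - 1) (u v : Fin N)
    (G : SimpleGraph (Fin N)) : |cmat N d u v G| ≤ 1 := by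
  unfold cmat
  split_ifs
  · simp
  · exact abs_cen_le_one hN hd _ G

theorem abs_prod_cen_le_one (hN : 2 ≤ N) (hd : 2 * d ≤ N - 1) (T : Finset (Sym2 (Fin N)))
    (G : SimpleGraph (Fin N)) : |∏ e ∈ T, cen N d e G| ≤ 1 := by
  rw [Finset.abs_prod]
  exact Finset.prod_le_one (fun _ _ => abs_nonneg _) fun e _ => abs_cen_le_one hN hd e G

theorem sum_subset_edgeIndicator_le {G : SimpleGraph (Fin N)} (hG : G ∈ regularGraphs N d)
    (u : Fin N) (O : Finset (Fin N)) : ∑ v ∈ O, edgeIndicator s(u, v) G ≤ d := by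
  rw [← mem_regularGraphs.1 hG u]
  exact Finset.sum_le_sum_of_subset_of_nonneg (Finset.subset_univ _)
    fun v _ _ => edgeIndicator_nonneg _ _

/-- Of the `d * N` ordered adjacent pairs `(k, l)`, at most `2 * d * |U|` meet `U`, at most `d²`
have `ik` as an edge, and at most `d²` have `jl` as an edge. -/
theorem sum_switchable_ge {G : SimpleGraph (Fin N)} (hG : G ∈ regularGraphs N d)
    (i j : Fin N) (U : Finset (Fin N)) :
    edgeIndicator s(i, j) G * ((d : ℝ) * (N - 2 * U.card - 2 * d)) ≤
      ∑ k ∈ Uᶜ, ∑ l ∈ Uᶜ, switchable i j k l G := by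
  have hA := fun e => edgeIndicator_nonneg (N := N) e G
  have hA1 := fun e => edgeIndicator_le_one (N := N) e G
  have hrow := mem_regularGraphs.1 hG
  have hd0 : (0 : ℝ) ≤ d := Nat.cast_nonneg _
  have h1 : ∑ k ∈ Uᶜ, ∑ l ∈ Uᶜ, edgeIndicator s(k, l) G ≥ d * (N - 2 * U.card) := by
    have e1 : ∀ k, ∑ l ∈ Uᶜ, edgeIndicator s(k, l) G = d - ∑ l ∈ U, edgeIndicator s(l, k) G := by
      intro k
      rw [← hrow k, ← Finset.sum_add_sum_compl U]
      simp [Sym2.eq_swap]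
    simp_rw [e1]
    rw [Finset.sum_sub_distrib, Finset.sum_comm, Finset.sum_const, nsmul_eq_mul,
      Finset.card_compl, Fintype.card_fin, Nat.cast_sub (by simpa using Finset.card_le_univ U)]
    have : ∑ y ∈ U, ∑ x ∈ Uᶜ, edgeIndicator s(y, x) G ≤ ∑ y ∈ U, (d : ℝ) :=
      Finset.sum_le_sum fun u _ => sum_subset_edgeIndicator_le hG u _
    rw [Finset.sum_const, nsmul_eq_mul] at this
    linarith
  have h2 : ∑ k ∈ Uᶜ, ∑ l ∈ Uᶜ, edgeIndicator s(k, l) G * edgeIndicator s(i, k) G ≤ d * d := by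
    calc _ ≤ ∑ k ∈ Uᶜ, edgeIndicator s(i, k) G * d := by
          refine Finset.sum_le_sum fun k _ => ?_
          rw [← Finset.sum_mul, mul_comm]
          exact mul_le_mul_of_nonneg_left (sum_subset_edgeIndicator_le hG k _) (hA _)
      _ ≤ d * d := by
          rw [← Finset.sum_mul]
          exact mul_le_mul_of_nonneg_right (sum_subset_edgeIndicator_le hG i _) hd0
  have h3 : ∑ k ∈ Uᶜ, ∑ l ∈ Uᶜ, edgeIndicator s(k, l) G * edgeIndicator s(j, l) G ≤ d * d := by
    rw [Finset.sum_comm]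
    calc _ ≤ ∑ l ∈ Uᶜ, edgeIndicator s(j, l) G * d := by
          refine Finset.sum_le_sum fun l _ => ?_
          rw [← Finset.sum_mul, mul_comm]
          simp_rw [Sym2.eq_swap (b := l)]
          exact mul_le_mul_of_nonneg_left (sum_subset_edgeIndicator_le hG l _) (hA _)
      _ ≤ d * d := by
          rw [← Finset.sum_mul]
          exact mul_le_mul_of_nonneg_right (sum_subset_edgeIndicator_le hG j _) hd0
  calc edgeIndicator s(i, j) G * ((d : ℝ) * (N - 2 * U.card - 2 * d))
      ≤ edgeIndicator s(i, j) G * (∑ k ∈ Uᶜ, ∑ l ∈ Uᶜ, (edgeIndicator s(k, l) G -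
          edgeIndicator s(k, l) G * edgeIndicator s(i, k) G -
          edgeIndicator s(k, l) G * edgeIndicator s(j, l) G)) := by
        refine mul_le_mul_of_nonneg_left ?_ (hA _)
        simp_rw [Finset.sum_sub_distrib]
        linarith
    _ ≤ _ := by
        rw [Finset.mul_sum]
        refine Finset.sum_le_sum fun k _ => ?_
        rw [Finset.mul_sum]
        refine Finset.sum_le_sum fun l _ => ?_
        unfold switchable
        have := mul_nonneg (mul_nonneg (mul_nonneg (hA s(i, j)) (hA s(k, l))) (hA s(i, k)))
          (hA s(j, l))
        linarith

/-- Remove the edges of `S` one at a time. A graph containing the edge `ij` and the remaining edges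
admits at least `d * N / 2` switchings that destroy `ij` and leave the others alone, while a
resulting graph is reached from at most `d²` choices of `k` and `l`. The quotient is `2 * d / N`.
The size conditions give `2|U| ≤ N/4` and `2d ≤ N/4`. -/
theorem expectation_prod_edgeIndicator_le (hd : 1 ≤ d) (hdN : 8 * d ≤ N)
    (S : Finset (Sym2 (Fin N))) (hS : ∀ e ∈ S, ¬ e.IsDiag) (hN : 16 * S.card ≤ N) :
    uniformRegularExpectation N d (fun G => ∏ e ∈ S, edgeIndicator e G) ≤
      (2 * ((d : ℝ) / N)) ^ S.card := by
  classical
  induction S using Finset.induction_on with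
  | empty => simpa using uniformRegularExpectation_const_le (N := N) (d := d) zero_le_one
  | insert e S he ih =>
    have hcard := Finset.card_insert_of_notMem he
    have ih' := ih (fun e' h => hS e' (Finset.mem_insert_of_mem h)) (by omega)
    have hdiag := hS e (Finset.mem_insert_self _ _)
    rw [hcard, pow_succ']
    have hN0 : (0 : ℝ) < N := by
      have : 0 < N := by omega
      exact_mod_cast this
    have hd1 : (1 : ℝ) ≤ d := by exact_mod_cast hd
    refine le_trans ?_ (mul_le_mul_of_nonneg_left ih' (by positivity))
    set F : SimpleGraph (Fin N) → ℝ := fun G => ∏ e ∈ S, edgeIndicator e G with hF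
    set U := pairSupport (insert e S) with hUdef
    have hU : ∀ e' ∈ insert e S, ∀ v ∈ e', v ∈ U :=
      fun e' he' v hv => mem_pairSupport.2 ⟨e', he', hv⟩
    have hUc : (U.card : ℝ) ≤ N / 8 := by
      have h1 : U.card ≤ 2 * (insert e S).card := card_pairSupport_le _
      have : 8 * U.card ≤ N := by omega
      have : (8 : ℝ) * U.card ≤ N := by exact_mod_cast this
      linarith
    have hdN' : (d : ℝ) ≤ N / 8 := by
      have : (8 : ℝ) * d ≤ N := by exact_mod_cast hdN
      linarith
    have hF0 : ∀ G, 0 ≤ F G := fun G => Finset.prod_nonneg fun e _ => edgeIndicator_nonneg e G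
    induction e with
    | h i j =>
      have hij : i ≠ j := by simpa using hdiag
      have hi : i ∈ U := hU _ (Finset.mem_insert_self _ _) i (by simp)
      have hj : j ∈ U := hU _ (Finset.mem_insert_self _ _) j (by simp)
      have hterm : ∀ k ∈ Uᶜ, ∀ l ∈ Uᶜ,
          uniformRegularExpectation N d (fun G => switchable i j k l G * F G) ≤
          uniformRegularExpectation N d
            (fun G => edgeIndicator s(i, k) G * edgeIndicator s(j, l) G * F G) := by
        intro k hk l hl
        rw [Finset.mem_compl] at hk hl
        -- The coincidence `k = l` is harmless: `switchable` vanishes because `kk` is never an edge.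
        by_cases hkl : k = l
        · subst hkl
          refine uniformRegularExpectation_mono fun G _ => ?_
          rw [switchable, edgeIndicator_diag]
          have := mul_nonneg (mul_nonneg (edgeIndicator_nonneg s(i, k) G)
            (edgeIndicator_nonneg s(j, k) G)) (hF0 G)
          simpa using this
        · have h4 : Distinct4 i j k l :=
            ⟨hij, fun h => hk (h ▸ hi), fun h => hl (h ▸ hi), fun h => hk (h ▸ hj),
              fun h => hl (h ▸ hj), hkl⟩
          rw [expectation_switchable h4]
          refine uniformRegularExpectation_mono fun G _ => ?_
          have hinv : F (switchGraph i j k l G) = F G := by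
            refine Finset.prod_congr rfl fun e' he' => edgeIndicator_switchGraph_of_notMem ?_ G
            exact notMem_switchPairs (U := U)
              (fun e'' h => hU e'' (Finset.mem_insert_of_mem h)) he hk hl he'
          rw [hinv]
          refine mul_le_mul_of_nonneg_right ?_ (hF0 G)
          unfold switchable
          have a1 := edgeIndicator_nonneg s(i, k) G
          have a2 := edgeIndicator_nonneg s(j, l) G
          have a3 := edgeIndicator_nonneg s(i, j) G
          have a4 := edgeIndicator_nonneg s(k, l) G
          have b3 := edgeIndicator_le_one s(i, j) G
          have b4 := edgeIndicator_le_one s(k, l) G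
          have h0 : (1 - edgeIndicator s(i, j) G) * (1 - edgeIndicator s(k, l) G) ≤ 1 := by
            nlinarith
          have := mul_le_mul_of_nonneg_left h0 (mul_nonneg a1 a2)
          linarith
      have hsum := Finset.sum_le_sum fun k hk => Finset.sum_le_sum fun l hl => hterm k hk l hl
      simp_rw [← uniformRegularExpectation_sum] at hsum
      have hlow : (d : ℝ) * (N / 2) * uniformRegularExpectation N d
          (fun G => ∏ e ∈ insert s(i, j) S, edgeIndicator e G) ≤
          uniformRegularExpectation N d
            (fun G => ∑ k ∈ Uᶜ, ∑ l ∈ Uᶜ, switchable i j k l G * F G) := by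
        rw [← uniformRegularExpectation_mul_left]
        refine uniformRegularExpectation_mono fun G hG => ?_
        rw [Finset.prod_insert he]
        simp_rw [← Finset.sum_mul]
        rw [← mul_assoc]
        refine mul_le_mul_of_nonneg_right (le_trans ?_ (sum_switchable_ge hG i j U)) (hF0 G)
        rw [mul_comm]
        refine mul_le_mul_of_nonneg_left ?_ (edgeIndicator_nonneg _ _)
        refine mul_le_mul_of_nonneg_left ?_ (by linarith)
        linarith
      have hup : uniformRegularExpectation N d (fun G => ∑ k ∈ Uᶜ, ∑ l ∈ Uᶜ,
          edgeIndicator s(i, k) G * edgeIndicator s(j, l) G * F G) ≤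
          (d : ℝ) * d * uniformRegularExpectation N d F := by
        rw [← uniformRegularExpectation_mul_left]
        refine uniformRegularExpectation_mono fun G hG => ?_
        simp_rw [← Finset.sum_mul, ← Finset.mul_sum, ← Finset.sum_mul]
        refine mul_le_mul_of_nonneg_right ?_ (hF0 G)
        exact mul_le_mul (sum_subset_edgeIndicator_le hG i _) (sum_subset_edgeIndicator_le hG j _)
          (Finset.sum_nonneg fun _ _ => edgeIndicator_nonneg _ _) (by linarith)
      have htot := hlow.trans (hsum.trans hup)
      have hpos : 0 < (d : ℝ) * (N / 2) := by positivity
      rw [← mul_le_mul_iff_right₀ hpos]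
      refine htot.trans (le_of_eq ?_)
      field_simp

theorem abs_corr_le_one (hN : 2 ≤ N) (hd : 2 * d ≤ N - 1) (T : Finset (Sym2 (Fin N))) :
    |corr N d T| ≤ 1 :=
  abs_uniformRegularExpectation_le_of_le zero_le_one fun G _ => abs_prod_cen_le_one hN hd T G

/-- Bound each `|x_e|` by the indicator plus `p` and expand the product; subgraph probabilities
`(2p)^|S|` then sum to `(3p)^|T|`. The larger constant makes the bound trivial when `8d > N` or
`16|T| > N`, where the subgraph estimate is not available. -/
theorem abs_corr_le_edgeDensity_pow (hd : 1 ≤ d) (hdN : 2 * d ≤ N - 1)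
    (T : Finset (Sym2 (Fin N))) (hT : ∀ e ∈ T, ¬ e.IsDiag) :
    |corr N d T| ≤ ((16 * T.card + 8) * edgeDensity N d) ^ T.card := by
  classical
  have hN : 2 ≤ N := by omega
  have hN0 : (0 : ℝ) < N := by
    have : 0 < N := by omega
    exact_mod_cast this
  have hp0 := edgeDensity_nonneg (d := d) hN
  have htriv : 1 ≤ (16 * (T.card : ℝ) + 8) * edgeDensity N d →
      |corr N d T| ≤ ((16 * T.card + 8) * edgeDensity N d) ^ T.card := fun h =>
    (abs_corr_le_one hN hdN T).trans (one_le_pow₀ h)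
  by_cases h1 : 8 * d ≤ N
  swap
  · apply htriv
    have h8 : (N : ℝ) ≤ 8 * d := by
      have : N ≤ 8 * d := by omega
      exact_mod_cast this
    have : 1 ≤ 8 * edgeDensity N d := by
      have := div_le_edgeDensity (d := d) hN
      have h9 : 1 ≤ 8 * ((d : ℝ) / N) := by
        rw [← mul_div_assoc, le_div_iff₀ hN0]; linarith
      linarith
    have h0 : (0 : ℝ) ≤ 16 * T.card * edgeDensity N d := by positivity
    linarith
  by_cases h2 : 16 * T.card ≤ N
  swap
  · apply htriv
    have h8 : (N : ℝ) ≤ 16 * T.card := by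
      have : N ≤ 16 * T.card := by omega
      exact_mod_cast this
    have h3 := inv_le_edgeDensity hN hd
    have : 1 ≤ N * edgeDensity N d := by
      rwa [div_le_iff₀ hN0, mul_comm] at h3
    nlinarith
  have hp : ∀ S ⊆ T, uniformRegularExpectation N d (fun G => ∏ e ∈ S, edgeIndicator e G) ≤
      (2 * edgeDensity N d) ^ S.card := by
    intro S hS
    refine (expectation_prod_edgeIndicator_le hd h1 S (fun e he => hT e (hS he)) ?_).trans ?_
    · have := Finset.card_le_card hS
      omega
    · gcongr
      exact div_le_edgeDensity hN
  calc |corr N d T| ≤ uniformRegularExpectation N d (fun G => |∏ e ∈ T, cen N d e G|) :=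
        abs_uniformRegularExpectation_le _
    _ ≤ uniformRegularExpectation N d (fun G => ∑ S ∈ T.powerset,
          edgeDensity N d ^ (T \ S).card * ∏ e ∈ S, edgeIndicator e G) := by
        refine uniformRegularExpectation_mono fun G _ => ?_
        rw [Finset.abs_prod]
        calc ∏ e ∈ T, |cen N d e G| ≤ ∏ e ∈ T, (edgeIndicator e G + edgeDensity N d) := by
              refine Finset.prod_le_prod (fun _ _ => abs_nonneg _) fun e _ => ?_
              have := edgeIndicator_nonneg e G
              rw [cen, abs_le]
              constructor <;> linarith
          _ = _ := by
              rw [Finset.prod_add]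
              refine Finset.sum_congr rfl fun S _ => ?_
              rw [Finset.prod_const, mul_comm]
    _ ≤ ∑ S ∈ T.powerset, edgeDensity N d ^ (T \ S).card * (2 * edgeDensity N d) ^ S.card := by
        rw [uniformRegularExpectation_sum]
        refine Finset.sum_le_sum fun S hS => ?_
        rw [uniformRegularExpectation_mul_left]
        exact mul_le_mul_of_nonneg_left (hp S (Finset.mem_powerset.1 hS)) (by positivity)
    _ = (3 * edgeDensity N d) ^ T.card := by
        have := Finset.prod_add (fun _ : Sym2 (Fin N) => 2 * edgeDensity N d)
          (fun _ => edgeDensity N d) T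
        rw [Finset.prod_const] at this
        rw [show 3 * edgeDensity N d = 2 * edgeDensity N d + edgeDensity N d by ring, this]
        refine Finset.sum_congr rfl fun S _ => ?_
        rw [Finset.prod_const, Finset.prod_const, mul_comm]
    _ ≤ _ := by
        gcongr
        have : (0 : ℝ) ≤ T.card := Nat.cast_nonneg _
        linarith

end SubgraphProbability

/-! ### Weights -/

section Weights

/-- The bound for a correlation of `j` edges in which only `n` edges have been fully exploited. -/
def corrWeight (s p : ℝ) (n j : ℕ) : ℝ := s ^ min j n * p ^ (j - n)

variable {s p : ℝ} {n j : ℕ}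

theorem corrWeight_nonneg (hs : 0 ≤ s) (hp : 0 ≤ p) : 0 ≤ corrWeight s p n j := by
  unfold corrWeight
  positivity

theorem corrWeight_succ_of_le (h : n ≤ j) : corrWeight s p n (j + 1) = p * corrWeight s p n j := by
  unfold corrWeight
  rw [min_eq_right h, min_eq_right (by omega), show j + 1 - n = (j - n) + 1 by omega, pow_succ]
  ring

theorem corrWeight_succ_of_lt (h : j < n) : corrWeight s p n (j + 1) = s * corrWeight s p n j := by
  unfold corrWeight
  rw [min_eq_left h.le, min_eq_left (by omega), show j + 1 - n = 0 by omega,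
    show j - n = 0 by omega, pow_succ]
  ring

theorem mul_corrWeight_le_succ (hs : 0 ≤ s) (hsp : s ≤ p) :
    s * corrWeight s p n j ≤ corrWeight s p n (j + 1) := by
  have h0 : 0 ≤ corrWeight s p n j := corrWeight_nonneg hs (hs.trans hsp)
  rcases lt_or_ge j n with h | h
  · rw [corrWeight_succ_of_lt h]
  · rw [corrWeight_succ_of_le h]
    exact mul_le_mul_of_nonneg_right hsp h0

theorem corrWeight_succ_le (hs : 0 ≤ s) (hsp : s ≤ p) (hp : p ≤ 1) :
    corrWeight s p n (j + 1) ≤ corrWeight s p n j := by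
  have h0 : 0 ≤ corrWeight s p n j := corrWeight_nonneg hs (hs.trans hsp)
  rcases lt_or_ge j n with h | h
  · rw [corrWeight_succ_of_lt h]
    exact mul_le_of_le_one_left h0 (hsp.trans hp)
  · rw [corrWeight_succ_of_le h]
    exact mul_le_of_le_one_left h0 hp

/-- The scale `√d / N` of the correlation of one edge. -/
noncomputable def corrScale (N d : ℕ) : ℝ := √(d : ℝ) / N

variable {N d : ℕ}

theorem corrScale_nonneg : 0 ≤ corrScale N d := by
  unfold corrScale
  positivity

theorem inv_le_corrScale (hd : 1 ≤ d) : 1 / (N : ℝ) ≤ corrScale N d := by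
  unfold corrScale
  gcongr
  rw [Real.one_le_sqrt]
  exact_mod_cast hd

theorem corrScale_le_edgeDensity (hN : 2 ≤ N) (hd : 1 ≤ d) :
    corrScale N d ≤ edgeDensity N d := by
  refine le_trans ?_ (div_le_edgeDensity hN)
  unfold corrScale
  have h1 : (1 : ℝ) ≤ d := by exact_mod_cast hd
  gcongr
  rw [Real.sqrt_le_left (by linarith)]
  nlinarith

/-- When a repeated edge is cancelled, a factor `p` replaces a weight that may be `s`; this prices
the exchange at `O(√d)`. -/
theorem edgeDensity_le_mul_corrScale (hN : 2 ≤ N) :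
    edgeDensity N d ≤ 2 * √(d : ℝ) * corrScale N d := by
  refine (edgeDensity_le_div hN).trans (le_of_eq ?_)
  unfold corrScale
  rw [mul_assoc, ← mul_div_assoc √(d : ℝ), Real.mul_self_sqrt (Nat.cast_nonneg _)]

end Weights

/-! ### Correlations with additional factors -/

section Extra

variable {N d : ℕ}

/-- The functional `f ↦ 𝔼[F f]`. -/
noncomputable def expectationMul (N d : ℕ) (F : SimpleGraph (Fin N) → ℝ) :
    (SimpleGraph (Fin N) → ℝ) →ₗ[ℝ] ℝ where
  toFun f := uniformRegularExpectation N d fun G => F G * f G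
  map_add' f g := by
    rw [← uniformRegularExpectation_add]
    simp only [Pi.add_apply, mul_add]
  map_smul' c f := by
    rw [RingHom.id_apply, smul_eq_mul, ← uniformRegularExpectation_mul_left]
    simp only [Pi.smul_apply, smul_eq_mul, mul_left_comm]

theorem expectationMul_apply (F f : SimpleGraph (Fin N) → ℝ) :
    expectationMul N d F f = uniformRegularExpectation N d fun G => F G * f G := rfl

theorem expectationMul_congr {F f g : SimpleGraph (Fin N) → ℝ}
    (h : ∀ G ∈ regularGraphs N d, f G = g G) :
    expectationMul N d F f = expectationMul N d F g :=
  uniformRegularExpectation_congr fun G hG => by rw [h G hG]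

theorem abs_expectationMul_sum_le {ι : Type*} (F : SimpleGraph (Fin N) → ℝ) (A : Finset ι)
    (g : ι → SimpleGraph (Fin N) → ℝ) {B : ℝ} (h : ∀ a ∈ A, |expectationMul N d F (g a)| ≤ B) :
    |expectationMul N d F (∑ a ∈ A, g a)| ≤ A.card * B := by
  rw [map_sum, ← nsmul_eq_mul]
  exact (Finset.abs_sum_le_sum_abs _ _).trans (Finset.sum_le_card_nsmul _ _ _ h)

/-- The product of the centred indicators over a set of pairs. -/
noncomputable def cenProd (N d : ℕ) (T : Finset (Sym2 (Fin N))) (G : SimpleGraph (Fin N)) : ℝ :=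
  ∏ e ∈ T, cen N d e G

theorem expectationMul_cenProd_one (T : Finset (Sym2 (Fin N))) :
    expectationMul N d (cenProd N d T) 1 = corr N d T := by
  simp [expectationMul_apply, corr, cenProd]

theorem cenProd_mul_cmat {T : Finset (Sym2 (Fin N))} {u v : Fin N} (huv : u ≠ v)
    (h : s(u, v) ∉ T) (G : SimpleGraph (Fin N)) :
    cenProd N d T G * cmat N d u v G = cenProd N d (insert s(u, v) T) G := by
  rw [cenProd, cenProd, Finset.prod_insert h, cmat_of_ne huv, mul_comm]

theorem cen_mul_cen (e : Sym2 (Fin N)) (G : SimpleGraph (Fin N)) :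
    cen N d e G * cen N d e G = edgeDensity N d * (1 - edgeDensity N d) +
      (1 - 2 * edgeDensity N d) * cen N d e G := by
  unfold cen
  rcases edgeIndicator_zero_or_one e G with h | h <;> rw [h] <;> ring

theorem expectationMul_insert {T : Finset (Sym2 (Fin N))} {u v : Fin N} (huv : u ≠ v)
    (h : s(u, v) ∉ T) (f : SimpleGraph (Fin N) → ℝ) :
    expectationMul N d (cenProd N d T) (cmat N d u v * f) =
      expectationMul N d (cenProd N d (insert s(u, v) T)) f := by
  simp only [expectationMul_apply, Pi.mul_apply, ← mul_assoc, cenProd_mul_cmat huv h]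

theorem expectationMul_of_mem {T : Finset (Sym2 (Fin N))} {u v : Fin N} (huv : u ≠ v)
    (h : s(u, v) ∈ T) (f : SimpleGraph (Fin N) → ℝ) :
    expectationMul N d (cenProd N d T) (cmat N d u v * f) =
      edgeDensity N d * (1 - edgeDensity N d) *
        expectationMul N d (cenProd N d (T.erase s(u, v))) f +
      (1 - 2 * edgeDensity N d) * expectationMul N d (cenProd N d T) f := by
  simp only [expectationMul_apply]
  rw [← uniformRegularExpectation_mul_left, ← uniformRegularExpectation_mul_left,
    ← uniformRegularExpectation_add]
  congr 1
  ext G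
  rw [Pi.mul_apply, cmat_of_ne huv]
  unfold cenProd
  rw [← Finset.mul_prod_erase _ _ h]
  linear_combination (∏ e ∈ T.erase s(u, v), cen N d e G) * f G * cen_mul_cen (d := d) s(u, v) G

/-- Each additional entry of the matrix costs at most a factor `4 √d`. -/
theorem abs_expectationMul_list_le (hd : 1 ≤ d) (hdN : 2 * d ≤ N - 1) {n J : ℕ} {C : ℝ}
    (hC : 0 ≤ C)
    (H : ∀ T : Finset (Sym2 (Fin N)), (∀ e ∈ T, ¬ e.IsDiag) → T.card ≤ J →
      |corr N d T| ≤ C * corrWeight (corrScale N d) (edgeDensity N d) n T.card)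
    (l : List (Fin N × Fin N)) :
    ∀ T : Finset (Sym2 (Fin N)), (∀ e ∈ T, ¬ e.IsDiag) → T.card + l.length ≤ J →
      |expectationMul N d (cenProd N d T) ((l.map fun e => cmat N d e.1 e.2).prod)| ≤
        C * (4 * √(d : ℝ)) ^ l.length *
          corrWeight (corrScale N d) (edgeDensity N d) n T.card := by
  classical
  have hN : 2 ≤ N := by omega
  have hs := corrScale_nonneg (N := N) (d := d)
  have hsp := corrScale_le_edgeDensity hN hd
  have hp2 := edgeDensity_le_half hN hdN
  have hp1 : edgeDensity N d ≤ 1 := by linarith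
  have hp0 := edgeDensity_nonneg (d := d) hN
  have hsq : 1 ≤ √(d : ℝ) := by
    rw [Real.one_le_sqrt]; exact_mod_cast hd
  induction l with
  | nil =>
    intro T hT hc
    simpa [expectationMul_cenProd_one] using H T hT (by simpa using hc)
  | cons e l ih =>
    intro T hT hc
    obtain ⟨u, v⟩ := e
    simp only [List.length_cons] at hc
    rw [List.map_cons, List.prod_cons, List.length_cons, pow_succ]
    simp only
    set B := C * (4 * √(d : ℝ)) ^ l.length with hB
    have hB0 : 0 ≤ B := by positivity
    set W := corrWeight (corrScale N d) (edgeDensity N d) n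
    have hW0 : ∀ j, 0 ≤ W j := fun j => corrWeight_nonneg hs hp0
    have hgoal : B * (2 * √(d : ℝ) + 1) * W T.card ≤
        C * ((4 * √(d : ℝ)) ^ l.length * (4 * √(d : ℝ))) * W T.card := by
      rw [← mul_assoc, ← hB]
      refine mul_le_mul_of_nonneg_right (mul_le_mul_of_nonneg_left ?_ hB0) (hW0 _)
      linarith
    refine le_trans ?_ hgoal
    by_cases huv : u = v
    · subst huv
      have : cmat N d u u = 0 := by
        ext G; exact cmat_self u G
      rw [this, zero_mul, map_zero, abs_zero]
      have := hW0 T.card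
      positivity
    by_cases he : s(u, v) ∈ T
    · rw [expectationMul_of_mem huv he]
      have hcard : (T.erase s(u, v)).card + 1 = T.card := Finset.card_erase_add_one he
      have h1 := ih (T.erase s(u, v)) (fun e h => hT e (Finset.mem_of_mem_erase h)) (by omega)
      have h2 := ih T hT (by omega)
      -- For an entry repeated in `T`, the square splits as `p(1-p) + (1-2p)x`. The first part loses
      -- the edge, hence a weight at least `s`, in return for `p ≤ 2√d s`.
      have h3 : edgeDensity N d * W (T.erase s(u, v)).card ≤ 2 * √(d : ℝ) * W T.card := by
        calc _ ≤ 2 * √(d : ℝ) * corrScale N d * W (T.erase s(u, v)).card :=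
              mul_le_mul_of_nonneg_right (edgeDensity_le_mul_corrScale hN) (hW0 _)
          _ = 2 * √(d : ℝ) * (corrScale N d * W (T.erase s(u, v)).card) := by ring
          _ ≤ _ := by
              refine mul_le_mul_of_nonneg_left ?_ (by positivity)
              rw [← hcard]
              exact mul_corrWeight_le_succ hs hsp
      refine (abs_add_le _ _).trans ?_
      rw [abs_mul (edgeDensity N d * _), abs_mul (1 - 2 * edgeDensity N d),
        abs_of_nonneg (mul_nonneg hp0 (by linarith : (0:ℝ) ≤ 1 - edgeDensity N d)),
        abs_of_nonneg (by linarith : (0:ℝ) ≤ 1 - 2 * edgeDensity N d)]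
      have h4 : edgeDensity N d * (1 - edgeDensity N d) ≤ edgeDensity N d := by nlinarith
      have h5 : 1 - 2 * edgeDensity N d ≤ 1 := by linarith
      calc _ ≤ edgeDensity N d * (B * W (T.erase s(u, v)).card) + 1 * (B * W T.card) :=
            add_le_add (mul_le_mul h4 h1 (abs_nonneg _) hp0)
              (mul_le_mul h5 h2 (abs_nonneg _) zero_le_one)
        _ = B * (edgeDensity N d * W (T.erase s(u, v)).card) + B * W T.card := by ring
        _ ≤ B * (2 * √(d : ℝ) * W T.card) + B * W T.card := by gcongr
        _ = _ := by ring
    · rw [expectationMul_insert huv he]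
      have hcard := Finset.card_insert_of_notMem he
      have h1 := ih (insert s(u, v) T) (by
        intro e h
        rcases Finset.mem_insert.1 h with rfl | h
        · simpa using huv
        · exact hT e h) (by omega)
      refine h1.trans ?_
      rw [hcard]
      have h2 : W (T.card + 1) ≤ W T.card := corrWeight_succ_le hs hsp hp1
      have h3 : (1 : ℝ) ≤ 2 * √(d : ℝ) + 1 := by linarith
      calc B * W (T.card + 1) ≤ B * W T.card := by gcongr
        _ ≤ B * (2 * √(d : ℝ) + 1) * W T.card := by
          refine mul_le_mul_of_nonneg_right ?_ (hW0 _)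
          exact le_mul_of_one_le_right hB0 h3

end Extra

/-! ### The recurrence obtained from the switching identity -/

section Recurrence

variable {N d : ℕ}

theorem sum_compl_cmat (hN : 2 ≤ N) {G : SimpleGraph (Fin N)} (hG : G ∈ regularGraphs N d)
    (U : Finset (Fin N)) (v : Fin N) :
    ∑ k ∈ Uᶜ, cmat N d v k G = -∑ u ∈ U, cmat N d v u G := by
  have := sum_cmat hN hG v
  rw [← Finset.sum_add_sum_compl U] at this
  linarith

/-- The sum of the switching polynomials over all choices of two vertices outside of `U`. -/
theorem sum_switchPoly (x : Fin N → Fin N → ℝ) (p : ℝ) (hx : ∀ u v, x u v = x v u)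
    (hx0 : ∀ u, x u u = 0) (U : Finset (Fin N))
    (hrow : ∀ v, ∑ k ∈ Uᶜ, x v k = -∑ u ∈ U, x v u) (i j : Fin N) :
    ∑ k ∈ Uᶜ, ∑ l ∈ Uᶜ, switchPoly p (x i j) (x k l) (x i k) (x j l) -
        ∑ k ∈ Uᶜ, switchPoly p (x i j) (x k k) (x i k) (x j k) =
      p * (1 - p) * ((Uᶜ.card : ℝ) * (Uᶜ.card - 1)) * x i j +
      (p * (1 - p) * ∑ u ∈ U, ∑ v ∈ U, x u v +
        p * (1 - p) * (Uᶜ.card - 1) * ∑ u ∈ U, x i u +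
        p * (1 - p) * (Uᶜ.card - 1) * ∑ u ∈ U, x j u +
        (1 - 2 * p) * ∑ u ∈ U, ∑ v ∈ U, x i j * x u v -
        (1 - 2 * p) * ∑ u ∈ U, ∑ v ∈ U, x i u * x j v +
        (1 - 2 * p) * ∑ k ∈ Uᶜ, x i k * x j k +
        ∑ k ∈ Uᶜ, ∑ u ∈ U, x i j * (x i k * x k u) +
        ∑ k ∈ Uᶜ, ∑ u ∈ U, x i j * (x j k * x k u) +
        ∑ u ∈ U, ∑ v ∈ U, x i j * (x i u * x j v) -
        ∑ k ∈ Uᶜ, x i j * (x i k * x k j)) +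
      ∑ k ∈ Uᶜ, ∑ l ∈ Uᶜ, x i k * (x k l * x l j) := by
  -- A free end of a path summed outside `U` is minus its sum over the bounded set `U`. This
  -- reduction disposes of everything except the multiple of `x i j`, terms with at most one vertex
  -- free outside `U`, and the path of length three.
  have hUU : ∑ k ∈ Uᶜ, ∑ l ∈ Uᶜ, x k l = ∑ u ∈ U, ∑ v ∈ U, x u v := by
    simp_rw [hrow]
    rw [Finset.sum_neg_distrib, Finset.sum_comm]
    rw [← Finset.sum_neg_distrib]
    refine Finset.sum_congr rfl fun u _ => ?_
    simp_rw [hx _ u]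
    rw [hrow, neg_neg]
  have h1 : ∑ k ∈ Uᶜ, ∑ l ∈ Uᶜ, x k l * x i k = -∑ k ∈ Uᶜ, x i k * ∑ u ∈ U, x k u := by
    rw [← Finset.sum_neg_distrib]
    refine Finset.sum_congr rfl fun k _ => ?_
    rw [← Finset.sum_mul, hrow]
    ring
  have h2 : ∑ k ∈ Uᶜ, ∑ l ∈ Uᶜ, x k l * x j l = -∑ k ∈ Uᶜ, x j k * ∑ u ∈ U, x k u := by
    rw [Finset.sum_comm, ← Finset.sum_neg_distrib]
    refine Finset.sum_congr rfl fun k _ => ?_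
    simp_rw [hx _ k]
    rw [← Finset.sum_mul, hrow]
    ring
  have h3 : ∑ k ∈ Uᶜ, x i k * ∑ l ∈ Uᶜ, x j l = ∑ u ∈ U, x i u * ∑ v ∈ U, x j v := by
    rw [← Finset.sum_mul, ← Finset.sum_mul, hrow, hrow]
    ring
  have e1 : ∀ k l, switchPoly p (x i j) (x k l) (x i k) (x j l) =
      p * (1 - p) * x i j + p * (1 - p) * x k l - p * (1 - p) * x i k - p * (1 - p) * x j l +
      (1 - 2 * p) * x i j * x k l - (1 - 2 * p) * (x i k * x j l) -
      x i j * (x k l * x i k) - x i j * (x k l * x j l) + x i j * (x i k * x j l) +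
      x i k * (x k l * x l j) := by
    intro k l
    rw [hx l j]
    unfold switchPoly
    ring
  have e2 : ∀ k, switchPoly p (x i j) (x k k) (x i k) (x j k) =
      p * (1 - p) * x i j - p * (1 - p) * x i k - p * (1 - p) * x j k -
      (1 - 2 * p) * (x i k * x j k) + x i j * (x i k * x k j) := by
    intro k
    rw [hx0, hx k j]
    unfold switchPoly
    ring
  simp_rw [e2, e1]
  simp only [Finset.sum_add_distrib, Finset.sum_sub_distrib, ← Finset.mul_sum, hUU, h1, h2, h3,
    Finset.sum_const, nsmul_eq_mul]
  rw [hrow i, hrow j]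
  ring

/-- A path of length two through a vertex not covered by `T` gains two factors of the density. -/
theorem abs_expectationMul_path_le (hdN : 2 * d ≤ N - 1) {n J : ℕ} {C : ℝ}
    (hC : 0 ≤ C)
    (H : ∀ T : Finset (Sym2 (Fin N)), (∀ e ∈ T, ¬ e.IsDiag) → T.card ≤ J →
      |corr N d T| ≤ C * corrWeight (corrScale N d) (edgeDensity N d) n T.card)
    {T : Finset (Sym2 (Fin N))} (hT : ∀ e ∈ T, ¬ e.IsDiag) (hJ : T.card + 3 ≤ J)
    (hn : n ≤ T.card) {U : Finset (Fin N)} (hU : ∀ e ∈ T, ∀ v ∈ e, v ∈ U) {i j : Fin N}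
    (hij : i ≠ j) (hi : i ∈ U) (hj : j ∈ U) (he : s(i, j) ∉ T) {k u : Fin N} (hk : k ∉ U)
    (hu : u ∈ U) :
    |expectationMul N d (cenProd N d T)
        (cmat N d i j * (cmat N d i k * cmat N d k u))| ≤
      2 * C * edgeDensity N d ^ 2 *
        corrWeight (corrScale N d) (edgeDensity N d) n T.card := by
  classical
  have hN : 2 ≤ N := by omega
  have hs := corrScale_nonneg (N := N) (d := d)
  have hp2 := edgeDensity_le_half hN hdN
  have hp1 : edgeDensity N d ≤ 1 := by linarith
  have hp0 := edgeDensity_nonneg (d := d) hN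
  have hW0 := corrWeight_nonneg (n := n) (j := T.card) hs hp0
  have hik : i ≠ k := fun h => hk (h ▸ hi)
  have huk : k ≠ u := fun h => hk (h ▸ hu)
  have hkT : ∀ v, s(v, k) ∉ T := fun v h => hk (hU _ h k (by simp))
  have hd1 : ∀ e ∈ insert s(i, j) T, ¬ e.IsDiag := by
    intro e h
    rcases Finset.mem_insert.1 h with rfl | h
    · simpa using hij
    · exact hT e h
  have hik1 : s(i, k) ∉ insert s(i, j) T := by
    rw [Finset.mem_insert, not_or]
    refine ⟨fun h => ?_, hkT i⟩
    rcases Sym2.eq_iff.1 h with ⟨-, h⟩ | ⟨h, -⟩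
    · exact hk (h ▸ hj)
    · exact hij h
  have hd2 : ∀ e ∈ insert s(i, k) (insert s(i, j) T), ¬ e.IsDiag := by
    intro e h
    rcases Finset.mem_insert.1 h with rfl | h
    · simpa using hik
    · exact hd1 e h
  have hc1 := Finset.card_insert_of_notMem he
  have hc2 := Finset.card_insert_of_notMem hik1
  have w1 : corrWeight (corrScale N d) (edgeDensity N d) n (T.card + 1) =
      edgeDensity N d * corrWeight (corrScale N d) (edgeDensity N d) n T.card :=
    corrWeight_succ_of_le hn
  have w2 : corrWeight (corrScale N d) (edgeDensity N d) n (T.card + 1 + 1) =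
      edgeDensity N d * corrWeight (corrScale N d) (edgeDensity N d) n (T.card + 1) :=
    corrWeight_succ_of_le (by omega)
  have w3 : corrWeight (corrScale N d) (edgeDensity N d) n (T.card + 1 + 1 + 1) =
      edgeDensity N d * corrWeight (corrScale N d) (edgeDensity N d) n (T.card + 1 + 1) :=
    corrWeight_succ_of_le (by omega)
  rw [expectationMul_insert hij he, expectationMul_insert hik hik1]
  -- If `u = i` the pair `ik` occurs twice: its square contributes `p`, and the new edge `ij` a
  -- second `p`. Otherwise there are three new edges, worth even `p³`. Each new edge counts `p`, and
  -- not `s`, because `n ≤ T.card`.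
  by_cases hui : u = i
  · subst hui
    have hcomm : cmat N d k u = cmat N d u k := by
      ext G; exact cmat_comm k u G
    rw [hcomm, ← mul_one (cmat N d u k), expectationMul_of_mem hik (Finset.mem_insert_self _ _),
      Finset.erase_insert hik1, expectationMul_cenProd_one, expectationMul_cenProd_one]
    have b1 := H _ hd1 (by omega)
    have b2 := H _ hd2 (by omega)
    rw [hc1, w1] at b1
    rw [hc2, hc1, w2, w1] at b2
    refine (abs_add_le _ _).trans ?_
    rw [abs_mul (edgeDensity N d * _), abs_mul (1 - 2 * edgeDensity N d), abs_of_nonneg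
      (mul_nonneg hp0 (by linarith : (0:ℝ) ≤ 1 - edgeDensity N d)),
      abs_of_nonneg (by linarith : (0:ℝ) ≤ 1 - 2 * edgeDensity N d)]
    have h4 : edgeDensity N d * (1 - edgeDensity N d) ≤ edgeDensity N d := by nlinarith
    have h5 : 1 - 2 * edgeDensity N d ≤ 1 := by linarith
    refine (add_le_add (mul_le_mul h4 b1 (abs_nonneg _) hp0)
      (mul_le_mul h5 b2 (abs_nonneg _) zero_le_one)).trans (le_of_eq ?_)
    ring
  · have hku1 : s(k, u) ∉ insert s(i, k) (insert s(i, j) T) := by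
      rw [Finset.mem_insert, Finset.mem_insert, not_or, not_or]
      refine ⟨fun h => ?_, fun h => ?_, fun h => hk (hU _ h k (by simp))⟩
      · rcases Sym2.eq_iff.1 h with ⟨h, -⟩ | ⟨-, h⟩
        · exact hik h.symm
        · exact hui h
      · rcases Sym2.eq_iff.1 h with ⟨h, -⟩ | ⟨h, -⟩
        · exact hik h.symm
        · exact hk (h ▸ hj)
    have hc3 := Finset.card_insert_of_notMem hku1
    rw [← mul_one (cmat N d k u), expectationMul_insert huk hku1, expectationMul_cenProd_one]
    have b3 := H (insert s(k, u) (insert s(i, k) (insert s(i, j) T))) (by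
      intro e h
      rcases Finset.mem_insert.1 h with rfl | h
      · simpa using huk
      · exact hd2 e h) (by omega)
    rw [hc3, hc2, hc1, w3, w2, w1] at b3
    refine b3.trans ?_
    have : 0 ≤ C * edgeDensity N d ^ 2 * corrWeight (corrScale N d) (edgeDensity N d) n T.card := by
      positivity
    have := mul_le_mul_of_nonneg_right hp1 this
    linarith

/-- Replacing an edge by a path of length three through new vertices. -/
def replaceEdge (T : Finset (Sym2 (Fin N))) (i k l j : Fin N) : Finset (Sym2 (Fin N)) :=
  insert s(i, k) (insert s(k, l) (insert s(l, j) T))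

theorem cenProd_replaceEdge {T : Finset (Sym2 (Fin N))} {U : Finset (Fin N)}
    (hU : ∀ e ∈ T, ∀ v ∈ e, v ∈ U) {i j k l : Fin N} (hij : i ≠ j) (hi : i ∈ U) (hj : j ∈ U)
    (hk : k ∉ U) (hl : l ∉ U) (hkl : k ≠ l) (G : SimpleGraph (Fin N)) :
    cenProd N d T G * (cmat N d i k G * (cmat N d k l G * cmat N d l j G)) =
      cenProd N d (replaceEdge T i k l j) G := by
  have hik : i ≠ k := fun h => hk (h ▸ hi)
  have hlj : l ≠ j := fun h => hl (h ▸ hj)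
  have hil : i ≠ l := fun h => hl (h ▸ hi)
  have hjk : j ≠ k := fun h => hk (h ▸ hj)
  have h1 : s(l, j) ∉ T := fun h => hl (hU _ h l (by simp))
  have h2 : s(k, l) ∉ insert s(l, j) T := by
    rw [Finset.mem_insert, not_or]
    refine ⟨fun h => ?_, fun h => hk (hU _ h k (by simp))⟩
    rw [Sym2.eq_iff] at h
    grind
  have h3 : s(i, k) ∉ insert s(k, l) (insert s(l, j) T) := by
    rw [Finset.mem_insert, Finset.mem_insert, not_or, not_or]
    refine ⟨fun h => ?_, fun h => ?_, fun h => hk (hU _ h k (by simp))⟩ <;>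
    · rw [Sym2.eq_iff] at h
      grind
  rw [replaceEdge, ← cenProd_mul_cmat hik h3, ← cenProd_mul_cmat hkl h2,
    ← cenProd_mul_cmat hlj h1]
  ring

theorem abs_le_of_add_eq_zero {x a₁ a₂ a₃ a₄ a₅ a₆ a₇ a₈ a₉ b₁ b₂ : ℝ}
    {m₁ m₂ m₃ m₄ m₅ m₆ m₇ m₈ m₉ n₁ n₂ : ℝ}
    (h : 0 = x + (a₁ + a₂ + a₃ + a₄ - a₅ + a₆ + a₇ + a₈ + a₉ - b₁) + b₂)
    (h₁ : |a₁| ≤ m₁) (h₂ : |a₂| ≤ m₂) (h₃ : |a₃| ≤ m₃) (h₄ : |a₄| ≤ m₄) (h₅ : |a₅| ≤ m₅)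
    (h₆ : |a₆| ≤ m₆) (h₇ : |a₇| ≤ m₇) (h₈ : |a₈| ≤ m₈) (h₉ : |a₉| ≤ m₉) (k₁ : |b₁| ≤ n₁)
    (k₂ : |b₂| ≤ n₂) :
    |x| ≤ m₁ + m₂ + m₃ + m₄ + m₅ + m₆ + m₇ + m₈ + m₉ + n₁ + n₂ := by
  rw [abs_le] at *
  constructor <;> linarith only [h, h₁.1, h₁.2, h₂.1, h₂.2, h₃.1, h₃.2, h₄.1, h₄.2, h₅.1, h₅.2,
    h₆.1, h₆.2, h₇.1, h₇.2, h₈.1, h₈.2, h₉.1, h₉.2, k₁.1, k₁.2, k₂.1, k₂.2]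

/-- The numerical part of `abs_corr_insert_le`, with `r = √d`, `b = |U|` and `L = N - b`. All error
terms are at most a constant times `b² p N r C W`. Dividing by the coefficient of `q`, which is at
least `p N² / 16`, leaves `r / N = s`. -/
theorem abs_le_of_recurrence_terms {p s r b L N d C W Q q : ℝ}
    {a₁ a₂ a₃ a₄ a₅ a₆ a₇ a₈ a₉ b₁ b₂ : ℝ} (hppos : 0 < p) (hp2 : p ≤ 1 / 2)
    (hs : 0 ≤ s) (hsq : 1 ≤ r) (hsd : r * r = d) (hsN : s * N = r) (hN0 : 0 < N)
    (hdpN : d ≤ p * N) (hC : 0 ≤ C) (hW0 : 0 ≤ W) (hb1 : 2 ≤ b) (hbN : 4 * b ≤ N)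
    (hLN : L = N - b)
    (hident : 0 = p * (1 - p) * (L * (L - 1)) * q +
      (p * (1 - p) * a₁ + p * (1 - p) * (L - 1) * a₂ + p * (1 - p) * (L - 1) * a₃ +
        (1 - 2 * p) * a₄ - (1 - 2 * p) * a₅ + (1 - 2 * p) * a₆ + a₇ + a₈ + a₉ - b₁) + b₂)
    (t1 : |a₁| ≤ b * (b * (C * (4 * r) * W))) (t2 : |a₂| ≤ b * (C * (4 * r) * W))
    (t3 : |a₃| ≤ b * (C * (4 * r) * W)) (t4 : |a₄| ≤ b * (b * (C * (4 * r) ^ 2 * W)))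
    (t5 : |a₅| ≤ b * (b * (C * (4 * r) ^ 2 * W))) (t6 : |a₆| ≤ L * (C * p ^ 2 * W))
    (t7 : |a₇| ≤ L * (b * (2 * C * p ^ 2 * W))) (t8 : |a₈| ≤ L * (b * (2 * C * p ^ 2 * W)))
    (t9 : |a₉| ≤ b * (b * (C * (4 * r) ^ 3 * W))) (t10 : |b₁| ≤ L * (2 * C * p ^ 2 * W))
    (t11 : |b₂| ≤ L * (L - 1) * Q) :
    |q| ≤ 4000 * b ^ 2 * C * s * W + 2 / p * Q := by
  have hp0 := hppos.le
  have hL2 : N / 2 ≤ L := by rw [hLN]; linarith only [hbN, hN0]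
  have hL1 : 2 ≤ L := by linarith only [hL2, hbN, hb1]
  have hLle : L ≤ N := by rw [hLN]; linarith only [hb1]
  clear hLN
  obtain ⟨w, hw⟩ : ∃ w, w = C * W := ⟨_, rfl⟩
  have hw0 : 0 ≤ w := by rw [hw]; positivity
  have hLL : 0 < L * (L - 1) := mul_pos (by linarith only [hL1]) (by linarith only [hL1])
  have hQ0 : 0 ≤ Q := by
    have h := (abs_nonneg _).trans t11
    exact nonneg_of_mul_nonneg_right h hLL
  have hq1 : p * (1 - p) ≤ p := by nlinarith only [hp0]
  have hq1' : p / 2 ≤ p * (1 - p) := by nlinarith only [hp0, hp2]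
  have hq0 : 0 ≤ p * (1 - p) := by linarith only [hq1', hp0]
  have hc0 : 0 ≤ 1 - 2 * p := by linarith only [hp2]
  have hc1 : 1 - 2 * p ≤ 1 := by linarith only [hp0]
  have hb2 : b ≤ b ^ 2 := by nlinarith only [hb1]
  have hN1 : (1 : ℝ) ≤ N := by linarith only [hbN, hb1]
  have hb0' : 0 ≤ b := by linarith only [hb1]
  have hb1' : 1 ≤ b ^ 2 := by linarith only [hb1, hb2]
  have hp1 : p ≤ 1 := by linarith only [hp2]
  have hd0 : 0 ≤ d := hsd ▸ mul_self_nonneg r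
  have hL0 : 0 ≤ L - 1 := by linarith only [hL1]
  -- The common size of the errors. The worst term, with three additional entries, contributes `r³ =
  -- d r ≤ p N r`.
  obtain ⟨E, hE⟩ : ∃ E, E = b ^ 2 * (p * N * r) * w := ⟨_, rfl⟩
  have hkey : ∀ α β γ : ℝ, 0 ≤ β → α ≤ β * (p * N * r) → 0 ≤ γ → γ ≤ b ^ 2 →
      γ * α * w ≤ β * E := by
    intro α β γ hβ h hγ hγb
    calc γ * α * w ≤ γ * (β * (p * N * r)) * w := by gcongr
      _ ≤ b ^ 2 * (β * (p * N * r)) * w := by gcongr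
      _ = β * E := by rw [hE]; ring
  have hscaled : ∀ c y M : ℝ, 0 ≤ c → |y| ≤ M → |c * y| ≤ c * M := by
    intro c y M hc h
    rw [abs_mul, abs_of_nonneg hc]
    exact mul_le_mul_of_nonneg_left h hc
  have hbb : b ^ 2 ≤ b ^ 2 := le_rfl
  have hb0 : 0 ≤ b ^ 2 := by positivity
  have hpNr : 0 ≤ p * N * r := by positivity
  have f1 : p ≤ p * N := le_mul_of_one_le_right hp0 hN1
  have f2 : p * N ≤ p * N * r := le_mul_of_one_le_right (by positivity) hsq
  have f3 : p * r ≤ p * N * r := by gcongr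
  have f4 : L * p ^ 2 ≤ p * N * r := by
    calc L * p ^ 2 ≤ N * (p * 1) := by rw [pow_two]; gcongr
      _ ≤ p * N * r := by linarith only [f2]
  have u1 := hscaled _ _ _ hq0 t1
  have u2 := hscaled _ _ _ (mul_nonneg hq0 hL0) t2
  have u3 := hscaled _ _ _ (mul_nonneg hq0 hL0) t3
  have u4 := hscaled _ _ _ hc0 t4
  have u5 := hscaled _ _ _ hc0 t5
  have u6 := hscaled _ _ _ hc0 t6
  have v1 : p * (1 - p) * (b * (b * (C * (4 * r) * W))) ≤ 4 * E := by
    have := hkey (p * (1 - p) * (4 * r)) 4 (b ^ 2) (by norm_num) (by nlinarith only [hq1, f3, hsq, mul_le_mul_of_nonneg_right hq1 (zero_le_one.trans hsq)]) hb0 hbb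
    refine le_trans (le_of_eq ?_) this
    rw [hw]; ring
  have v2 : p * (1 - p) * (L - 1) * (b * (C * (4 * r) * W)) ≤ 4 * E := by
    have h : p * (1 - p) * (L - 1) * (4 * r) ≤ 4 * (p * N * r) := by
      calc p * (1 - p) * (L - 1) * (4 * r) ≤ p * N * (4 * r) := by
            gcongr
            linarith only [hLle]
        _ = _ := by ring
    have := hkey _ 4 b (by norm_num) h hb0' hb2
    refine le_trans (le_of_eq ?_) this
    rw [hw]; ring
  have v4 : (1 - 2 * p) * (b * (b * (C * (4 * r) ^ 2 * W))) ≤ 16 * E := by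
    have h : (1 - 2 * p) * (16 * (r * r)) ≤ 16 * (p * N * r) := by
      rw [hsd]
      calc (1 - 2 * p) * (16 * d) ≤ 1 * (16 * (p * N)) := by gcongr
        _ ≤ _ := by linarith only [f2]
    have := hkey _ 16 (b ^ 2) (by norm_num) h hb0 hbb
    refine le_trans (le_of_eq ?_) this
    rw [hw]; ring
  have v6 : (1 - 2 * p) * (L * (C * p ^ 2 * W)) ≤ 1 * E := by
    have h : (1 - 2 * p) * (L * p ^ 2) ≤ 1 * (p * N * r) := by gcongr
    have := hkey _ 1 1 (by norm_num) h zero_le_one hb1'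
    refine le_trans (le_of_eq ?_) this
    rw [hw]; ring
  have v7 : L * (b * (2 * C * p ^ 2 * W)) ≤ 2 * E := by
    have h : 2 * (L * p ^ 2) ≤ 2 * (p * N * r) := by linarith only [f4]
    have := hkey _ 2 b (by norm_num) h hb0' hb2
    refine le_trans (le_of_eq ?_) this
    rw [hw]; ring
  have v9 : b * (b * (C * (4 * r) ^ 3 * W)) ≤ 64 * E := by
    have h : 64 * (r * r * r) ≤ 64 * (p * N * r) := by
      rw [hsd]
      gcongr
    have := hkey _ 64 (b ^ 2) (by norm_num) h hb0 hbb
    refine le_trans (le_of_eq ?_) this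
    rw [hw]; ring
  have v10 : L * (2 * C * p ^ 2 * W) ≤ 2 * E := by
    have h : 2 * (L * p ^ 2) ≤ 2 * (p * N * r) := by linarith only [f4]
    have := hkey _ 2 1 (by norm_num) h zero_le_one hb1'
    refine le_trans (le_of_eq ?_) this
    rw [hw]; ring
  -- The constants collected above add up to `115`; `250` is generous, and `250 * 16 = 4000`.
  have htotal : |p * (1 - p) * (L * (L - 1)) * q| ≤ 250 * E + L * (L - 1) * Q := by
    have hE0 : 0 ≤ E := by rw [hE]; positivity
    refine (abs_le_of_add_eq_zero hident (u1.trans v1) (u2.trans v2) (u3.trans v2) (u4.trans v4)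
      (u5.trans v4) (u6.trans v6) (t7.trans v7) (t8.trans v7) (t9.trans v9) (t10.trans v10)
      t11).trans ?_
    linarith only [hE0]
  have hden : p * N ^ 2 / 16 ≤ p * (1 - p) * (L * (L - 1)) := by
    have h1 : N / 2 * (N / 4) ≤ L * (L - 1) := by
      refine mul_le_mul hL2 ?_ (by positivity) (by linarith only [hL1])
      linarith only [hL2, hL1]
    calc p * N ^ 2 / 16 = p / 2 * (N / 2 * (N / 4)) := by ring
      _ ≤ _ := mul_le_mul hq1' h1 (by positivity) hq0
  have hdpos : 0 < p * (1 - p) * (L * (L - 1)) := lt_of_lt_of_le (by positivity) hden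
  rw [abs_mul, abs_of_pos hdpos, mul_comm, ← le_div_iff₀ hdpos, add_div] at htotal
  refine htotal.trans (add_le_add ?_ ?_)
  · rw [div_le_iff₀ hdpos]
    calc 250 * E = 4000 * b ^ 2 * C * s * W * (p * N ^ 2 / 16) := by
          rw [hE, hw, ← hsN]; ring
      _ ≤ _ := by gcongr
  · rw [div_le_iff₀ hdpos, div_mul_eq_mul_div, div_mul_eq_mul_div, le_div_iff₀ hppos]
    have := mul_le_mul_of_nonneg_right hq1' (mul_nonneg hLL.le hQ0)
    linarith only [this]

-- The switching identity with the product over `T` as test function, summed over `k, l` outside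
-- `U`. Terms whose vertices all lie in `U` are few and cost powers of `√d`; terms with one free
-- vertex are `N` times more numerous but gain `p²`. The sum over two free vertices consists of the
-- correlations bounded by `Q`.
set_option maxHeartbeats 1000000 in
theorem abs_corr_insert_le (hd : 1 ≤ d) (hdN : 2 * d ≤ N - 1) {n J : ℕ} {C : ℝ}
    (hC : 0 ≤ C)
    (H : ∀ T : Finset (Sym2 (Fin N)), (∀ e ∈ T, ¬ e.IsDiag) → T.card ≤ J →
      |corr N d T| ≤ C * corrWeight (corrScale N d) (edgeDensity N d) n T.card)
    {T : Finset (Sym2 (Fin N))} (hT : ∀ e ∈ T, ¬ e.IsDiag) (hJ : T.card + 3 ≤ J)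
    (hn : n ≤ T.card) {U : Finset (Fin N)} (hU : ∀ e ∈ T, ∀ v ∈ e, v ∈ U) (hUN : 4 * U.card ≤ N)
    {i j : Fin N} (hij : i ≠ j) (hi : i ∈ U) (hj : j ∈ U) (he : s(i, j) ∉ T) {Q : ℝ}
    (hQ : ∀ k l, k ∉ U → l ∉ U → k ≠ l → |corr N d (replaceEdge T i k l j)| ≤ Q) :
    |corr N d (insert s(i, j) T)| ≤
      4000 * (U.card : ℝ) ^ 2 * C * corrScale N d *
        corrWeight (corrScale N d) (edgeDensity N d) n T.card + 2 / edgeDensity N d * Q := by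
  classical
  have hN : 2 ≤ N := by omega
  have hs := corrScale_nonneg (N := N) (d := d)
  have hp2 := edgeDensity_le_half hN hdN
  have hp1 : edgeDensity N d ≤ 1 := by linarith
  have hp0 := edgeDensity_nonneg (d := d) hN
  have hW0 := corrWeight_nonneg (n := n) (j := T.card) hs hp0
  have hN0 : (0 : ℝ) < N := by
    have : 0 < N := by omega
    exact_mod_cast this
  have hd1 : (1 : ℝ) ≤ d := by exact_mod_cast hd
  have hpd := div_le_edgeDensity (d := d) hN
  have hppos : 0 < edgeDensity N d := lt_of_lt_of_le (by positivity) hpd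
  have hinv := inv_le_corrScale (N := N) hd
  have hsq : 1 ≤ √(d : ℝ) := by
    rw [Real.one_le_sqrt]; exact_mod_cast hd
  have hsd : √(d : ℝ) * √(d : ℝ) = d := Real.mul_self_sqrt (by linarith)
  have hsN : corrScale N d * N = √(d : ℝ) := by
    unfold corrScale; field_simp
  set p := edgeDensity N d with hp
  set s := corrScale N d with hsdef
  set r := √(d : ℝ) with hr
  set W := corrWeight s p n T.card with hW
  set Λ := expectationMul N d (cenProd N d T) with hΛ
  set x : Fin N → Fin N → SimpleGraph (Fin N) → ℝ := cmat N d with hx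
  have hcardU : 2 ≤ U.card := by
    have h2 : ({i, j} : Finset (Fin N)).card = 2 := Finset.card_pair hij
    rw [← h2]
    refine Finset.card_le_card ?_
    intro v hv
    rcases Finset.mem_insert.1 hv with rfl | hv
    · exact hi
    · rw [Finset.mem_singleton.1 hv]; exact hj
  have hb1 : 2 ≤ (U.card : ℝ) := by exact_mod_cast hcardU
  have hbN : 4 * (U.card : ℝ) ≤ N := by exact_mod_cast hUN
  have hLN : (Uᶜ.card : ℝ) = N - U.card := by
    rw [Finset.card_compl, Fintype.card_fin, Nat.cast_sub (by omega)]
  -- bounds with a bounded number of additional factors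
  have hlist := fun (l : List (Fin N × Fin N)) (hl : l.length ≤ 3) =>
    abs_expectationMul_list_le hd hdN hC H l T hT (by omega)
  have B1 : ∀ u v, |Λ (x u v)| ≤ C * (4 * r) * W := by
    intro u v
    simpa using hlist [(u, v)] (by simp)
  have B2 : ∀ u v u' v', |Λ (x u v * x u' v')| ≤ C * (4 * r) ^ 2 * W := by
    intro u v u' v'
    simpa using hlist [(u, v), (u', v')] (by simp)
  have B3 : ∀ u v u' v' u'' v'', |Λ (x u v * (x u' v' * x u'' v''))| ≤ C * (4 * r) ^ 3 * W := by
    intro u v u' v' u'' v''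
    simpa using hlist [(u, v), (u', v'), (u'', v'')] (by simp)
  have P1 : ∀ k ∈ Uᶜ, ∀ u ∈ U, |Λ (x i j * (x i k * x k u))| ≤ 2 * C * p ^ 2 * W :=
    fun k hk u hu => abs_expectationMul_path_le hdN hC H hT hJ hn hU hij hi hj he
      (Finset.mem_compl.1 hk) hu
  have P2 : ∀ k ∈ Uᶜ, ∀ u ∈ U, |Λ (x i j * (x j k * x k u))| ≤ 2 * C * p ^ 2 * W := by
    intro k hk u hu
    have hc : x i j = x j i := by ext G; exact cmat_comm i j G
    rw [hc]
    exact abs_expectationMul_path_le hdN hC H hT hJ hn hU hij.symm hj hi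
      (by rwa [Sym2.eq_swap]) (Finset.mem_compl.1 hk) hu
  have P3 : ∀ k ∈ Uᶜ, |Λ (x i k * x j k)| ≤ C * p ^ 2 * W := by
    intro k hk
    rw [Finset.mem_compl] at hk
    have hik : i ≠ k := fun h => hk (h ▸ hi)
    have hjk : j ≠ k := fun h => hk (h ▸ hj)
    have h1 : s(i, k) ∉ T := fun h => hk (hU _ h k (by simp))
    have h2 : s(j, k) ∉ insert s(i, k) T := by
      rw [Finset.mem_insert, not_or]
      refine ⟨fun h => ?_, fun h => hk (hU _ h k (by simp))⟩
      rw [Sym2.eq_iff] at h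
      grind
    rw [hΛ, hx, expectationMul_insert hik h1, ← mul_one (cmat N d j k),
      expectationMul_insert hjk h2, expectationMul_cenProd_one]
    have hc1 := Finset.card_insert_of_notMem h1
    have hc2 := Finset.card_insert_of_notMem h2
    refine (H _ ?_ (by omega)).trans (le_of_eq ?_)
    · intro e h
      rcases Finset.mem_insert.1 h with rfl | h
      · simpa using hjk
      · rcases Finset.mem_insert.1 h with rfl | h
        · simpa using hik
        · exact hT e h
    · rw [hc2, hc1, corrWeight_succ_of_le (by omega), corrWeight_succ_of_le hn, hW]
      ring
  -- the identity
  have hpoint : ∀ G ∈ regularGraphs N d, _ := fun G hG =>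
    sum_switchPoly (fun u v => x u v G) p (fun u v => cmat_comm u v G) (fun u => cmat_self u G) U
      (fun v => sum_compl_cmat hN hG U v) i j
  -- For `k ≠ l` the switching leaves all pairs of `T` unchanged, so only the diagonal survives in
  -- the unrestricted double sum.
  have hzero : Λ (∑ k ∈ Uᶜ, ∑ l ∈ Uᶜ, fun G => switchPoly p (x i j G) (x k l G) (x i k G) (x j l G)) =
      Λ (∑ k ∈ Uᶜ, fun G => switchPoly p (x i j G) (x k k G) (x i k G) (x j k G)) := by
    rw [map_sum, map_sum]
    refine Finset.sum_congr rfl fun k hk => ?_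
    rw [map_sum]
    refine Finset.sum_eq_single_of_mem k hk fun l hl hlk => ?_
    rw [Finset.mem_compl] at hk hl
    have h4 : Distinct4 i j k l :=
      ⟨hij, fun h => hk (h ▸ hi), fun h => hl (h ▸ hi), fun h => hk (h ▸ hj),
        fun h => hl (h ▸ hj), hlk.symm⟩
    refine expectation_mul_switchPoly_eq_zero h4 fun G => ?_
    refine Finset.prod_congr rfl fun e he' => ?_
    rw [cen, cen, edgeIndicator_switchGraph_of_notMem (notMem_switchPairs hU he hk hl he')]
  have hident : Λ (∑ k ∈ Uᶜ, ∑ l ∈ Uᶜ,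
        fun G => switchPoly p (x i j G) (x k l G) (x i k G) (x j l G)) -
      Λ (∑ k ∈ Uᶜ, fun G => switchPoly p (x i j G) (x k k G) (x i k G) (x j k G)) =
      Λ ((p * (1 - p) * ((Uᶜ.card : ℝ) * (Uᶜ.card - 1))) • x i j +
      ((p * (1 - p)) • ∑ u ∈ U, ∑ v ∈ U, x u v +
        (p * (1 - p) * ((Uᶜ.card : ℝ) - 1)) • ∑ u ∈ U, x i u +
        (p * (1 - p) * ((Uᶜ.card : ℝ) - 1)) • ∑ u ∈ U, x j u +
        (1 - 2 * p) • ∑ u ∈ U, ∑ v ∈ U, x i j * x u v -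
        (1 - 2 * p) • ∑ u ∈ U, ∑ v ∈ U, x i u * x j v +
        (1 - 2 * p) • ∑ k ∈ Uᶜ, x i k * x j k +
        ∑ k ∈ Uᶜ, ∑ u ∈ U, x i j * (x i k * x k u) +
        ∑ k ∈ Uᶜ, ∑ u ∈ U, x i j * (x j k * x k u) +
        ∑ u ∈ U, ∑ v ∈ U, x i j * (x i u * x j v) -
        ∑ k ∈ Uᶜ, x i j * (x i k * x k j)) +
      ∑ k ∈ Uᶜ, ∑ l ∈ Uᶜ, x i k * (x k l * x l j)) := by
    rw [← map_sub]
    refine expectationMul_congr fun G hG => ?_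
    have := hpoint G hG
    simpa only [Pi.sub_apply, Pi.add_apply, Pi.smul_apply, Pi.mul_apply, Finset.sum_apply,
      smul_eq_mul] using this
  rw [hzero, sub_self] at hident
  simp only [map_add, map_sub, map_smul, smul_eq_mul] at hident
  have hmain : Λ (x i j) = corr N d (insert s(i, j) T) := by
    rw [← mul_one (x i j), hΛ, hx, expectationMul_insert hij he, expectationMul_cenProd_one]
  -- estimates of the individual terms
  have double : ∀ (A B : Finset (Fin N)) (g : Fin N → Fin N → SimpleGraph (Fin N) → ℝ) (M : ℝ),
      (∀ a ∈ A, ∀ b ∈ B, |Λ (g a b)| ≤ M) →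
      |Λ (∑ a ∈ A, ∑ b ∈ B, g a b)| ≤ A.card * (B.card * M) := fun A B g M h =>
    abs_expectationMul_sum_le _ A _ fun a ha => abs_expectationMul_sum_le _ B _ fun b hb => h a ha b hb
  have t1 := double U U (fun u v => x u v) _ (fun u _ v _ => B1 u v)
  have t2 := abs_expectationMul_sum_le (N := N) (d := d) (cenProd N d T) U (fun u => x i u)
    (fun u _ => B1 i u)
  have t3 := abs_expectationMul_sum_le (N := N) (d := d) (cenProd N d T) U (fun u => x j u)
    (fun u _ => B1 j u)
  have t4 := double U U (fun u v => x i j * x u v) _ (fun u _ v _ => B2 i j u v)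
  have t5 := double U U (fun u v => x i u * x j v) _ (fun u _ v _ => B2 i u j v)
  have t6 := abs_expectationMul_sum_le (N := N) (d := d) (cenProd N d T) Uᶜ
    (fun k => x i k * x j k) P3
  have t7 := double Uᶜ U (fun k u => x i j * (x i k * x k u)) _ P1
  have t8 := double Uᶜ U (fun k u => x i j * (x j k * x k u)) _ P2
  have t9 := double U U (fun u v => x i j * (x i u * x j v)) _ (fun u _ v _ => B3 i j i u j v)
  have t10 := abs_expectationMul_sum_le (N := N) (d := d) (cenProd N d T) Uᶜ
    (fun k => x i j * (x i k * x k j)) (fun k hk => P1 k hk j hj)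
  have t11 : |Λ (∑ k ∈ Uᶜ, ∑ l ∈ Uᶜ, x i k * (x k l * x l j))| ≤ (Uᶜ.card : ℝ) * (Uᶜ.card - 1) * Q := by
    have : ∀ k ∈ Uᶜ, |Λ (∑ l ∈ Uᶜ, x i k * (x k l * x l j))| ≤ ((Uᶜ.card : ℝ) - 1) * Q := by
      intro k hk
      rw [← Finset.add_sum_erase _ _ hk]
      have hkk : x k k = 0 := by ext G; exact cmat_self k G
      rw [hkk, zero_mul, mul_zero, zero_add]
      have hce : (((Uᶜ).erase k).card : ℝ) = (Uᶜ.card : ℝ) - 1 := by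
        rw [Finset.card_erase_of_mem hk, Nat.cast_sub (Finset.card_pos.2 ⟨k, hk⟩)]
        simp
      rw [← hce]
      refine abs_expectationMul_sum_le _ _ _ fun l hl => ?_
      have hlk := Finset.ne_of_mem_erase hl
      have hl' := Finset.mem_compl.1 (Finset.mem_of_mem_erase hl)
      have hk' := Finset.mem_compl.1 hk
      have := hQ k l hk' hl' hlk.symm
      have e : expectationMul N d (cenProd N d T) (x i k * (x k l * x l j)) =
          corr N d (replaceEdge T i k l j) := by
        rw [expectationMul_apply]
        unfold corr
        congr 1
        ext G
        exact cenProd_replaceEdge hU hij hi hj hk' hl' hlk.symm G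
      rw [e]
      exact this
    have h2 := abs_expectationMul_sum_le (N := N) (d := d) (cenProd N d T) Uᶜ _ this
    rw [mul_assoc]
    exact h2
  rw [hmain] at hident
  have hdpN : (d : ℝ) ≤ p * N := by rwa [div_le_iff₀ hN0] at hpd
  exact abs_le_of_recurrence_terms hppos hp2 hs hsq hsd hsN hN0 hdpN hC hW0 hb1 hbN hLN hident
    t1 t2 t3 t4 t5 t6 t7 t8 t9 t10 t11

end Recurrence

/-! ### Moments of the normalised fourth Schatten norm -/

section FourthMoment

variable {N d : ℕ}

/-- The normalised sum of the squared entries of `M ^ 2`. -/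
noncomputable def fourthTrace (M : Matrix (Fin N) (Fin N) ℝ) : ℝ :=
  (∑ a, ∑ b, (M * M) a b ^ 2) / (N : ℝ) ^ 4

/-- The normalised entries of `M ^ 3`. -/
noncomputable def cubeEntry (M : Matrix (Fin N) (Fin N) ℝ) (i j : Fin N) : ℝ :=
  (M * M * M) i j / (N : ℝ) ^ 2

theorem fourthTrace_nonneg (M : Matrix (Fin N) (Fin N) ℝ) : 0 ≤ fourthTrace M := by
  unfold fourthTrace
  positivity

theorem abs_sum_mul_le (f g : Fin N → ℝ) (hg : ∀ a, |g a| ≤ 1) :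
    |∑ a, f a * g a| ≤ ∑ a, |f a| := by
  refine (Finset.abs_sum_le_sum_abs _ _).trans (Finset.sum_le_sum fun a _ => ?_)
  rw [abs_mul]
  exact mul_le_of_le_one_right (abs_nonneg _) (hg a)

theorem abs_mul_self_apply_le {M : Matrix (Fin N) (Fin N) ℝ} (hM : ∀ a b, |M a b| ≤ 1)
    (a b : Fin N) : |(M * M) a b| ≤ N := by
  rw [Matrix.mul_apply]
  refine (abs_sum_mul_le _ _ fun c => hM c b).trans ?_
  refine (Finset.sum_le_card_nsmul _ _ 1 fun c _ => hM a c).trans ?_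
  simp

theorem abs_cubeEntry_le_one {M : Matrix (Fin N) (Fin N) ℝ} (hM : ∀ a b, |M a b| ≤ 1)
    (i j : Fin N) : |cubeEntry M i j| ≤ 1 := by
  have hN : (0 : ℝ) < N := by exact_mod_cast Nat.zero_lt_of_lt i.2
  unfold cubeEntry
  rw [abs_div, abs_of_pos (by positivity : (0 : ℝ) < (N : ℝ) ^ 2), div_le_one (by positivity),
    Matrix.mul_apply]
  refine (abs_sum_mul_le _ _ fun c => hM c j).trans ?_
  refine (Finset.sum_le_card_nsmul _ _ (N : ℝ) fun c _ => abs_mul_self_apply_le hM i c).trans ?_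
  simp [pow_two]

theorem sum_ite_mem_le {Q : Finset (Fin N)} (hQ : Q.card ≤ 4) :
    ∑ a : Fin N, (if a ∈ Q then (2 : ℝ) else 0) ≤ 8 := by
  rw [Finset.sum_ite_mem, Finset.univ_inter, Finset.sum_const, nsmul_eq_mul]
  have : (Q.card : ℝ) ≤ 4 := by exact_mod_cast hQ
  linarith

/-- The effect on the square of a perturbation supported on four rows and columns. -/
theorem abs_mul_self_sub_le {M M' : Matrix (Fin N) (Fin N) ℝ} (hM : ∀ a b, |M a b| ≤ 1)
    (hM' : ∀ a b, |M' a b| ≤ 1) {Q : Finset (Fin N)}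
    (hrow : ∀ a, ∑ b, |M' a b - M a b| ≤ if a ∈ Q then 2 else 0)
    (hcol : ∀ b, ∑ a, |M' a b - M a b| ≤ if b ∈ Q then 2 else 0) (a b : Fin N) :
    |(M' * M') a b - (M * M) a b| ≤ (if a ∈ Q then 2 else 0) + if b ∈ Q then 2 else 0 := by
  have h : (M' * M') a b - (M * M) a b =
      ∑ c, (M' a c - M a c) * M' c b + ∑ c, (M' c b - M c b) * M a c := by
    rw [Matrix.mul_apply, Matrix.mul_apply, ← Finset.sum_sub_distrib, ← Finset.sum_add_distrib]
    refine Finset.sum_congr rfl fun c _ => ?_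
    ring
  rw [h]
  refine (abs_add_le _ _).trans (add_le_add ?_ ?_)
  · exact (abs_sum_mul_le _ _ fun c => hM' c b).trans (hrow a)
  · exact (abs_sum_mul_le _ _ fun c => hM a c).trans (hcol b)

/-- `M²` changes by `O(1)` per entry, and only in four rows and four columns except where those meet
the switching; its entries are at most `N`. The squares thus change by `O(N²)` in total, before
division by `N⁴`. -/
theorem abs_fourthTrace_sub_le {M M' : Matrix (Fin N) (Fin N) ℝ} (hM : ∀ a b, |M a b| ≤ 1)
    (hM' : ∀ a b, |M' a b| ≤ 1) {Q : Finset (Fin N)} (hQ : Q.card ≤ 4)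
    (hrow : ∀ a, ∑ b, |M' a b - M a b| ≤ if a ∈ Q then 2 else 0)
    (hcol : ∀ b, ∑ a, |M' a b - M a b| ≤ if b ∈ Q then 2 else 0) (hN : 0 < N) :
    |fourthTrace M' - fourthTrace M| ≤ 32 / (N : ℝ) ^ 2 := by
  have hN0 : (0 : ℝ) < N := by exact_mod_cast hN
  unfold fourthTrace
  rw [← sub_div, abs_div, abs_of_pos (by positivity : (0 : ℝ) < (N : ℝ) ^ 4),
    div_le_div_iff₀ (by positivity) (by positivity), ← Finset.sum_sub_distrib]
  have hterm : ∀ a b, |(M' * M') a b ^ 2 - (M * M) a b ^ 2| ≤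
      2 * N * ((if a ∈ Q then (2 : ℝ) else 0) + if b ∈ Q then 2 else 0) := by
    intro a b
    rw [sq_sub_sq, abs_mul]
    refine mul_le_mul ?_ (abs_mul_self_sub_le hM hM' hrow hcol a b) (abs_nonneg _) (by positivity)
    refine (abs_add_le _ _).trans ?_
    have := abs_mul_self_apply_le hM a b
    have := abs_mul_self_apply_le hM' a b
    linarith
  have hsum : |∑ a, (∑ b, (M' * M') a b ^ 2 - ∑ b, (M * M) a b ^ 2)| ≤ 32 * (N : ℝ) ^ 2 := by
    calc _ ≤ ∑ a, ∑ b, 2 * N * ((if a ∈ Q then (2 : ℝ) else 0) + if b ∈ Q then 2 else 0) := by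
          refine (Finset.abs_sum_le_sum_abs _ _).trans (Finset.sum_le_sum fun a _ => ?_)
          rw [← Finset.sum_sub_distrib]
          exact (Finset.abs_sum_le_sum_abs _ _).trans (Finset.sum_le_sum fun b _ => hterm a b)
      _ = 2 * N * (2 * N * ∑ a : Fin N, (if a ∈ Q then (2 : ℝ) else 0)) := by
          simp only [← Finset.mul_sum, Finset.sum_add_distrib, Finset.sum_const, Finset.card_univ,
            Fintype.card_fin, nsmul_eq_mul]
          ring
      _ ≤ 2 * N * (2 * N * 8) := by
          gcongr
          exact sum_ite_mem_le hQ
      _ = _ := by ring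
  calc _ ≤ 32 * (N : ℝ) ^ 2 * (N : ℝ) ^ 2 := by gcongr
    _ = _ := by ring

/-- A fixed entry of `M³` changes by `O(N)`: the row `i` of `M²` moves by `O(1)` per entry, with
`O(1)` exceptional extra changes, and the column `j` of `M` has bounded total change against entries
of size `N`. -/
theorem abs_cubeEntry_sub_le {M M' : Matrix (Fin N) (Fin N) ℝ} (hM : ∀ a b, |M a b| ≤ 1)
    (hM' : ∀ a b, |M' a b| ≤ 1) {Q : Finset (Fin N)} (hQ : Q.card ≤ 4)
    (hrow : ∀ a, ∑ b, |M' a b - M a b| ≤ if a ∈ Q then 2 else 0)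
    (hcol : ∀ b, ∑ a, |M' a b - M a b| ≤ if b ∈ Q then 2 else 0) (i j : Fin N) :
    |cubeEntry M' i j - cubeEntry M i j| ≤ 12 / (N : ℝ) := by
  have hN1 : 1 ≤ N := Nat.one_le_of_lt i.2
  have hN0 : (1 : ℝ) ≤ N := by exact_mod_cast hN1
  have hite : ∀ a, (if a ∈ Q then (2 : ℝ) else 0) ≤ 2 := by
    intro a; split_ifs <;> norm_num
  unfold cubeEntry
  rw [← sub_div, abs_div, abs_of_pos (by positivity : (0 : ℝ) < (N : ℝ) ^ 2),
    div_le_div_iff₀ (by positivity) (by positivity)]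
  have h : (M' * M' * M') i j - (M * M * M) i j =
      ∑ c, ((M' * M') i c - (M * M) i c) * M' c j + ∑ c, (M' c j - M c j) * (M * M) i c := by
    rw [Matrix.mul_apply, Matrix.mul_apply, ← Finset.sum_sub_distrib, ← Finset.sum_add_distrib]
    refine Finset.sum_congr rfl fun c _ => ?_
    ring
  have h1 : |∑ c, ((M' * M') i c - (M * M) i c) * M' c j| ≤ 2 * N + 8 := by
    refine (abs_sum_mul_le _ _ fun c => hM' c j).trans ?_
    calc _ ≤ ∑ c, ((2 : ℝ) + if c ∈ Q then 2 else 0) := by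
          refine Finset.sum_le_sum fun c _ => (abs_mul_self_sub_le hM hM' hrow hcol i c).trans ?_
          have := hite i
          linarith
      _ ≤ _ := by
          rw [Finset.sum_add_distrib]
          have := sum_ite_mem_le hQ
          simp only [Finset.sum_const, Finset.card_univ, Fintype.card_fin, nsmul_eq_mul]
          linarith
  have h2 : |∑ c, (M' c j - M c j) * (M * M) i c| ≤ 2 * N := by
    calc _ ≤ ∑ c, |M' c j - M c j| * N := by
          refine (Finset.abs_sum_le_sum_abs _ _).trans (Finset.sum_le_sum fun c _ => ?_)
          rw [abs_mul]
          exact mul_le_mul_of_nonneg_left (abs_mul_self_apply_le hM i c) (abs_nonneg _)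
      _ ≤ 2 * N := by
          rw [← Finset.sum_mul]
          exact mul_le_mul_of_nonneg_right ((hcol j).trans (hite j)) (by linarith)
  have h3 : |(M' * M' * M') i j - (M * M * M) i j| ≤ 12 * N := by
    rw [h]
    refine (abs_add_le _ _).trans ?_
    linarith
  nlinarith

/-- The centred adjacency matrix as a matrix. -/
noncomputable def centredMatrix (N d : ℕ) (G : SimpleGraph (Fin N)) : Matrix (Fin N) (Fin N) ℝ :=
  Matrix.of fun u v => cmat N d u v G

theorem switchSign_comm (i j k l u v : Fin N) :
    switchSign i j k l u v = switchSign i j k l v u := by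
  unfold switchSign
  ring

theorem sum_abs_switchSign_le {i j k l : Fin N} (h : Distinct4 i j k l) (u : Fin N) :
    ∑ v, |switchSign i j k l u v| ≤ if u ∈ ({i, j, k, l} : Finset (Fin N)) then 2 else 0 := by
  obtain ⟨hij, hik, hil, hjk, hjl, hkl⟩ := h
  have key : ∀ a b : Fin N,
      ∑ v, |(if v = a then (1 : ℝ) else 0) - (if v = b then 1 else 0)| ≤ 2 := by
    intro a b
    calc _ ≤ ∑ v, ((if v = a then (1 : ℝ) else 0) + (if v = b then 1 else 0)) := by
          refine Finset.sum_le_sum fun v _ => ?_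
          split_ifs <;> norm_num
      _ ≤ 2 := by
          rw [Finset.sum_add_distrib]
          simp
          norm_num
  split_ifs with hu
  · simp only [Finset.mem_insert, Finset.mem_singleton] at hu
    rcases hu with rfl | rfl | rfl | rfl
    · simpa [switchSign, hij, hik, hil] using key k j
    · simpa [switchSign, hij.symm, hjk, hjl] using key l i
    · simpa [switchSign, hik.symm, hjk.symm, hkl] using key i l
    · simpa [switchSign, hil.symm, hjl.symm, hkl.symm] using key j k
  · simp only [Finset.mem_insert, Finset.mem_singleton, not_or] at hu
    simp [switchSign, hu]

theorem cmat_switchGraph {i j k l : Fin N} (h : Distinct4 i j k l) {G : SimpleGraph (Fin N)}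
    (hG : switchable i j k l G ≠ 0) (u v : Fin N) :
    cmat N d u v (switchGraph i j k l G) = cmat N d u v G + switchSign i j k l u v := by
  by_cases huv : u = v
  · subst huv
    obtain ⟨hij, hik, hil, hjk, hjl, hkl⟩ := h
    rw [cmat_self, cmat_self, zero_add]
    unfold switchSign
    by_cases h1 : u = i
    · subst h1; simp [*]
    · by_cases h2 : u = j
      · subst h2; simp [*]
      · by_cases h3 : u = k
        · subst h3; simp [*]
        · by_cases h4 : u = l
          · subst h4; simp [*]
          · simp [*]
  · rw [cmat_of_ne huv, cmat_of_ne huv, cen, cen, edgeIndicator_switchGraph h hG]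
    ring

/-- The test functional of the moment recursion changes little under a switching. -/
theorem abs_testFunctional_switch_le (hN : 2 ≤ N) (hd : 2 * d ≤ N - 1) (t : ℕ) {i j k l : Fin N}
    (h : Distinct4 i j k l) {G : SimpleGraph (Fin N)} (hG : switchable i j k l G ≠ 0)
    (a b : Fin N) :
    |cubeEntry (centredMatrix N d (switchGraph i j k l G)) a b *
        fourthTrace (centredMatrix N d (switchGraph i j k l G)) ^ t -
      cubeEntry (centredMatrix N d G) a b * fourthTrace (centredMatrix N d G) ^ t| ≤
      (12 + t) * 32 ^ t / N * (fourthTrace (centredMatrix N d G) + 1 / N) ^ t := by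
  have hN0 : (0 : ℝ) < N := by
    have : 0 < N := by omega
    exact_mod_cast this
  have hN1 : (1 : ℝ) ≤ N := by
    have : 1 ≤ N := by omega
    exact_mod_cast this
  set M := centredMatrix N d G with hM
  set M' := centredMatrix N d (switchGraph i j k l G) with hM'
  have hb : ∀ a b, |M a b| ≤ 1 := fun a b => abs_cmat_le_one hN hd a b _
  have hb' : ∀ a b, |M' a b| ≤ 1 := fun a b => abs_cmat_le_one hN hd a b _
  have hdiff : ∀ a b, M' a b - M a b = switchSign i j k l a b := by
    intro a b
    have := cmat_switchGraph (d := d) h hG a b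
    simp only [hM, hM', centredMatrix, Matrix.of_apply, this]
    ring
  have hQ : ({i, j, k, l} : Finset (Fin N)).card ≤ 4 := Finset.card_le_four
  have hrow : ∀ a, ∑ b, |M' a b - M a b| ≤
      if a ∈ ({i, j, k, l} : Finset (Fin N)) then 2 else 0 := by
    intro a
    simp_rw [hdiff]
    exact sum_abs_switchSign_le h a
  have hcol : ∀ b, ∑ a, |M' a b - M a b| ≤
      if b ∈ ({i, j, k, l} : Finset (Fin N)) then 2 else 0 := by
    intro b
    simp_rw [hdiff, switchSign_comm i j k l _ b]
    exact sum_abs_switchSign_le h b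
  have hY := abs_fourthTrace_sub_le hb hb' hQ hrow hcol (by omega)
  have hH := abs_cubeEntry_sub_le hb hb' hQ hrow hcol a b
  have hH1 := abs_cubeEntry_le_one hb a b
  set Y := fourthTrace M
  set Y' := fourthTrace M'
  have hY0 : 0 ≤ Y := fourthTrace_nonneg M
  have hY0' : 0 ≤ Y' := fourthTrace_nonneg M'
  -- The summand `1 / N` ensures that the change `32 / N²` of `Y` is at most `32 Z / N`, so that
  -- powers of `Y` have relative change `O(1/N)` even when `Y` is tiny.
  set Z := Y + 1 / N with hZ
  have hZN : 1 / (N : ℝ) ≤ Z := by linarith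
  have hZ0 : 0 ≤ Z := by positivity
  have hYZ : Y ≤ 32 * Z := by
    have : 0 ≤ 1 / (N : ℝ) := by positivity
    linarith
  have hN2 : 32 / (N : ℝ) ^ 2 ≤ 32 / N * (1 / N) := le_of_eq (by field_simp)
  have hN3 : 32 / (N : ℝ) * (1 / N) ≤ 32 * (1 / N) := by
    rw [div_eq_mul_one_div (32 : ℝ) (N : ℝ)]
    have : 1 / (N : ℝ) ≤ 1 := by rw [div_le_one hN0]; exact hN1
    have h0 : 0 ≤ 1 / (N : ℝ) := by positivity
    nlinarith
  have hYZ' : Y' ≤ 32 * Z := by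
    have := (abs_le.1 hY).2
    linarith
  have hpow : |Y' ^ t - Y ^ t| ≤ t / N * (32 * Z) ^ t := by
    refine (abs_pow_sub_pow_le Y' Y t).trans ?_
    rw [abs_of_nonneg hY0, abs_of_nonneg hY0']
    rcases t with _ | t
    · simp
    have h1 : |Y' - Y| ≤ 1 / N * (32 * Z) := by
      refine hY.trans (hN2.trans ?_)
      calc 32 / (N : ℝ) * (1 / N) = 1 / N * (32 * (1 / N)) := by ring
        _ ≤ _ := by gcongr
    calc _ ≤ 1 / N * (32 * Z) * ((t + 1 : ℕ) : ℝ) * (32 * Z) ^ t := by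
          rw [Nat.add_sub_cancel]
          have := pow_le_pow_left₀ (le_max_of_le_left hY0') (max_le hYZ' hYZ) t
          gcongr
      _ = _ := by rw [pow_succ]; ring
  have e : cubeEntry M' a b * Y' ^ t - cubeEntry M a b * Y ^ t =
      (cubeEntry M' a b - cubeEntry M a b) * Y' ^ t + cubeEntry M a b * (Y' ^ t - Y ^ t) := by
    ring
  rw [e]
  refine (abs_add_le _ _).trans ?_
  rw [abs_mul, abs_mul, abs_of_nonneg (pow_nonneg hY0' t)]
  calc _ ≤ 12 / N * (32 * Z) ^ t + 1 * (t / N * (32 * Z) ^ t) := by gcongr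
    _ = _ := by rw [mul_pow]; ring

theorem abs_switchPoly_le {p a b c e : ℝ} (hp0 : 0 ≤ p) (hp : p ≤ 1 / 2) (ha : |a| ≤ 1)
    (hb : |b| ≤ 1) (hc : |c| ≤ 1) (he : |e| ≤ 1) : |switchPoly p a b c e| ≤ 8 := by
  have m : ∀ x y : ℝ, |x| ≤ 1 → |y| ≤ 1 → |x * y| ≤ 1 := by
    intro x y hx hy
    rw [abs_mul]
    exact mul_le_one₀ hx (abs_nonneg _) hy
  have m2 : ∀ x y B : ℝ, |x| ≤ 1 → |y| ≤ B → |x * y| ≤ B := by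
    intro x y B hx hy
    rw [abs_mul]
    exact (mul_le_of_le_one_left (abs_nonneg _) hx).trans hy
  have hq : |p * (1 - p)| ≤ 1 := by rw [abs_le]; constructor <;> nlinarith
  -- With `4p(1-p) ≤ 1` and the linear part divided by four, the four pieces contribute `1 + 2 + 2 +
  -- 2`.
  have hq4 : |4 * (p * (1 - p))| ≤ 1 := by
    rw [abs_le]; constructor <;> nlinarith [sq_nonneg (1 - 2 * p)]
  have hr : |1 - 2 * p| ≤ 1 := by rw [abs_le]; constructor <;> linarith
  have hA : |4 * (p * (1 - p)) * ((a + b - c - e) / 4)| ≤ 1 := by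
    refine m2 _ _ 1 hq4 ?_
    rw [abs_le] at *
    constructor <;> linarith
  have hB : |(1 - 2 * p) * (a * b - c * e)| ≤ 2 := by
    refine m2 _ _ 2 hr ?_
    rw [sub_eq_add_neg]
    refine (abs_add_le _ _).trans ?_
    rw [abs_neg]
    linarith [m _ _ ha hb, m _ _ hc he]
  have hC : |a * b * (c + e)| ≤ 2 :=
    m2 _ _ 2 (m _ _ ha hb) ((abs_add_le _ _).trans (by linarith))
  have hD : |c * e * (a + b)| ≤ 2 :=
    m2 _ _ 2 (m _ _ hc he) ((abs_add_le _ _).trans (by linarith))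
  have e' : switchPoly p a b c e = 4 * (p * (1 - p)) * ((a + b - c - e) / 4) +
      (1 - 2 * p) * (a * b - c * e) - a * b * (c + e) + c * e * (a + b) := by
    unfold switchPoly; ring
  rw [e']
  rw [abs_le] at hA hB hC hD ⊢
  constructor <;> linarith [hA.1, hA.2, hB.1, hB.2, hC.1, hC.2, hD.1, hD.2]

/-- Summing the switching polynomial against the cube of a symmetric matrix with vanishing row
sums. -/
theorem sum_cubeEntry_mul_switchPoly {x : Matrix (Fin N) (Fin N) ℝ} (p : ℝ)
    (hx : ∀ u v, x u v = x v u) (hrow : ∀ v, ∑ k, x v k = 0) (hN : 0 < N) :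
    p * (1 - p) * (N : ℝ) ^ 4 * fourthTrace x ≤
      ∑ i, ∑ j, ∑ k, ∑ l, cubeEntry x i j * switchPoly p (x i j) (x k l) (x i k) (x j l) := by
  have hN0 : (0 : ℝ) < N := by exact_mod_cast hN
  -- Summing over all vertices, zero row sums kill every term except the multiple of `x i j` and the
  -- full path of length three.
  have hinner : ∀ i j, ∑ k, ∑ l, switchPoly p (x i j) (x k l) (x i k) (x j l) =
      p * (1 - p) * (N : ℝ) ^ 2 * x i j + (x * x * x) i j := by
    intro i j
    have e1 : ∀ k l, switchPoly p (x i j) (x k l) (x i k) (x j l) =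
        p * (1 - p) * x i j + p * (1 - p) * x k l - p * (1 - p) * x i k - p * (1 - p) * x j l +
        (1 - 2 * p) * x i j * x k l - (1 - 2 * p) * x i k * x j l -
        x i j * x i k * x k l - x i j * (x l k * x j l) + x i j * x i k * x j l +
        x i k * x k l * x l j := by
      intro k l
      rw [hx l j, hx l k]
      unfold switchPoly
      ring
    have h2 : ∑ k, ∑ l, x l k * x j l = 0 := by
      rw [Finset.sum_comm]
      simp_rw [← Finset.sum_mul, hrow]
      simp
    have h3 : ∑ k, ∑ l, x i k * x k l * x l j = (x * x * x) i j := by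
      rw [Finset.sum_comm, Matrix.mul_apply]
      refine Finset.sum_congr rfl fun l _ => ?_
      rw [← Finset.sum_mul, Matrix.mul_apply]
    simp_rw [e1]
    simp only [Finset.sum_add_distrib, Finset.sum_sub_distrib, ← Finset.mul_sum, hrow, h2,
      Finset.sum_const, Finset.card_univ, Fintype.card_fin, nsmul_eq_mul]
    rw [h3]
    simp only [mul_zero, Finset.sum_const_zero]
    ring
  have htr : ∑ i, ∑ j, (x * x * x) i j * x i j = ∑ a, ∑ b, (x * x) a b ^ 2 := by
    have hxx : ∀ a b, (x * x) a b = (x * x) b a := by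
      intro a b
      rw [Matrix.mul_apply, Matrix.mul_apply]
      exact Finset.sum_congr rfl fun c _ => by rw [hx a c, hx c b, mul_comm]
    calc _ = ∑ i, ∑ j, ∑ b, (x * x) i b * x b j * x j i := by
          refine Finset.sum_congr rfl fun i _ => Finset.sum_congr rfl fun j _ => ?_
          rw [Matrix.mul_apply, Finset.sum_mul, hx i j]
      _ = _ := by
          refine Finset.sum_congr rfl fun i _ => ?_
          rw [Finset.sum_comm]
          refine Finset.sum_congr rfl fun b _ => ?_
          simp_rw [mul_assoc]
          rw [← Finset.mul_sum, ← Matrix.mul_apply, hxx b i, pow_two]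
  -- The path term paired with `cubeEntry` is a sum of squares and can be dropped. This sign is the
  -- reason for testing against `x³`.
  have hnonneg : 0 ≤ ∑ i, ∑ j, (x * x * x) i j ^ 2 / (N : ℝ) ^ 2 :=
    Finset.sum_nonneg fun i _ => Finset.sum_nonneg fun j _ => by positivity
  calc p * (1 - p) * (N : ℝ) ^ 4 * fourthTrace x
      = p * (1 - p) * ∑ i, ∑ j, (x * x * x) i j * x i j := by
        rw [htr, fourthTrace]; field_simp
    _ ≤ p * (1 - p) * ∑ i, ∑ j, (x * x * x) i j * x i j +
        ∑ i, ∑ j, (x * x * x) i j ^ 2 / (N : ℝ) ^ 2 := by linarith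
    _ = _ := by
        simp_rw [← Finset.mul_sum, hinner]
        rw [Finset.mul_sum, ← Finset.sum_add_distrib]
        refine Finset.sum_congr rfl fun i _ => ?_
        rw [Finset.mul_sum, ← Finset.sum_add_distrib]
        refine Finset.sum_congr rfl fun j _ => ?_
        unfold cubeEntry
        field_simp

theorem le_add_ite_of_not_distinct4 {i j k l : Fin N} (h : ¬ Distinct4 i j k l) {c : ℝ}
    (hc : 0 ≤ c) :
    8 ≤ c + (if i = j then 8 else 0) + (if i = k then 8 else 0) +
      (if i = l then 8 else 0) + (if j = k then 8 else 0) + (if j = l then 8 else 0) +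
      (if k = l then 8 else 0) := by
  have hite : ∀ (P : Prop) [Decidable P], (0 : ℝ) ≤ (if P then 8 else 0) := by
    intro P _
    split_ifs <;> norm_num
  have g1 := hite (i = j)
  have g2 := hite (i = k)
  have g3 := hite (i = l)
  have g4 := hite (j = k)
  have g5 := hite (j = l)
  have g6 := hite (k = l)
  have hor : i = j ∨ i = k ∨ i = l ∨ j = k ∨ j = l ∨ k = l := by
    unfold Distinct4 at h
    tauto
  rcases hor with h | h | h | h | h | h <;> rw [if_pos h] <;> linarith

/-- Test the switching identity with `(x³)_ij Y^t / N²` and sum over all quadruples. The sum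
dominates `p(1-p) N⁴ Y^(t+1)`, while a switching changes the test function by only `O((Y + 1/N)^t /
N)`. Each of the six possible coincidences among `i, j, k, l` concerns `N³` quadruples with terms of
size at most `8 Y^t`, whence `48 = 6 * 8`. -/
theorem expectation_fourthTrace_pow_succ_le (hd : 1 ≤ d) (hdN : 2 * d ≤ N - 1) (t : ℕ) :
    edgeDensity N d * (1 - edgeDensity N d) * uniformRegularExpectation N d
        (fun G => fourthTrace (centredMatrix N d G) ^ (t + 1)) ≤
      ((12 + t) * 32 ^ t + 48) / N * uniformRegularExpectation N d
        (fun G => (fourthTrace (centredMatrix N d G) + 1 / N) ^ t) := by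
  have hN : 2 ≤ N := by omega
  have hN0 : (0 : ℝ) < N := by
    have : 0 < N := by omega
    exact_mod_cast this
  have hp0 := edgeDensity_nonneg (d := d) hN
  have hp2 := edgeDensity_le_half hN hdN
  set p := edgeDensity N d
  set x : SimpleGraph (Fin N) → Matrix (Fin N) (Fin N) ℝ := centredMatrix N d with hx
  set EZ := uniformRegularExpectation N d (fun G => (fourthTrace (x G) + 1 / N) ^ t) with hEZ
  have hYZ : ∀ G, fourthTrace (x G) ^ t ≤ (fourthTrace (x G) + 1 / N) ^ t := by
    intro G
    have := fourthTrace_nonneg (x G)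
    have h0 : 0 ≤ 1 / (N : ℝ) := by positivity
    gcongr
    linarith
  have hEZ0 : 0 ≤ EZ := uniformRegularExpectation_nonneg fun G _ => by
    have := fourthTrace_nonneg (x G)
    positivity
  set c : ℝ := (12 + t) * 32 ^ t / N with hc
  have hc0 : 0 ≤ c := by positivity
  have hterm : ∀ i j k l : Fin N, uniformRegularExpectation N d (fun G =>
      cubeEntry (x G) i j * fourthTrace (x G) ^ t *
        switchPoly p (x G i j) (x G k l) (x G i k) (x G j l)) ≤
      (c + (if i = j then 8 else 0) + (if i = k then 8 else 0) + (if i = l then 8 else 0) +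
        (if j = k then 8 else 0) + (if j = l then 8 else 0) + (if k = l then 8 else 0)) * EZ := by
    intro i j k l
    by_cases h : Distinct4 i j k l
    · have h' := h
      obtain ⟨hij, hik, hil, hjk, hjl, hkl⟩ := h'
      simp only [hij, hik, hil, hjk, hjl, hkl, if_false, add_zero]
      have := expectation_mul_switchPoly (d := d) h
        (fun G => cubeEntry (x G) i j * fourthTrace (x G) ^ t)
      refine (le_of_eq this).trans ?_
      rw [hEZ, ← uniformRegularExpectation_mul_left]
      refine uniformRegularExpectation_mono fun G _ => ?_
      have h4' : Distinct4 i k j l := ⟨hik, hij, hil, hjk.symm, hkl, hjl⟩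
      have hZ0 : 0 ≤ c * (fourthTrace (x G) + 1 / N) ^ t := by
        have := fourthTrace_nonneg (x G)
        positivity
      rcases switchable_eq_zero_or i k j l G with h0 | ⟨h1, -⟩
      · rw [h0, zero_mul]; exact hZ0
      · rw [h1, one_mul]
        have := abs_testFunctional_switch_le hN hdN t h4' (G := G) (by rw [h1]; norm_num) i j
        rw [switchGraph_comm] at this
        exact (le_abs_self _).trans this
    · have h8 : (8 : ℝ) ≤ c + (if i = j then 8 else 0) + (if i = k then 8 else 0) +
          (if i = l then 8 else 0) + (if j = k then 8 else 0) + (if j = l then 8 else 0) +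
          (if k = l then 8 else 0) := by
        exact le_add_ite_of_not_distinct4 h hc0
      refine le_trans ?_ (mul_le_mul_of_nonneg_right h8 hEZ0)
      rw [hEZ, ← uniformRegularExpectation_mul_left]
      refine uniformRegularExpectation_mono fun G _ => ?_
      have hb : ∀ a b, |x G a b| ≤ 1 := fun a b => abs_cmat_le_one hN hdN a b _
      have hY0 : 0 ≤ fourthTrace (x G) ^ t := pow_nonneg (fourthTrace_nonneg _) _
      refine (le_abs_self _).trans ?_
      rw [abs_mul, abs_mul, abs_of_nonneg hY0]
      have h1 := abs_cubeEntry_le_one hb i j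
      have h2 := abs_switchPoly_le hp0 hp2 (hb i j) (hb k l) (hb i k) (hb j l)
      calc _ ≤ 1 * fourthTrace (x G) ^ t * 8 := by gcongr
        _ ≤ 8 * (fourthTrace (x G) + 1 / N) ^ t := by
          have := hYZ G
          linarith
  have hupper : ∑ i, ∑ j, ∑ k, ∑ l, uniformRegularExpectation N d (fun G =>
      cubeEntry (x G) i j * fourthTrace (x G) ^ t *
        switchPoly p (x G i j) (x G k l) (x G i k) (x G j l)) ≤
      (N : ℝ) ^ 4 * (((12 + t) * 32 ^ t + 48) / N * EZ) := by
    refine (Finset.sum_le_sum fun i _ => Finset.sum_le_sum fun j _ => Finset.sum_le_sum fun k _ =>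
      Finset.sum_le_sum fun l _ => hterm i j k l).trans (le_of_eq ?_)
    simp only [← Finset.sum_mul, Finset.sum_add_distrib, Finset.sum_const, Finset.card_univ,
      Fintype.card_fin, nsmul_eq_mul, Finset.sum_ite_eq, Finset.mem_univ, if_true,
      mul_ite, mul_zero]
    rw [hc]
    field_simp
    ring
  have hlower : (N : ℝ) ^ 4 * (p * (1 - p) * uniformRegularExpectation N d
        (fun G => fourthTrace (x G) ^ (t + 1))) ≤
      ∑ i, ∑ j, ∑ k, ∑ l, uniformRegularExpectation N d (fun G =>
      cubeEntry (x G) i j * fourthTrace (x G) ^ t *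
        switchPoly p (x G i j) (x G k l) (x G i k) (x G j l)) := by
    simp_rw [← uniformRegularExpectation_sum]
    rw [← mul_assoc, ← uniformRegularExpectation_mul_left]
    refine uniformRegularExpectation_mono fun G hG => ?_
    have := sum_cubeEntry_mul_switchPoly (x := x G) p (fun u v => cmat_comm u v G)
      (fun v => sum_cmat hN hG v) (by omega)
    have h2 := mul_le_mul_of_nonneg_right this (pow_nonneg (fourthTrace_nonneg (x G)) t)
    refine le_trans (le_of_eq ?_) (h2.trans (le_of_eq ?_))
    · rw [pow_succ]; ring
    · simp_rw [Finset.sum_mul]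
      refine Finset.sum_congr rfl fun i _ => Finset.sum_congr rfl fun j _ =>
        Finset.sum_congr rfl fun k _ => Finset.sum_congr rfl fun l _ => ?_
      ring
  have := hlower.trans hupper
  exact le_of_mul_le_mul_left this (by positivity)

theorem exists_expectation_fourthTrace_pow_le (t : ℕ) :
    ∃ C : ℝ, 0 ≤ C ∧ ∀ N d : ℕ, 1 ≤ d → 2 * d ≤ N - 1 →
      uniformRegularExpectation N d (fun G => (fourthTrace (centredMatrix N d G) + 1 / N) ^ t) ≤
        C * (1 / (edgeDensity N d * N)) ^ t := by
  induction t with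
  | zero =>
    refine ⟨1, zero_le_one, fun N d _ _ => ?_⟩
    simpa using uniformRegularExpectation_const_le (N := N) (d := d) zero_le_one
  | succ t ih =>
    obtain ⟨C, hC, ih⟩ := ih
    refine ⟨2 ^ t * (2 * ((12 + t) * 32 ^ t + 48) * C + 1), by positivity,
      fun N d hd hdN => ?_⟩
    have hN : 2 ≤ N := by omega
    have hN0 : (0 : ℝ) < N := by
      have : 0 < N := by omega
      exact_mod_cast this
    have hp2 := edgeDensity_le_half hN hdN
    have hppos : 0 < edgeDensity N d := lt_of_lt_of_le (by positivity) (inv_le_edgeDensity hN hd)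
    have h1 := expectation_fourthTrace_pow_succ_le hd hdN t
    have h2 := ih N d hd hdN
    set p := edgeDensity N d
    set u := 1 / (p * N) with hu
    have hu0 : 0 ≤ u := by positivity
    have hu1 : 1 / (N : ℝ) ≤ u := by
      rw [hu]
      refine one_div_le_one_div_of_le (by positivity) ?_
      nlinarith
    set EY := uniformRegularExpectation N d (fun G => fourthTrace (centredMatrix N d G) ^ (t + 1))
    have hEY0 : 0 ≤ EY := uniformRegularExpectation_nonneg fun G _ =>
      pow_nonneg (fourthTrace_nonneg _) _
    have h3 : EY ≤ 2 * ((12 + t) * 32 ^ t + 48) * C * u ^ (t + 1) := by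
      have h4 : p / 2 * EY ≤ ((12 + t) * 32 ^ t + 48) / N * (C * u ^ t) := by
        calc p / 2 * EY ≤ p * (1 - p) * EY := by
              refine mul_le_mul_of_nonneg_right ?_ hEY0
              nlinarith
          _ ≤ _ := h1
          _ ≤ _ := by gcongr
      have h5 : 2 / p * (p / 2 * EY) ≤ 2 / p * (((12 + t) * 32 ^ t + 48) / N * (C * u ^ t)) := by
        gcongr
      refine le_trans (le_of_eq ?_) (h5.trans (le_of_eq ?_))
      · field_simp
      · rw [pow_succ, hu]
        field_simp
    calc _ ≤ uniformRegularExpectation N d (fun G =>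
          2 ^ t * (fourthTrace (centredMatrix N d G) ^ (t + 1) + (1 / N) ^ (t + 1))) := by
          refine uniformRegularExpectation_mono fun G _ => ?_
          exact add_pow_le (fourthTrace_nonneg _) (by positivity) (t + 1)
      _ ≤ 2 ^ t * (EY + (1 / N) ^ (t + 1)) := by
          rw [uniformRegularExpectation_mul_left, uniformRegularExpectation_add]
          gcongr
          exact uniformRegularExpectation_const_le (by positivity)
      _ ≤ 2 ^ t * (2 * ((12 + t) * 32 ^ t + 48) * C * u ^ (t + 1) + u ^ (t + 1)) := by
          gcongr
      _ = _ := by ring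

end FourthMoment

/-! ### Products along paths and exchangeability -/

section Paths

variable {N d : ℕ}

/-- The product of the entries of `x` along the path starting at `a` and continuing with `w`. -/
def chainProd (x : Fin N → Fin N → ℝ) : Fin N → List (Fin N) → ℝ
  | _, [] => 1
  | a, b :: w => x a b * chainProd x b w

theorem chainProd_map (x : Fin N → Fin N → ℝ) (σ : Fin N → Fin N) (a : Fin N)
    (w : List (Fin N)) :
    chainProd (fun u v => x (σ u) (σ v)) a w = chainProd x (σ a) (w.map σ) := by
  induction w generalizing a with
  | nil => rfl
  | cons b w ih => rw [List.map_cons, chainProd, chainProd, ih]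

/-- The correlation of a set `S` of pairs together with a path from `i` to `j` with inner vertices
`f`. -/
noncomputable def pathCorr (N d : ℕ) (S : Finset (Sym2 (Fin N))) (i j : Fin N)
    (f : List (Fin N)) : ℝ :=
  uniformRegularExpectation N d fun G =>
    cenProd N d S G * chainProd (fun u v => cmat N d u v G) i (f ++ [j])

theorem cenProd_comap {S : Finset (Sym2 (Fin N))} {σ : Equiv.Perm (Fin N)}
    (hσ : ∀ v ∈ pairSupport S, σ v = v) (G : SimpleGraph (Fin N)) :
    cenProd N d S (G.comap σ) = cenProd N d S G := by
  refine Finset.prod_congr rfl fun e he => ?_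
  induction e with
  | h u v =>
    rw [cen, cen, edgeIndicator_comap, hσ u (mem_pairSupport.2 ⟨_, he, by simp⟩),
      hσ v (mem_pairSupport.2 ⟨_, he, by simp⟩)]

theorem exists_perm_map_eq (U : Finset (Fin N)) (f f' : List (Fin N))
    (hlen : f.length = f'.length) (hf : f.Nodup) (hf' : f'.Nodup) (hU : ∀ v ∈ f, v ∉ U)
    (hU' : ∀ v ∈ f', v ∉ U) :
    ∃ σ : Equiv.Perm (Fin N), (∀ v ∈ U, σ v = v) ∧ f.map σ = f' := by
  induction f generalizing f' with
  | nil =>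
    refine ⟨1, fun _ _ => rfl, ?_⟩
    rw [List.length_nil] at hlen
    rw [List.length_eq_zero_iff.1 hlen.symm]
    rfl
  | cons v f ih =>
    rcases f' with _ | ⟨v', f'⟩
    · simp at hlen
    simp only [List.length_cons, Nat.add_right_cancel_iff] at hlen
    rw [List.nodup_cons] at hf hf'
    simp only [List.mem_cons, forall_eq_or_imp] at hU hU'
    obtain ⟨σ, hσ, hmap⟩ := ih f' hlen hf.2 hf'.2 hU.2 hU'.2
    have hv : σ v ∉ f' := by
      rw [← hmap, List.mem_map]
      rintro ⟨u, hu, huv⟩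
      exact hf.1 (σ.injective huv ▸ hu)
    have hvU : σ v ∉ U := by
      intro h
      have := hσ _ h
      exact hU.1 (σ.injective this ▸ h)
    refine ⟨Equiv.swap (σ v) v' * σ, fun u hu => ?_, ?_⟩
    · rw [Equiv.Perm.mul_apply, hσ u hu, Equiv.swap_apply_of_ne_of_ne]
      · rintro rfl; exact hvU hu
      · rintro rfl; exact hU'.1 hu
    · rw [List.map_cons, Equiv.Perm.mul_apply, Equiv.swap_apply_left]
      congr 1
      rw [Equiv.Perm.coe_mul, ← List.map_map, hmap]
      conv_rhs => rw [← List.map_id f']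
      refine List.map_congr_left fun u hu => ?_
      rw [id, Equiv.swap_apply_of_ne_of_ne]
      · rintro rfl; exact hv hu
      · rintro rfl; exact hf'.1 hu

/-- A relabelling that fixes `U` carries one list of new inner vertices to any other; the
correlation depends only on their number. -/
theorem pathCorr_eq {S : Finset (Sym2 (Fin N))} {i j : Fin N} {U : Finset (Fin N)}
    (hS : pairSupport S ⊆ U) (hi : i ∈ U) (hj : j ∈ U) {f f' : List (Fin N)}
    (hlen : f.length = f'.length) (hf : f.Nodup) (hf' : f'.Nodup) (hU : ∀ v ∈ f, v ∉ U)
    (hU' : ∀ v ∈ f', v ∉ U) : pathCorr N d S i j f = pathCorr N d S i j f' := by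
  obtain ⟨σ, hσ, hmap⟩ := exists_perm_map_eq U f f' hlen hf hf' hU hU'
  unfold pathCorr
  rw [← uniformRegularExpectation_comap σ (fun G => cenProd N d S G * _)]
  congr 1
  ext G
  rw [cenProd_comap fun v hv => hσ v (hS hv)]
  simp_rw [cmat_comap]
  rw [chainProd_map (fun u v => cmat N d u v G) σ, hσ i hi, List.map_append, List.map_singleton,
    hσ j hj, hmap]

/-- The sum of the path products over all paths from `a` to `j` whose inner vertices belong to the
given blocks. -/
def blockSum (x : Fin N → Fin N → ℝ) (j : Fin N) : List (Finset (Fin N)) → Fin N → ℝ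
  | [], a => x a j
  | B :: Bs, a => ∑ v ∈ B, x a v * blockSum x j Bs v

/-- Since all the path correlations in question coincide, a single one can be recovered from the sum
over the blocks. -/
theorem expectation_mul_blockSum (j : Fin N) (Bs : List (Finset (Fin N))) (c : ℝ) :
    ∀ (Φ : SimpleGraph (Fin N) → ℝ) (a : Fin N),
    (∀ f, List.Forall₂ (fun v B => v ∈ B) f Bs →
      uniformRegularExpectation N d
        (fun G => Φ G * chainProd (fun u v => cmat N d u v G) a (f ++ [j])) = c) →
    uniformRegularExpectation N d
        (fun G => Φ G * blockSum (fun u v => cmat N d u v G) j Bs a) =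
      (Bs.map fun B => (B.card : ℝ)).prod * c := by
  induction Bs with
  | nil =>
    intro Φ a h
    have := h [] List.Forall₂.nil
    simpa [chainProd, blockSum] using this
  | cons B Bs ih =>
    intro Φ a h
    simp only [blockSum, Finset.mul_sum]
    rw [uniformRegularExpectation_sum, List.map_cons, List.prod_cons, mul_assoc,
      ← nsmul_eq_mul, ← Finset.sum_const]
    refine Finset.sum_congr rfl fun v hv => ?_
    simp_rw [← mul_assoc]
    refine ih (fun G => Φ G * cmat N d a v G) v fun f hf => ?_
    have := h (v :: f) (List.Forall₂.cons hv hf)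
    simpa [chainProd, mul_assoc] using this

/-- The Frobenius norm of the square of a matrix. -/
noncomputable def sqNorm (M : Matrix (Fin N) (Fin N) ℝ) : ℝ := √(∑ a, ∑ b, (M * M) a b ^ 2)

theorem sqNorm_nonneg (M : Matrix (Fin N) (Fin N) ℝ) : 0 ≤ sqNorm M := Real.sqrt_nonneg _

/-- `‖Mh‖² = ⟨h, M²h⟩ ≤ ‖M²‖ ‖h‖²` in Frobenius norm, where `h` is `g` cut off to `B`. Hence the
restriction to blocks costs nothing. -/
theorem sum_sq_mulVec_le {M : Matrix (Fin N) (Fin N) ℝ} (hM : ∀ u v, M u v = M v u)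
    (B : Finset (Fin N)) (g : Fin N → ℝ) :
    ∑ a, (∑ v ∈ B, M a v * g v) ^ 2 ≤ sqNorm M * ∑ v, g v ^ 2 := by
  set h : Fin N → ℝ := fun v => if v ∈ B then g v else 0 with hh
  have h1 : ∀ a, ∑ v ∈ B, M a v * g v = ∑ v, M a v * h v := by
    intro a
    simp [hh]
  have h2 : ∑ v, h v ^ 2 ≤ ∑ v, g v ^ 2 := by
    refine Finset.sum_le_sum fun v _ => ?_
    simp only [hh]
    split_ifs
    · exact le_rfl
    · simpa using sq_nonneg (g v)
  have h0 : 0 ≤ ∑ v, h v ^ 2 := Finset.sum_nonneg fun v _ => sq_nonneg _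
  have h3 : ∑ a, (∑ v, M a v * h v) ^ 2 = ∑ q : Fin N × Fin N, (M * M) q.1 q.2 * (h q.1 * h q.2) := by
    rw [Fintype.sum_prod_type]
    calc _ = ∑ a, ∑ u, ∑ v, M u a * M a v * (h u * h v) := by
          refine Finset.sum_congr rfl fun a _ => ?_
          rw [pow_two, Finset.sum_mul_sum]
          refine Finset.sum_congr rfl fun u _ => Finset.sum_congr rfl fun v _ => ?_
          rw [hM u a]; ring
      _ = _ := by
          rw [Finset.sum_comm]
          refine Finset.sum_congr rfl fun u _ => ?_
          rw [Finset.sum_comm]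
          refine Finset.sum_congr rfl fun v _ => ?_
          rw [← Finset.sum_mul, Matrix.mul_apply]
  have h4 : ∑ q : Fin N × Fin N, (h q.1 * h q.2) ^ 2 = (∑ v, h v ^ 2) ^ 2 := by
    rw [Fintype.sum_prod_type, pow_two (∑ v, h v ^ 2), Finset.sum_mul_sum]
    simp_rw [mul_pow]
  simp_rw [h1]
  rw [h3]
  refine (Real.sum_mul_le_sqrt_mul_sqrt _ _ _).trans ?_
  rw [h4, Real.sqrt_sq h0, Fintype.sum_prod_type]
  exact mul_le_mul_of_nonneg_left h2 (sqNorm_nonneg M)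

theorem sum_sq_le_of_abs_le_one {g : Fin N → ℝ} (hg : ∀ a, |g a| ≤ 1) :
    ∑ a, g a ^ 2 ≤ N := by
  refine (Finset.sum_le_card_nsmul _ _ (1 : ℝ) fun a _ => ?_).trans (by simp)
  rw [← sq_abs]
  exact pow_le_one₀ (abs_nonneg _) (hg a)

theorem sum_sq_blockSum_le {M : Matrix (Fin N) (Fin N) ℝ} (hM : ∀ u v, M u v = M v u)
    (hb : ∀ u v, |M u v| ≤ 1) (j : Fin N) (Bs : List (Finset (Fin N))) :
    ∑ a, blockSum M j Bs a ^ 2 ≤ sqNorm M ^ Bs.length * N := by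
  induction Bs with
  | nil => simpa [blockSum] using sum_sq_le_of_abs_le_one fun a => hb a j
  | cons B Bs ih =>
    simp only [blockSum]
    refine (sum_sq_mulVec_le hM B _).trans ?_
    rw [List.length_cons, pow_succ', mul_assoc]
    exact mul_le_mul_of_nonneg_left ih (sqNorm_nonneg M)

theorem sqNorm_le {M : Matrix (Fin N) (Fin N) ℝ} (hb : ∀ u v, |M u v| ≤ 1) :
    sqNorm M ≤ (N : ℝ) ^ 2 := by
  unfold sqNorm
  rw [Real.sqrt_le_left (by positivity)]
  have : ∀ a b, (M * M) a b ^ 2 ≤ (N : ℝ) ^ 2 := fun a b => by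
    rw [← sq_abs]
    exact pow_le_pow_left₀ (abs_nonneg _) (abs_mul_self_apply_le hb a b) 2
  refine (Finset.sum_le_card_nsmul _ _ ((N : ℝ) * N ^ 2) fun a _ => ?_).trans ?_
  · exact (Finset.sum_le_card_nsmul _ _ _ fun b _ => this a b).trans (by simp)
  · simp only [Finset.card_univ, Fintype.card_fin, nsmul_eq_mul]
    exact le_of_eq (by ring)

theorem abs_blockSum_le {M : Matrix (Fin N) (Fin N) ℝ} (hM : ∀ u v, M u v = M v u)
    (hb : ∀ u v, |M u v| ≤ 1) (j i : Fin N) {t : ℕ} {Bs : List (Finset (Fin N))}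
    (hlen : Bs.length = 4 * t + 2) :
    |blockSum M j Bs i| ≤ (N : ℝ) ^ (4 * t + 2) * fourthTrace M ^ t := by
  have hN0 : (0 : ℝ) < N := by exact_mod_cast Nat.zero_lt_of_lt i.2
  have hY0 := fourthTrace_nonneg M
  rcases Bs with _ | ⟨B, Bs⟩
  · simp at hlen
  have hlen' : Bs.length = 4 * t + 1 := by
    rw [List.length_cons] at hlen; omega
  -- The first vertex is split off by Cauchy–Schwarz; the other `4t + 1` each cost one `sqNorm`. One
  -- of these is bounded by `N²`, and the remaining `4t` pair up into `(N⁴ Y)^(2t)`, the square of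
  -- `N^(4t) Y^t`.
  refine abs_le_of_sq_le_sq ?_ (by positivity)
  have hsq : sqNorm M ^ 2 = (N : ℝ) ^ 4 * fourthTrace M := by
    unfold sqNorm fourthTrace
    rw [Real.sq_sqrt (by positivity)]
    field_simp
  calc blockSum M j (B :: Bs) i ^ 2 ≤ (∑ v ∈ B, M i v ^ 2) * ∑ v ∈ B, blockSum M j Bs v ^ 2 :=
        Finset.sum_mul_sq_le_sq_mul_sq _ _ _
    _ ≤ (∑ v, M i v ^ 2) * ∑ v, blockSum M j Bs v ^ 2 := by
        gcongr <;> exact Finset.subset_univ B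
    _ ≤ N * (sqNorm M ^ Bs.length * N) := by
        gcongr
        · exact sum_sq_le_of_abs_le_one fun v => hb i v
        · exact sum_sq_blockSum_le hM hb j Bs
    _ = N * (sqNorm M * ((sqNorm M ^ 2) ^ (2 * t)) * N) := by
        rw [hlen', ← pow_mul, ← pow_succ']; congr 4; ring
    _ ≤ N * ((N : ℝ) ^ 2 * ((sqNorm M ^ 2) ^ (2 * t)) * N) := by
        gcongr
        exact sqNorm_le hb
    _ = _ := by
        rw [hsq]; ring

/-- Residue classes modulo `r` serve as disjoint blocks of size about `N / r`; removing `U` costs at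
most half of each. -/
theorem le_card_filter_mod (U : Finset (Fin N)) {r t : ℕ} (ht : t < r)
    (hN : 2 * r * (1 + U.card) ≤ N) :
    (N : ℝ) / (2 * r) ≤ ((Finset.univ.filter fun v : Fin N => (v : ℕ) % r = t ∧ v ∉ U).card : ℝ) := by
  have hr : 0 < r := by omega
  have h1 : N / r ≤ (Finset.univ.filter fun v : Fin N => (v : ℕ) % r = t).card := by
    rw [← Fintype.card_fin (N / r), ← Finset.card_univ]
    have hlt : ∀ q : Fin (N / r), (q : ℕ) * r + t < N := by
      intro q
      have : ((q : ℕ) + 1) * r ≤ N / r * r := Nat.mul_le_mul_right r q.2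
      have := Nat.div_mul_le_self N r
      nlinarith
    refine Finset.card_le_card_of_injOn (fun q => ⟨(q : ℕ) * r + t, hlt q⟩) ?_ ?_
    · intro q _
      simp [Nat.mod_eq_of_lt ht]
    · intro q _ q' _ h
      simp only [Fin.mk.injEq, Nat.add_right_cancel_iff] at h
      exact Fin.ext (Nat.eq_of_mul_eq_mul_right hr h)
  have h2 : (Finset.univ.filter fun v : Fin N => (v : ℕ) % r = t).card ≤
      (Finset.univ.filter fun v : Fin N => (v : ℕ) % r = t ∧ v ∉ U).card + U.card := by
    refine (Finset.card_le_card ?_).trans (Finset.card_union_le _ _)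
    intro v hv
    simp only [Finset.mem_filter, Finset.mem_univ, true_and, Finset.mem_union] at hv ⊢
    tauto
  have h3 : N < (N / r + 1) * r := by
    have := Nat.lt_div_mul_add (a := N) hr
    nlinarith
  have h4 : N ≤ 2 * r * (Finset.univ.filter fun v : Fin N => (v : ℕ) % r = t ∧ v ∉ U).card := by
    have h5 := h1.trans h2
    have h6 : N / r * r ≤ ((Finset.univ.filter fun v : Fin N => (v : ℕ) % r = t ∧ v ∉ U).card +
      U.card) * r := Nat.mul_le_mul_right r h5
    nlinarith
  have hr' : (0 : ℝ) < r := by exact_mod_cast hr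
  rw [div_le_iff₀ (by positivity)]
  have : (N : ℝ) ≤ 2 * r * ((Finset.univ.filter fun v : Fin N => (v : ℕ) % r = t ∧ v ∉ U).card : ℝ) := by
    exact_mod_cast h4
  linarith

theorem pow_length_le_prod_map {ι : Type*} {c : ℝ} (hc : 0 ≤ c) {g : ι → ℝ} {l : List ι}
    (h : ∀ a ∈ l, c ≤ g a) : c ^ l.length ≤ (l.map g).prod := by
  induction l with
  | nil => simp
  | cons a l ih =>
    rw [List.length_cons, List.map_cons, List.prod_cons, pow_succ']
    have h1 := ih fun b hb => h b (List.mem_cons_of_mem a hb)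
    have h2 := h a List.mem_cons_self
    exact mul_le_mul h2 h1 (by positivity) (hc.trans h2)

/-- Average over inner vertices taken one from each of `r` disjoint blocks. Such vertices are
automatically distinct, so exchangeability applies to every term, while the sum over the blocks
factorises into matrix products controlled by `Y`. -/
theorem abs_pathCorr_le (hN : 2 ≤ N) (hdN : 2 * d ≤ N - 1) {S : Finset (Sym2 (Fin N))}
    {i j : Fin N} {U : Finset (Fin N)} (hS : pairSupport S ⊆ U) (hi : i ∈ U) (hj : j ∈ U)
    {t : ℕ} (hUN : 2 * (4 * t + 2) * (1 + U.card) ≤ N) {f : List (Fin N)}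
    (hlen : f.length = 4 * t + 2) (hf : f.Nodup) (hU : ∀ v ∈ f, v ∉ U) :
    |pathCorr N d S i j f| ≤ (2 * (4 * t + 2 : ℕ)) ^ (4 * t + 2) * uniformRegularExpectation N d
      (fun G => fourthTrace (centredMatrix N d G) ^ t) := by
  classical
  set r := 4 * t + 2 with hr
  have hN0 : (0 : ℝ) < N := by
    have : 0 < N := by omega
    exact_mod_cast this
  have hr0 : (0 : ℝ) < (r : ℕ) := by exact_mod_cast (by omega : 0 < r)
  set Bs : List (Finset (Fin N)) := (List.range r).map fun t =>
    Finset.univ.filter fun v : Fin N => (v : ℕ) % r = t ∧ v ∉ U with hBs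
  have hBlen : Bs.length = r := by simp [hBs]
  have hconst : ∀ f', List.Forall₂ (fun v B => v ∈ B) f' Bs →
      uniformRegularExpectation N d (fun G => cenProd N d S G *
        chainProd (fun u v => cmat N d u v G) i (f' ++ [j])) = pathCorr N d S i j f := by
    intro f' hf'
    have hl' := hf'.length_eq
    rw [hBs, List.forall₂_map_right_iff] at hf'
    simp only [Finset.mem_filter, Finset.mem_univ, true_and] at hf'
    have hmod : f'.map (fun v : Fin N => (v : ℕ) % r) = List.range r := by
      have := hf'.imp fun _ _ h => h.1
      rw [← List.forall₂_map_left_iff (R := fun a b : ℕ => a = b), List.forall₂_eq_eq_eq] at this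
      exact this
    have hnd : f'.Nodup := List.Nodup.of_map (fun v : Fin N => (v : ℕ) % r) (by
      rw [hmod]; exact List.nodup_range)
    have hU' : ∀ v ∈ f', v ∉ U := by
      have := hf'.imp fun _ _ h => h.symm
      rw [List.forall₂_and_left] at this
      exact this.1
    exact pathCorr_eq hS hi hj (by omega) hnd hf hU' hU
  have hsum := expectation_mul_blockSum j Bs (pathCorr N d S i j f) (cenProd N d S) i hconst
  have hup : |uniformRegularExpectation N d (fun G => cenProd N d S G *
      blockSum (fun u v => cmat N d u v G) j Bs i)| ≤ (N : ℝ) ^ r *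
        uniformRegularExpectation N d (fun G => fourthTrace (centredMatrix N d G) ^ t) := by
    refine (abs_uniformRegularExpectation_le _).trans ?_
    rw [← uniformRegularExpectation_mul_left]
    refine uniformRegularExpectation_mono fun G _ => ?_
    rw [abs_mul]
    refine (mul_le_of_le_one_left (abs_nonneg _) (abs_prod_cen_le_one hN hdN S G)).trans ?_
    exact abs_blockSum_le (M := centredMatrix N d G) (fun u v => cmat_comm u v G)
      (fun u v => abs_cmat_le_one hN hdN u v G) j i hBlen
  have hprod : ((N : ℝ) / (2 * r)) ^ r ≤ (Bs.map fun B => (B.card : ℝ)).prod := by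
    rw [← hBlen]
    refine pow_length_le_prod_map (by positivity) fun B hB => ?_
    rw [hBs, List.mem_map] at hB
    obtain ⟨t', ht', rfl⟩ := hB
    rw [hBlen]
    exact le_card_filter_mod U (List.mem_range.1 ht') hUN
  rw [hsum, abs_mul, abs_of_nonneg ((by positivity : (0 : ℝ) ≤ ((N : ℝ) / (2 * r)) ^ r).trans hprod)]
    at hup
  have h1 := (mul_le_mul_of_nonneg_right hprod (abs_nonneg (pathCorr N d S i j f))).trans hup
  have h2 : 0 < ((N : ℝ) / (2 * r)) ^ r := by positivity
  rw [← mul_le_mul_iff_right₀ h2]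
  refine h1.trans (le_of_eq ?_)
  rw [← mul_assoc, ← mul_pow]
  congr 2
  field_simp

end Paths

/-! ### Iterating the recurrence along a path -/

section Iteration

variable {N d : ℕ}

/-- The set `T ∪ {ia}` consists of `S` and a path from `i` to `j` with new inner vertices `f`,
whose first edge is `ia`. -/
structure IsPathExtension (d : ℕ) (S : Finset (Sym2 (Fin N))) (i j : Fin N) (f : List (Fin N))
    (a : Fin N) (T : Finset (Sym2 (Fin N))) : Prop where
  nodup : f.Nodup
  notMem : ∀ v ∈ f, v ∉ insert i (insert j (pairSupport S))
  ne : i ≠ a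
  edge_notMem : s(i, a) ∉ T
  not_isDiag : ∀ e ∈ T, ¬ e.IsDiag
  card_eq : T.card = S.card + f.length
  prod_eq : ∃ w, a :: w = f ++ [j] ∧ ∀ G, cenProd N d T G =
    cenProd N d S G * chainProd (fun u v => cmat N d u v G) a w

variable {S T : Finset (Sym2 (Fin N))} {i j a : Fin N} {f : List (Fin N)}

theorem isPathExtension_nil (hij : i ≠ j) (he : s(i, j) ∉ S) (hS : ∀ e ∈ S, ¬ e.IsDiag) :
    IsPathExtension d S i j [] j S :=
  ⟨List.nodup_nil, by simp, hij, he, hS, by simp, [], rfl, fun G => by simp [chainProd]⟩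

theorem IsPathExtension.corr_eq (h : IsPathExtension d S i j f a T) :
    corr N d (insert s(i, a) T) = pathCorr N d S i j f := by
  obtain ⟨w, hw, hprod⟩ := h.prod_eq
  unfold pathCorr corr
  congr 1
  ext G
  rw [← hw, chainProd]
  change cenProd N d _ G = _
  rw [← cenProd_mul_cmat h.ne h.edge_notMem, hprod]
  ring

theorem IsPathExtension.extend (h : IsPathExtension d S i j f a T) {U : Finset (Fin N)}
    (hT : ∀ e ∈ T, ∀ v ∈ e, v ∈ U) (hS : pairSupport S ⊆ U) (hf : ∀ v ∈ f, v ∈ U) (hi : i ∈ U)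
    (hj : j ∈ U) (ha : a ∈ U) {k l : Fin N} (hk : k ∉ U) (hl : l ∉ U) (hkl : k ≠ l) :
    IsPathExtension d S i j (k :: l :: f) k (insert s(k, l) (insert s(l, a) T)) := by
  have hik : i ≠ k := fun h => hk (h ▸ hi)
  have hla : l ≠ a := fun h => hl (h ▸ ha)
  have hil : i ≠ l := fun h => hl (h ▸ hi)
  have hak : a ≠ k := fun h => hk (h ▸ ha)
  have hnew : ∀ v, v ∉ U → v ∉ insert i (insert j (pairSupport S)) := by
    intro v hv hm
    rcases Finset.mem_insert.1 hm with rfl | hm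
    · exact hv hi
    · rcases Finset.mem_insert.1 hm with rfl | hm
      · exact hv hj
      · exact hv (hS hm)
  have h1 : s(l, a) ∉ T := fun h => hl (hT _ h l (by simp))
  have h2 : s(k, l) ∉ insert s(l, a) T := by
    rw [Finset.mem_insert, not_or]
    refine ⟨fun h => ?_, fun h => hk (hT _ h k (by simp))⟩
    rw [Sym2.eq_iff] at h
    grind
  have h3 : s(i, k) ∉ insert s(k, l) (insert s(l, a) T) := by
    rw [Finset.mem_insert, Finset.mem_insert, not_or, not_or]
    refine ⟨fun h => ?_, fun h => ?_, fun h => hk (hT _ h k (by simp))⟩ <;>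
    · rw [Sym2.eq_iff] at h
      grind
  refine ⟨?_, ?_, hik, h3, ?_, ?_, ?_⟩
  · rw [List.nodup_cons, List.nodup_cons, List.mem_cons, not_or]
    exact ⟨⟨hkl, fun h => hk (hf k h)⟩, fun h => hl (hf l h), h.nodup⟩
  · intro v hv
    rcases List.mem_cons.1 hv with rfl | hv
    · exact hnew _ hk
    · rcases List.mem_cons.1 hv with rfl | hv
      · exact hnew _ hl
      · exact h.notMem v hv
  · intro e he
    rcases Finset.mem_insert.1 he with rfl | he
    · simpa using hkl
    · rcases Finset.mem_insert.1 he with rfl | he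
      · simpa using hla
      · exact h.not_isDiag e he
  · rw [Finset.card_insert_of_notMem h2, Finset.card_insert_of_notMem h1, h.card_eq]
    simp only [List.length_cons]
    ring
  · obtain ⟨w, hw, hprod⟩ := h.prod_eq
    refine ⟨l :: a :: w, by rw [hw]; rfl, fun G => ?_⟩
    rw [chainProd, chainProd, ← cenProd_mul_cmat hkl h2, ← cenProd_mul_cmat hla h1, hprod]
    ring

/-- Replace the edge at `i` on the current path `K` times. One replacement multiplies later errors
by `2/p`, but they carry two more edges worth `p²`. The net factor `2p` is at most `1`, so the `K`
errors simply add up. -/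
theorem abs_corr_insert_le_iterate (hd : 1 ≤ d) (hdN : 2 * d ≤ N - 1) {n J M : ℕ} {C : ℝ}
    (hC : 0 ≤ C)
    (H : ∀ T : Finset (Sym2 (Fin N)), (∀ e ∈ T, ¬ e.IsDiag) → T.card ≤ J →
      |corr N d T| ≤ C * corrWeight (corrScale N d) (edgeDensity N d) n T.card)
    (hM : M + 3 ≤ J) (hNM : 20 * (M + 1) ≤ N) (K : ℕ) :
    ∀ (f : List (Fin N)) (a : Fin N) (T : Finset (Sym2 (Fin N))),
    IsPathExtension d S i j f a T → n ≤ T.card → T.card + 2 * K ≤ M → ∀ Q : ℝ,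
    (∀ f' a' T', IsPathExtension d S i j f' a' T' → f'.length = f.length + 2 * K →
      |corr N d (insert s(i, a') T')| ≤ Q) →
    |corr N d (insert s(i, a) T)| ≤
      K * (4000 * (5 * ((M : ℝ) + 1)) ^ 2 * C * corrScale N d *
        corrWeight (corrScale N d) (edgeDensity N d) n T.card) +
      (2 / edgeDensity N d) ^ K * Q := by
  classical
  have hN : 2 ≤ N := by omega
  have hp2 := edgeDensity_le_half hN hdN
  have hN0 : (0 : ℝ) < N := by
    have : 0 < N := by omega
    exact_mod_cast this
  have hppos : 0 < edgeDensity N d := lt_of_lt_of_le (by positivity) (inv_le_edgeDensity hN hd)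
  have hs := corrScale_nonneg (N := N) (d := d)
  induction K with
  | zero =>
    intro f a T h _ _ Q hQ
    simpa using hQ f a T h rfl
  | succ K ih =>
    intro f a T h hn hTM Q hQ
    set p := edgeDensity N d
    set s := corrScale N d
    set D := 4000 * (5 * ((M : ℝ) + 1)) ^ 2 * C * s with hD
    have hD0 : 0 ≤ D := by positivity
    set U : Finset (Fin N) := pairSupport T ∪ pairSupport S ∪ f.toFinset ∪ {i, j, a} with hU
    -- `|U| ≤ 2|T| + 2|S| + |f| + 3` and `|S| + |f| = |T| ≤ M`.
    have hcardU : U.card ≤ 5 * (M + 1) := by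
      have c1 := card_pairSupport_le T
      have c2 := card_pairSupport_le S
      have c3 := f.toFinset_card_le
      have c4 : ({i, j, a} : Finset (Fin N)).card ≤ 3 := Finset.card_le_three
      have c5 : U.card ≤ _ :=
        Finset.card_union_le (pairSupport T ∪ pairSupport S ∪ f.toFinset) {i, j, a}
      have c6 := Finset.card_union_le (pairSupport T ∪ pairSupport S) f.toFinset
      have c7 := Finset.card_union_le (pairSupport T) (pairSupport S)
      have c8 := h.card_eq
      omega
    have hTU : ∀ e ∈ T, ∀ v ∈ e, v ∈ U := fun e he v hv => by
      have : v ∈ pairSupport T := mem_pairSupport.2 ⟨e, he, hv⟩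
      simp [hU, this]
    have hSU : pairSupport S ⊆ U := fun v hv => by simp [hU, hv]
    have hfU : ∀ v ∈ f, v ∈ U := fun v hv => by simp [hU, hv]
    have hiU : i ∈ U := by simp [hU]
    have hjU : j ∈ U := by simp [hU]
    have haU : a ∈ U := by simp [hU]
    set W := corrWeight s p n with hW
    have hW0 : ∀ q, 0 ≤ W q := fun q => corrWeight_nonneg hs hppos.le
    have hW2 : W (T.card + 2) = p ^ 2 * W T.card := by
      have e1 : W (T.card + 1) = p * W T.card := corrWeight_succ_of_le hn
      have e2 : W (T.card + 1 + 1) = p * W (T.card + 1) := corrWeight_succ_of_le (by omega)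
      rw [show T.card + 2 = T.card + 1 + 1 by ring, e2, e1]
      ring
    have hstep := abs_corr_insert_le hd hdN hC H h.not_isDiag (by omega) hn hTU (by omega) h.ne
      hiU haU h.edge_notMem (Q := K * (D * W (T.card + 2)) + (2 / p) ^ K * Q) (by
        intro k l hk hl hkl
        have h' := h.extend hTU hSU hfU hiU hjU haU hk hl hkl
        have hc' : (insert s(k, l) (insert s(l, a) T)).card = T.card + 2 := by
          rw [h'.card_eq, h.card_eq]
          simp only [List.length_cons]
          ring
        have := ih _ _ _ h' (by omega) (by omega) Q (by
          intro f' a' T' hp' hl'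
          refine hQ f' a' T' hp' ?_
          rw [hl']
          simp only [List.length_cons]
          ring)
        rw [hc'] at this
        exact this)
    refine hstep.trans ?_
    have hU2 : 4000 * (U.card : ℝ) ^ 2 * C * s * W T.card ≤ D * W T.card := by
      refine mul_le_mul_of_nonneg_right ?_ (hW0 _)
      rw [hD]
      have : (U.card : ℝ) ≤ 5 * ((M : ℝ) + 1) := by exact_mod_cast hcardU
      gcongr
    have h2 : 2 / p * (K * (D * W (T.card + 2))) ≤ K * (D * W T.card) := by
      rw [hW2]
      have e : 2 / p * (K * (D * (p ^ 2 * W T.card))) = 2 * p * (K * (D * W T.card)) := by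
        field_simp
      rw [e]
      refine mul_le_of_le_one_left ?_ (by linarith)
      have := hW0 T.card
      positivity
    calc _ ≤ D * W T.card + (K * (D * W T.card) + 2 / p * ((2 / p) ^ K * Q)) := by
          refine add_le_add hU2 ?_
          rw [mul_add]
          exact add_le_add h2 le_rfl
      _ = _ := by
          push_cast
          ring

end Iteration

/-! ### The bound for all correlations

The bound holds uniformly for all degrees `1 ≤ d ≤ N - 2`; neither `d → ∞` nor the condition
involving `η` is needed. -/

section MainBound

/-- Correlations of the sparse half of the regular graphs are bounded by a constant times the
weight. -/
def CorrBound (n m : ℕ) : Prop :=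
  ∃ C : ℝ, 0 ≤ C ∧ ∀ N d : ℕ, 1 ≤ d → 2 * d ≤ N - 1 → ∀ T : Finset (Sym2 (Fin N)),
    (∀ e ∈ T, ¬ e.IsDiag) → T.card = m →
      |corr N d T| ≤ C * corrWeight (corrScale N d) (edgeDensity N d) n m

theorem corrBound_zero (m : ℕ) : CorrBound 0 m := by
  refine ⟨(16 * m + 8) ^ m, by positivity, fun N d hd hdN T hT hm => ?_⟩
  have := abs_corr_le_edgeDensity_pow hd hdN T hT
  rw [hm] at this
  simpa [corrWeight, mul_pow] using this

theorem exists_uniform_corrBound {n : ℕ} (h : ∀ m, CorrBound n m) (J : ℕ) :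
    ∃ C : ℝ, 0 ≤ C ∧ ∀ N d : ℕ, 1 ≤ d → 2 * d ≤ N - 1 → ∀ T : Finset (Sym2 (Fin N)),
      (∀ e ∈ T, ¬ e.IsDiag) → T.card ≤ J →
        |corr N d T| ≤ C * corrWeight (corrScale N d) (edgeDensity N d) n T.card := by
  choose C hC hb using h
  refine ⟨∑ m ∈ Finset.range (J + 1), C m, Finset.sum_nonneg fun m _ => hC m,
    fun N d hd hdN T hT hJ => ?_⟩
  refine (hb T.card N d hd hdN T hT rfl).trans ?_
  refine mul_le_mul_of_nonneg_right ?_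
    (corrWeight_nonneg corrScale_nonneg (edgeDensity_nonneg (by omega)))
  exact Finset.single_le_sum (f := C) (fun m _ => hC m) (Finset.mem_range.2 (by omega))

/-- Makes the claimed bound trivial for the finitely many small `N`, as correlations are at most
`1`. -/
theorem inv_pow_le_corrWeight {N d n m : ℕ} (hd : 1 ≤ d) (hdN : 2 * d ≤ N - 1) :
    (1 / (N : ℝ)) ^ m ≤ corrWeight (corrScale N d) (edgeDensity N d) n m := by
  have h1 := inv_le_corrScale (N := N) hd
  have h2 := inv_le_edgeDensity (N := N) (by omega) hd
  have h0 : 0 ≤ 1 / (N : ℝ) := by positivity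
  unfold corrWeight
  rw [show m = min m n + (m - n) by omega, pow_add]
  rw [show min (min m n + (m - n)) n = min m n by omega,
    show min m n + (m - n) - n = m - n by omega]
  exact mul_le_mul (pow_le_pow_left₀ h0 h1 _) (pow_le_pow_left₀ h0 h2 _) (by positivity)
    (pow_nonneg (h0.trans h1) _)

/-- One edge `ij` of `T` is opened into a long path. All errors on the way carry the new factor `s`;
the final path correlation is handled by moments of `Y` if `N p^E ≥ 1`, and by the a priori bound
otherwise. -/
theorem corrBound_succ {n : ℕ} (h : ∀ m, CorrBound n m) (m : ℕ) : CorrBound (n + 1) m := by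
  classical
  -- For `m ≤ n` both weights are `s^m`.
  rcases le_or_gt m n with hmn | hmn
  · obtain ⟨C, hC, hb⟩ := h m
    refine ⟨C, hC, fun N d hd hdN T hT hm => (hb N d hd hdN T hT hm).trans (le_of_eq ?_)⟩
    unfold corrWeight
    rw [min_eq_left hmn, min_eq_left (by omega), Nat.sub_eq_zero_of_le hmn,
      Nat.sub_eq_zero_of_le (by omega)]
  obtain ⟨m, rfl⟩ : ∃ m', m = m' + 1 := ⟨m - 1, by omega⟩
  have hnm : n ≤ m := by omega
  -- lengths of the iteration in the dense and the sparse case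
  obtain ⟨t, ht⟩ : ∃ t, t = n + 2 := ⟨_, rfl⟩
  -- `L` replacements create `2 * L = 4 * t + 2` inner vertices, the length required by
  -- `abs_pathCorr_le`.
  obtain ⟨L, hL⟩ : ∃ L, L = 2 * t + 1 := ⟨_, rfl⟩
  -- `p^(-L)` comes from the replacements, `p^(-t)` from the moments, and `p^m` suffices on the
  -- right-hand side.
  obtain ⟨E, hE⟩ : ∃ E, E = L + t + m := ⟨_, rfl⟩
  -- In the sparse case `p^E < 1/N`, so `p^R` yields `N^(-(n+1)) ≤ s^(n+1)`.
  obtain ⟨R, hR⟩ : ∃ R, R = E * (n + 1) := ⟨_, rfl⟩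
  have hLR : L ≤ R := by
    rw [hR, hE]
    nlinarith
  obtain ⟨M, hM⟩ : ∃ M, M = m + 2 * R := ⟨_, rfl⟩
  obtain ⟨C, hC, H⟩ := exists_uniform_corrBound h (M + 3)
  obtain ⟨C₀, hC₀, H₀⟩ := corrBound_zero (m + 2 * R + 1)
  obtain ⟨C₁, hC₁, H₁⟩ := exists_expectation_fourthTrace_pow_le t
  obtain ⟨N₀, hN₀⟩ : ∃ N₀, N₀ = 20 * (M + 1) + 2 * (4 * t + 2) * (2 * m + 3) := ⟨_, rfl⟩
  set D : ℝ := 4000 * (5 * ((M : ℝ) + 1)) ^ 2 * C with hD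
  have hD0 : 0 ≤ D := by positivity
  set c : ℝ := (2 * (4 * t + 2 : ℕ)) ^ (4 * t + 2) with hc
  refine ⟨R * D + 2 ^ R * C₀ + (L * D + 2 ^ L * (c * C₁)) + (N₀ : ℝ) ^ (m + 1), by positivity,
    fun N d hd hdN T hT hm => ?_⟩
  have hN : 2 ≤ N := by omega
  have hNpos : (0 : ℝ) < N := by
    have : 0 < N := by omega
    exact_mod_cast this
  have hp2 := edgeDensity_le_half hN hdN
  have hpinv := inv_le_edgeDensity hN hd
  have hppos : 0 < edgeDensity N d := lt_of_lt_of_le (by positivity) hpinv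
  have hs := corrScale_nonneg (N := N) (d := d)
  have hsinv := inv_le_corrScale (N := N) hd
  have hw := inv_pow_le_corrWeight (n := n + 1) (m := m + 1) hd hdN
  have hweq : corrWeight (corrScale N d) (edgeDensity N d) (n + 1) (m + 1) =
      corrScale N d ^ (n + 1) * edgeDensity N d ^ (m - n) := by
    unfold corrWeight
    rw [min_eq_right (by omega), Nat.add_sub_add_right]
  have hweq' : corrScale N d * corrWeight (corrScale N d) (edgeDensity N d) n m =
      corrWeight (corrScale N d) (edgeDensity N d) (n + 1) (m + 1) := by
    rw [hweq]
    unfold corrWeight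
    rw [min_eq_right hnm, pow_succ]
    ring
  set W := corrWeight (corrScale N d) (edgeDensity N d) (n + 1) (m + 1) with hW
  have hW0 : 0 ≤ W := le_trans (by positivity) hw
  have hsum : ∀ X : ℝ, (X ≤ R * D + 2 ^ R * C₀ ∨ X ≤ L * D + 2 ^ L * (c * C₁) ∨
      X ≤ (N₀ : ℝ) ^ (m + 1)) → X * W ≤
      (R * D + 2 ^ R * C₀ + (L * D + 2 ^ L * (c * C₁)) + (N₀ : ℝ) ^ (m + 1)) * W := by
    intro X hX
    refine mul_le_mul_of_nonneg_right ?_ hW0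
    have e1 : 0 ≤ R * D + 2 ^ R * C₀ := by positivity
    have e2 : 0 ≤ L * D + 2 ^ L * (c * C₁) := by positivity
    have e3 : (0 : ℝ) ≤ (N₀ : ℝ) ^ (m + 1) := by positivity
    rcases hX with h | h | h <;> linarith
  by_cases hNN : N₀ ≤ N
  swap
  · refine le_trans ?_ (hsum _ (Or.inr (Or.inr le_rfl)))
    refine (abs_corr_le_one hN hdN T).trans ?_
    calc (1 : ℝ) ≤ ((N₀ : ℝ) * (1 / N)) ^ (m + 1) := by
          refine one_le_pow₀ ?_
          rw [mul_one_div, one_le_div hNpos]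
          exact_mod_cast (by omega : N ≤ N₀)
      _ = (N₀ : ℝ) ^ (m + 1) * (1 / (N : ℝ)) ^ (m + 1) := mul_pow _ _ _
      _ ≤ _ := by gcongr
  obtain ⟨e, he⟩ : T.Nonempty := Finset.card_pos.1 (by omega)
  obtain ⟨S, heS, rfl⟩ : ∃ S, e ∉ S ∧ insert e S = T :=
    ⟨T.erase e, Finset.notMem_erase _ _, Finset.insert_erase he⟩
  have hSc : S.card = m := by
    rw [Finset.card_insert_of_notMem heS] at hm
    omega
  have hSd : ∀ e ∈ S, ¬ e.IsDiag := fun e he => hT e (Finset.mem_insert_of_mem he)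
  have hed := hT e (Finset.mem_insert_self _ _)
  induction e with
  | h i j =>
  have hij : i ≠ j := by simpa using hed
  have hbase := isPathExtension_nil (d := d) hij heS hSd
  have hiter := fun (K : ℕ) (hK : K ≤ R) => abs_corr_insert_le_iterate (S := S) (i := i) (j := j)
    hd hdN hC (H N d hd hdN) (M := M) le_rfl (by omega) K [] j S hbase (by omega) (by omega)
  have hrew : ∀ K : ℕ, (K : ℝ) * (4000 * (5 * ((M : ℝ) + 1)) ^ 2 * C * corrScale N d *
      corrWeight (corrScale N d) (edgeDensity N d) n S.card) = K * D * W := by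
    intro K
    rw [hSc, mul_assoc _ (corrScale N d), hweq', hD]
    ring
  by_cases hdense : 1 ≤ N * edgeDensity N d ^ E
  · refine le_trans ?_ (hsum _ (Or.inr (Or.inl le_rfl)))
    have h1 := hiter L hLR (c * (C₁ * (1 / (edgeDensity N d * N)) ^ t)) (by
      intro f' a' T' hext hlen
      rw [hext.corr_eq]
      have hUc : (insert i (insert j (pairSupport S))).card ≤ 2 * m + 2 := by
        have c1 := card_pairSupport_le S
        have c2 := Finset.card_insert_le j (pairSupport S)
        have c3 := Finset.card_insert_le i (insert j (pairSupport S))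
        omega
      have hUN : 2 * (4 * t + 2) * (1 + (insert i (insert j (pairSupport S))).card) ≤ N := by
        have : 2 * (4 * t + 2) * (1 + (insert i (insert j (pairSupport S))).card) ≤
          2 * (4 * t + 2) * (2 * m + 3) := Nat.mul_le_mul_left _ (by omega)
        omega
      refine (abs_pathCorr_le hN hdN (U := insert i (insert j (pairSupport S)))
        (fun v hv => by simp [hv]) (by simp) (by simp) hUN ?_ hext.nodup hext.notMem).trans ?_
      · rw [hlen, hL]
        simp only [List.length_nil]
        ring
      · rw [hc]
        refine mul_le_mul_of_nonneg_left (le_trans ?_ (H₁ N d hd hdN)) (by positivity)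
        refine uniformRegularExpectation_mono fun G _ => ?_
        have := fourthTrace_nonneg (centredMatrix N d G)
        have h0 : 0 ≤ 1 / (N : ℝ) := by positivity
        gcongr
        linarith)
    refine h1.trans ?_
    rw [hrew, add_mul]
    refine add_le_add le_rfl ?_
    set p := edgeDensity N d
    have key : (1 / p) ^ L * (1 / (p * N)) ^ t ≤ W := by
      have k1 : (1 / (N : ℝ)) ^ (n + 1) * p ^ m ≤ W := by
        rw [hweq]
        refine mul_le_mul (pow_le_pow_left₀ (by positivity) hsinv _) ?_ (by positivity)
          (by positivity)
        exact pow_le_pow_of_le_one hppos.le (by linarith) (by omega)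
      refine le_trans ?_ k1
      have k2 : (1 / p) ^ L * (1 / (p * N)) ^ t = 1 / (p ^ (L + t) * N ^ t) := by
        rw [one_div_pow, one_div_pow, mul_pow, pow_add]
        field_simp
      rw [k2, one_div_pow, div_le_iff₀ (by positivity), ht]
      have k3 : 1 / (N : ℝ) ^ (n + 1) * p ^ m * (p ^ (L + (n + 2)) * N ^ (n + 2)) =
          N * p ^ E := by
        rw [hE, ht, pow_succ (N : ℝ) (n + 1), pow_add p (L + (n + 2)) m]
        field_simp
      rw [k3]
      exact hdense
    calc (2 / p) ^ L * (c * (C₁ * (1 / (p * N)) ^ t))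
        = 2 ^ L * (c * C₁) * ((1 / p) ^ L * (1 / (p * N)) ^ t) := by
          rw [div_eq_mul_one_div 2 p, mul_pow]
          ring
      _ ≤ _ := by gcongr
  · refine le_trans ?_ (hsum _ (Or.inl le_rfl))
    have h1 := hiter R le_rfl (C₀ * edgeDensity N d ^ (m + 2 * R + 1)) (by
      intro f' a' T' hext hlen
      have hcard : (insert s(i, a') T').card = m + 2 * R + 1 := by
        rw [Finset.card_insert_of_notMem hext.edge_notMem, hext.card_eq, hlen, hSc]
        simp
      have := H₀ N d hd hdN (insert s(i, a') T') (by
        intro e he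
        rcases Finset.mem_insert.1 he with rfl | he
        · simpa using hext.ne
        · exact hext.not_isDiag e he) hcard
      simpa [corrWeight] using this)
    refine h1.trans ?_
    rw [hrew, add_mul]
    refine add_le_add le_rfl ?_
    rw [not_le] at hdense
    set p := edgeDensity N d
    have hp1 : p ≤ 1 := by linarith
    -- The a priori bound `p^(m + 2R + 1)` on the final graph has lost `p^R` to the replacements.
    have key : p ^ (m + R + 1) ≤ W := by
      have k1 : p ^ E ≤ 1 / N := by
        rw [le_div_iff₀ hNpos, mul_comm]
        exact hdense.le
      rw [hweq]
      calc p ^ (m + R + 1) ≤ p ^ (R + (m - n)) :=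
            pow_le_pow_of_le_one hppos.le hp1 (by omega)
        _ = (p ^ E) ^ (n + 1) * p ^ (m - n) := by rw [← pow_mul, ← hR, pow_add]
        _ ≤ _ := by
            gcongr
            exact k1.trans hsinv
    calc (2 / p) ^ R * (C₀ * p ^ (m + 2 * R + 1)) = 2 ^ R * C₀ * p ^ (m + R + 1) := by
          rw [div_pow, show m + 2 * R + 1 = R + (m + R + 1) by ring, pow_add p R]
          field_simp
      _ ≤ _ := by gcongr

theorem corrBound (n m : ℕ) : CorrBound n m := by
  induction n generalizing m with
  | zero => exact corrBound_zero m
  | succ n ih => exact corrBound_succ ih m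

/-- The bound `(√d / N) ^ n` for correlations of `n` edges, in both halves of the range of
degrees. -/
theorem exists_abs_corr_le (n : ℕ) : ∃ C : ℝ, ∀ N d : ℕ, 1 ≤ d → d + 2 ≤ N →
    ∀ T : Finset (Sym2 (Fin N)), (∀ e ∈ T, ¬ e.IsDiag) → T.card = n →
      |corr N d T| ≤ C * corrScale N d ^ n := by
  obtain ⟨C, hC, H⟩ := corrBound n n
  refine ⟨C, fun N d hd hdN T hT hn => ?_⟩
  have hw : ∀ s p : ℝ, corrWeight s p n n = s ^ n := by
    intro s p
    simp [corrWeight]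
  by_cases h : 2 * d ≤ N - 1
  · have := H N d hd h T hT hn
    rwa [hw] at this
  -- In the dense half the complement has degree `N - 1 - d ≤ d`, positive because `d + 2 ≤ N`, and
  -- hence a smaller scale.
  · have := H N (N - 1 - d) (by omega) (by omega) T hT hn
    rw [hw, ← corr_compl (by omega) (by omega) hT] at this
    refine this.trans ?_
    have hle : corrScale N (N - 1 - d) ≤ corrScale N d := by
      unfold corrScale
      gcongr
      omega
    have := corrScale_nonneg (N := N) (d := N - 1 - d)
    gcongr

end MainBound

/-! ### Conclusion: injective labellings and the scale `(d/N) * d^(-1/2) = √d/N`. -/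

theorem theorem2p3 (d : ℕ → ℕ)
    (hd : ∀ N : ℕ, 2 ≤ N → 1 ≤ d N ∧ d N ≤ N - 1 ∧ Even (d N * N))
    (η : ℝ)
    (hd_top : Tendsto (fun N : ℕ => (d N : ℝ)) atTop atTop)
    (hNd_top : Tendsto (fun N : ℕ => (N : ℝ) - (d N : ℝ)) atTop atTop)
    (hη_top : Tendsto (fun N : ℕ => |(N : ℝ) / 2 - (d N : ℝ) - η * Real.sqrt (d N : ℝ)|)
      atTop atTop)
    {V : Type*} [Finite V] (T : SimpleGraph V) (n : ℕ) (hn : T.edgeSet.ncard = n) :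
    ∃ C : ℝ, ∀ᶠ N : ℕ in atTop, ∀ φ : V ↪ Fin N,
      |edgeCorrelation N (d N) (T.map φ)| ≤
        ((d N : ℝ) / (N : ℝ)) ^ n * (C * (d N : ℝ) ^ (-((n : ℝ) / 2))) := by
  classical
  obtain ⟨C, hC⟩ := exists_abs_corr_le n
  refine ⟨C, ?_⟩
  filter_upwards [hNd_top.eventually_ge_atTop 2, eventually_ge_atTop 2] with N hN2 hN φ
  have hd1 := (hd N hN).1
  have hdN : d N + 2 ≤ N := by
    have : ((d N + 2 : ℕ) : ℝ) ≤ N := by push_cast; linarith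
    exact_mod_cast this
  have hcard : (T.map φ).edgeFinset.card = n := by
    rw [← hn, ← Set.ncard_coe_finset, SimpleGraph.coe_edgeFinset, SimpleGraph.edgeSet_map]
    exact Set.ncard_image_of_injective _ (Function.Embedding.injective _)
  have hdiag : ∀ e ∈ (T.map φ).edgeFinset, ¬ e.IsDiag := fun e he =>
    (T.map φ).not_isDiag_of_mem_edgeFinset he
  have h := hC N (d N) hd1 hdN _ hdiag hcard
  rw [edgeCorrelation_eq_corr hN]
  refine h.trans (le_of_eq ?_)
  have hd0 : (0 : ℝ) < d N := by exact_mod_cast hd1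
  have hpow : (d N : ℝ) ^ (-((n : ℝ) / 2)) = (1 / √(d N : ℝ)) ^ n := by
    rw [Real.rpow_neg hd0.le, one_div, inv_pow, Real.sqrt_eq_rpow, ← Real.rpow_natCast,
      ← Real.rpow_mul hd0.le]
    congr 2
    ring
  rw [hpow, mul_left_comm, ← mul_pow]
  congr 2
  unfold corrScale
  have hs0 : 0 < √(d N : ℝ) := Real.sqrt_pos.2 hd0
  have hN0 : (0 : ℝ) < N := by
    have : 0 < N := by omega
    exact_mod_cast this
  field_simp
  exact Real.sq_sqrt hd0.le
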